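/- Let $X$ be a complex manifold (Hausdorff, second countable, of pure finite dimension). A current on $X$ of dimension $2$ is a continuous linear functional on the smooth complex-valued $2$-forms with compact support, and $\mathrm{Psh}^0(X)$ denotes the set of continuous plurisubharmonic functions on $X$. A current $T$ on $X$ is called a Levi current if it is non-zero, of bidimension $(1,1)$, positive, $i\partial\bar\partial T=0$, and $T\wedge i\partial\bar\partial v=0$ for every $v\in \mathrm{Psh}^0(X)$, where $T\wedge i\partial\bar\partial v$ is defined locally as the limit of $T\wedge i\partial\bar\partial v_j$ for smooth plurisubharmonic $v_j$ converging locally uniformly to $v$. Let $T$ be a Levi current on $X$ and let $u\in \mathrm{Psh}^0(X)$. Then there exist a locally finite positive Borel measure $\mu$ on $\mathbb R$ and currents $T_c$ $(c\in\mathbb R)$ of dimension $2$ on $X$ such that: 1. for every $c\in\mathbb R$, $T_c$ is supported on $Y_c=\{x\in X : u(x)=c\}$; 2. $T_c\neq 0$ for $\mu$-almost every $c\in\mathbb R$; 3. for every $c\in\mathbb R$, if $T_c\ne 0$, then $T_c$ is a Levi current; 4. for every smooth complex-valued $2$-form $\alpha$ with compact support on $X$, the function $c\mapsto\langle T_c,\alpha\rangle$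 is $\mu$-integrable and $$\langle T,\alpha\rangle=\int_{\mathbb R}\langle T_c,\alpha\rangle\,d\mu(c);$$ 5. if moreover $u$ is of class $C^1$, then for every regular value $c$ of $u$ there is a current $S_c$ of dimension $2$ on the real $C^1$ hypersurface $Y_c$ (a continuous linear functional on the continuous $2$-forms with compact support on $Y_c$) such that $T_c=j_*S_c$, where $j:Y_c\to X$ is the inclusion, i.e. $\langle T_c,\alpha\rangle=\langle S_c,j^*\alpha\rangle$ for every such $\alpha$. -/

import Mathlib

open scoped Manifold ContDiff Topology
open Set Filter

namespace LeviCurrents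

noncomputable section

section Flat

variable {E : Type*} [NormedAddCommGroup E] [NormedSpace ℂ E]

/-- Multiplication by `i`, the complex structure of `E`, as a real linear map. -/
def mulI : E →L[ℝ] E :=
  (Complex.I • ContinuousLinearMap.id ℂ E).restrictScalars ℝ

/-- The `(0,1)`-form `∂̄f = (df + i df ∘ J) / 2` of a function on (an open subset of) the complex
vector space `E`, where `J` is the multiplication by `i`. -/
def dbar (f : E → ℂ) (z : E) : E [⋀^Fin 1]→L[ℝ] ℂ :=
  ContinuousAlternatingMap.ofSubsingleton ℝ E ℂ 0
    ((1 / 2 : ℂ) • (fderiv ℝ f z + Complex.I • (fderiv ℝ f z).comp mulI))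

/-- The `2`-form `i∂∂̄f = i d(∂̄f)` of a function on (an open subset of) `E`. -/
def iddbarFlat (f : E → ℂ) (z : E) : E [⋀^Fin 2]→L[ℝ] ℂ :=
  Complex.I • extDeriv (dbar f) z

theorem contDiffOn_fderiv_aux {F : Type*} [NormedAddCommGroup F] [NormedSpace ℝ F]
    {f : E → F} {s : Set E} (hs : IsOpen s)
    (hf : ContDiffOn ℝ ∞ f s) : ContDiffOn ℝ ∞ (fderiv ℝ f) s :=
  hf.fderiv_of_isOpen hs (by simp)

theorem contDiffOn_dbar {f : E → ℂ} {s : Set E} (hs : IsOpen s)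
    (hf : ContDiffOn ℝ ∞ f s) : ContDiffOn ℝ ∞ (dbar f) s := by
  have h := contDiffOn_fderiv_aux hs hf
  have h2 : ContDiffOn ℝ ∞ (fun z => (1 / 2 : ℂ) • (fderiv ℝ f z +
      Complex.I • (fderiv ℝ f z).comp (mulI (E := E)))) s :=
    (h.add ((h.clm_comp contDiffOn_const).const_smul Complex.I)).const_smul (1 / 2 : ℂ)
  exact (ContinuousAlternatingMap.ofSubsingletonLIE (𝕜 := ℝ) (E := E) (F := ℂ)
    (0 : Fin 1)).toContinuousLinearEquiv.contDiff.comp_contDiffOn h2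

theorem contDiffOn_iddbarFlat {f : E → ℂ} {s : Set E} (hs : IsOpen s)
    (hf : ContDiffOn ℝ ∞ f s) : ContDiffOn ℝ ∞ (iddbarFlat f) s := by
  have h1 : ContDiffOn ℝ ∞ (fderiv ℝ (dbar f)) s :=
    contDiffOn_fderiv_aux hs (contDiffOn_dbar hs hf)
  have h2 : ContDiffOn ℝ ∞ (extDeriv (dbar f)) s := by
    have h3 := (ContinuousAlternatingMap.alternatizeUncurryFinCLM ℝ E ℂ
      (n := 1)).contDiff.comp_contDiffOn (n := ∞) h1
    refine h3.congr fun z _ => ?_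
    simp only [Function.comp, ContinuousAlternatingMap.alternatizeUncurryFinCLM_apply]
    rfl
  exact h2.const_smul Complex.I

theorem dbar_congr {f g : E → ℂ} {z : E} (h : f =ᶠ[𝓝 z] g) : dbar f =ᶠ[𝓝 z] dbar g := by
  filter_upwards [h.fderiv (𝕜 := ℝ)] with y hy
  simp only [dbar, hy]

theorem iddbarFlat_congr {f g : E → ℂ} {z : E} (h : f =ᶠ[𝓝 z] g) :
    iddbarFlat f z = iddbarFlat g z := by
  simp only [iddbarFlat, (dbar_congr h).extDeriv_eq]

/-- `i∂∂̄` commutes with the pull-back by holomorphic maps. -/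
theorem iddbarFlat_comp {F : E → ℂ} {g : E → E} {z : E} (hg : ContDiffAt ℂ ω g z)
    {s : Set E} (hso : IsOpen s) (hzs : g z ∈ s) (hs : ContDiffOn ℝ ∞ F s) :
    iddbarFlat (F ∘ g) z = (iddbarFlat F (g z)).compContinuousLinearMap (fderiv ℝ g z) := by
  have hgc : ContinuousAt g z := hg.continuousAt
  have h1 : ∀ᶠ y in 𝓝 z, ContDiffAt ℂ ω g y := hg.eventually (by simp)
  have h2 : ∀ᶠ y in 𝓝 z, ContDiffAt ℝ ∞ F (g y) := by
    filter_upwards [hgc.preimage_mem_nhds (hso.mem_nhds hzs)] with y hy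
    exact hs.contDiffAt (hso.mem_nhds hy)
  have key : dbar (F ∘ g) =ᶠ[𝓝 z]
      fun y => (dbar F (g y)).compContinuousLinearMap (fderiv ℝ g y) := by
    filter_upwards [h1, h2] with y hy1 hy2
    have d1 : DifferentiableAt ℂ g y := hy1.differentiableAt (by simp)
    have e1 : fderiv ℝ g y = (fderiv ℂ g y).restrictScalars ℝ := d1.fderiv_restrictScalars ℝ
    have d2 : DifferentiableAt ℝ F (g y) := hy2.differentiableAt (by simp)
    have d3 : DifferentiableAt ℝ g y := d1.restrictScalars ℝ
    ext v
    simp [dbar, fderiv_comp y d2 d3, e1, mulI]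
  have hd : DifferentiableAt ℝ (dbar F) (g z) :=
    ((contDiffOn_dbar hso hs).contDiffAt (hso.mem_nhds hzs)).differentiableAt (by simp)
  have hg2 : ContDiffAt ℝ ω g z := hg.restrict_scalars ℝ
  rw [iddbarFlat, key.extDeriv_eq, extDeriv_pullback hd hg2 (by simp)]
  rfl

end Flat

section Manifold

variable {E : Type*} [NormedAddCommGroup E] [NormedSpace ℂ E]
variable {X : Type*} [TopologicalSpace X] [ChartedSpace E X]

theorem contDiffOn_transition [IsManifold 𝓘(ℂ, E) ω X] {e e' : OpenPartialHomeomorph X E}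
    (he : e ∈ atlas E X) (he' : e' ∈ atlas E X) :
    ContDiffOn ℂ ω (e' ∘ e.symm) (e.symm ≫ₕ e').source := by
  have h := ((contDiffGroupoid ω 𝓘(ℂ, E)).compatible he he').1
  simpa [contDiffPregroupoid] using h

/-- The underlying real manifold of a complex manifold. -/
theorem isManifold_real (E : Type*) [NormedAddCommGroup E] [NormedSpace ℂ E]
    (X : Type*) [TopologicalSpace X] [ChartedSpace E X]
    [IsManifold 𝓘(ℂ, E) ω X] : IsManifold 𝓘(ℝ, E) ∞ X := by
  refine isManifold_of_contDiffOn _ _ _ fun e e' he he' => ?_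
  have h := (contDiffOn_transition (X := X) he he').restrict_scalars ℝ
  simpa using h.of_le le_top

variable (E X) in
/-- (Not necessarily continuous) complex valued real `2`-forms on the complex manifold `X`. As usual
in Mathlib, the tangent space of `X` at `x` is `E`, by means of the preferred chart at `x`; its
complex structure is the multiplication by `i` of `E`. -/
abbrev TwoForm := X → E [⋀^Fin 2]→L[ℝ] ℂ

/-- The expression in the chart `e` of a `2`-form, i.e. its pull-back by `e⁻¹`. -/
def TwoForm.inChart (α : TwoForm E X) (e : OpenPartialHomeomorph X E) (z : E) :
    E [⋀^Fin 2]→L[ℝ] ℂ :=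
  (α (e.symm z)).compContinuousLinearMap (mfderiv 𝓘(ℝ, E) 𝓘(ℝ, E) e.symm z)

theorem TwoForm.inChart_add (α β : TwoForm E X) (e : OpenPartialHomeomorph X E) :
    (α + β).inChart e = α.inChart e + β.inChart e := rfl

theorem TwoForm.inChart_smul (a : ℂ) (α : TwoForm E X) (e : OpenPartialHomeomorph X E) :
    TwoForm.inChart (a • α) e = a • α.inChart e := rfl

variable (E X) in
/-- The space `𝒟²(X)` of smooth complex valued `2`-forms with compact support. -/
def testForms : Submodule ℂ (TwoForm E X) where
  carrier := {α | (∀ e ∈ atlas E X, ContDiffOn ℝ ∞ (α.inChart e) e.target) ∧ HasCompactSupport α}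
  add_mem' := fun ha hb => ⟨fun e he => (ha.1 e he).add (hb.1 e he), ha.2.add hb.2⟩
  zero_mem' := ⟨fun _ _ => contDiffOn_const (c := 0), HasCompactSupport.zero⟩
  smul_mem' := fun a _ hα => ⟨fun e he => (hα.1 e he).const_smul a, hα.2.smul_left (f := fun _ => a)⟩

theorem mem_testForms {α : TwoForm E X} : α ∈ testForms E X ↔
    (∀ e ∈ atlas E X, ContDiffOn ℝ ∞ (α.inChart e) e.target) ∧ HasCompactSupport α := Iff.rfl

/-- The `2`-form `i∂∂̄f` of a function on `X`. -/
def iddbar (f : X → ℂ) : TwoForm E X :=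
  fun x => iddbarFlat (f ∘ (chartAt E x).symm) (chartAt E x x)

/-- Smooth complex valued functions with compact support. -/
structure IsTestFunction (E : Type*) [NormedAddCommGroup E] [NormedSpace ℂ E]
    {X : Type*} [TopologicalSpace X] [ChartedSpace E X] (φ : X → ℂ) : Prop where
  smooth : ContMDiff 𝓘(ℝ, E) 𝓘(ℝ, ℂ) ∞ φ
  compact : HasCompactSupport φ

theorem contDiffOn_comp_symm [IsManifold 𝓘(ℂ, E) ω X] {f : X → ℂ} {U : Set X}
    (hf : ContMDiffOn 𝓘(ℝ, E) 𝓘(ℝ, ℂ) ∞ f U) {e : OpenPartialHomeomorph X E}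
    (he : e ∈ atlas E X) : ContDiffOn ℝ ∞ (f ∘ e.symm) (e.target ∩ e.symm ⁻¹' U) := by
  have := isManifold_real E X
  rw [← contMDiffOn_iff_contDiffOn]
  exact hf.comp ((contMDiffOn_symm_of_mem_maximalAtlas
    (IsManifold.subset_maximalAtlas he)).mono inter_subset_left) fun z hz => hz.2

theorem mfderiv_symm_eq [IsManifold 𝓘(ℂ, E) ω X] {e : OpenPartialHomeomorph X E}
    (he : e ∈ atlas E X) {z : E} (hz : z ∈ e.target) :
    mfderiv 𝓘(ℝ, E) 𝓘(ℝ, E) e.symm z = fderiv ℝ (chartAt E (e.symm z) ∘ e.symm) z := by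
  have := isManifold_real E X
  have : IsManifold 𝓘(ℝ, E) 1 X := .of_le (n := ∞) (by simp)
  have h := mdifferentiableAt_atlas_symm (I := 𝓘(ℝ, E)) he hz
  obtain ⟨L, hL⟩ : ∃ L : E →L[ℝ] E, L = mfderiv 𝓘(ℝ, E) 𝓘(ℝ, E) e.symm z := ⟨_, rfl⟩
  have h2 : HasFDerivWithinAt (chartAt E (e.symm z) ∘ e.symm) L (range 𝓘(ℝ, E)) z :=
    hL ▸ h.hasMFDerivAt.2
  rw [ModelWithCorners.range_eq_univ, hasFDerivWithinAt_univ] at h2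
  rw [← hL, h2.fderiv]

/-- In each chart `e`, the form `i∂∂̄f` is the form `i∂∂̄(f ∘ e⁻¹)`. -/
theorem iddbar_inChart [IsManifold 𝓘(ℂ, E) ω X] {f : X → ℂ} {U : Set X} (hU : IsOpen U)
    (hf : ContMDiffOn 𝓘(ℝ, E) 𝓘(ℝ, ℂ) ∞ f U) {e : OpenPartialHomeomorph X E}
    (he : e ∈ atlas E X) {z : E} (hz : z ∈ e.target) (hzU : e.symm z ∈ U) :
    TwoForm.inChart (iddbar f) e z = iddbarFlat (f ∘ e.symm) z := by
  set c := chartAt E (e.symm z) with hc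
  have hca : c ∈ atlas E X := chart_mem_atlas E _
  have hsrc : z ∈ (e.symm ≫ₕ c).source := by
    simp [hz, hc]
  have hg : ContDiffAt ℂ ω (c ∘ e.symm) z :=
    (contDiffOn_transition he hca).contDiffAt ((e.symm ≫ₕ c).open_source.mem_nhds hsrc)
  have hzc : (c ∘ e.symm) z ∈ c.target ∩ c.symm ⁻¹' U := by
    refine ⟨c.map_source (mem_chart_source E _), ?_⟩
    simpa [hc] using hzU
  have h := iddbarFlat_comp hg (c.isOpen_inter_preimage_symm hU) hzc (contDiffOn_comp_symm hf hca)
  have hcongr : (f ∘ e.symm) =ᶠ[𝓝 z] ((f ∘ c.symm) ∘ (c ∘ e.symm)) := by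
    filter_upwards [(e.symm ≫ₕ c).open_source.mem_nhds hsrc] with y hy
    have : e.symm y ∈ c.source := by simpa using hy.2
    simp [c.left_inv this]
  rw [iddbarFlat_congr hcongr, h, TwoForm.inChart, mfderiv_symm_eq he hz]
  rfl

theorem contDiffOn_iddbar_inChart [IsManifold 𝓘(ℂ, E) ω X] {f : X → ℂ} {U : Set X}
    (hU : IsOpen U) (hf : ContMDiffOn 𝓘(ℝ, E) 𝓘(ℝ, ℂ) ∞ f U) {e : OpenPartialHomeomorph X E}
    (he : e ∈ atlas E X) :
    ContDiffOn ℝ ∞ (TwoForm.inChart (iddbar f) e) (e.target ∩ e.symm ⁻¹' U) :=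
  (contDiffOn_iddbarFlat (e.isOpen_inter_preimage_symm hU) (contDiffOn_comp_symm hf he)).congr
    fun _ hz => iddbar_inChart hU hf he hz.1 hz.2

/-- For `f` smooth on the open set `U` and a test function `φ` supported in `U`, the form
`φ i∂∂̄f`, extended by zero, is a test form. -/
theorem smul_iddbar_mem [IsManifold 𝓘(ℂ, E) ω X] {f φ : X → ℂ} {U : Set X} (hU : IsOpen U)
    (hf : ContMDiffOn 𝓘(ℝ, E) 𝓘(ℝ, ℂ) ∞ f U) (hφ : IsTestFunction E φ) (hφU : tsupport φ ⊆ U) :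
    (fun x => φ x • (iddbar f x : E [⋀^Fin 2]→L[ℝ] ℂ)) ∈ testForms E X := by
  refine mem_testForms.2 ⟨fun e he z hz => ?_, hφ.compact.mono fun x hx h0 => hx ?_⟩
  swap
  · ext v
    simp only [h0]
    exact zero_mul _
  by_cases h : e.symm z ∈ U
  · have hn : e.target ∩ e.symm ⁻¹' U ∈ 𝓝 z := (e.isOpen_inter_preimage_symm hU).mem_nhds ⟨hz, h⟩
    have h1 : ContDiffAt ℝ ∞ (φ ∘ e.symm) z :=
      (contDiffOn_comp_symm (X := X) (f := φ) (U := U)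
        (ContMDiff.contMDiffOn hφ.smooth) he).contDiffAt hn
    have h2 : ContDiffAt ℝ ∞ (TwoForm.inChart (iddbar f) e) z :=
      (contDiffOn_iddbar_inChart hU hf he).contDiffAt hn
    have h3 : TwoForm.inChart (fun x => φ x • (iddbar f x : E [⋀^Fin 2]→L[ℝ] ℂ)) e =
        fun y => (φ ∘ e.symm) y • TwoForm.inChart (iddbar f) e y := by
      funext y
      ext v
      rfl
    rw [h3]
    exact (ContDiffAt.smul h1 h2).contDiffWithinAt
  · have hn : e.target ∩ e.symm ⁻¹' (tsupport φ)ᶜ ∈ 𝓝 z :=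
      (e.isOpen_inter_preimage_symm (isClosed_tsupport φ).isOpen_compl).mem_nhds
        ⟨hz, fun h' => h (hφU h')⟩
    refine ContDiffAt.contDiffWithinAt ((contDiffAt_const (c := 0)).congr_of_eventuallyEq ?_)
    filter_upwards [hn] with y hy
    have : φ (e.symm y) = 0 := image_eq_zero_of_notMem_tsupport hy.2
    ext v
    simp only [TwoForm.inChart, this]
    exact zero_mul _

/-- For a test function `φ`, the form `i∂∂̄φ` is a test form. -/
theorem iddbar_mem [IsManifold 𝓘(ℂ, E) ω X] {φ : X → ℂ} (hφ : IsTestFunction E φ) :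
    (iddbar φ : TwoForm E X) ∈ testForms E X := by
  refine mem_testForms.2 ⟨fun e he => ?_, ?_⟩
  · simpa using contDiffOn_iddbar_inChart isOpen_univ hφ.smooth.contMDiffOn he
  · refine hφ.compact.mono' fun x hx => ?_
    by_contra h
    refine hx ?_
    have h0 : φ =ᶠ[𝓝 x] fun _ => 0 := notMem_tsupport_iff_eventuallyEq.1 h
    have h1 : φ ∘ (chartAt E x).symm =ᶠ[𝓝 (chartAt E x x)] fun _ => 0 := by
      have ht : Tendsto (chartAt E x).symm (𝓝 (chartAt E x x)) (𝓝 x) := by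
        have := (chartAt E x).continuousAt_symm (mem_chart_target E x)
        rwa [ContinuousAt, (chartAt E x).left_inv (mem_chart_source E x)] at this
      exact ht.eventually h0
    rw [iddbar, iddbarFlat_congr h1]
    have h2 : dbar (fun _ : E => (0 : ℂ)) = fun _ => 0 := by
      funext z
      ext v
      simp [dbar]
    have h3 : extDeriv (fun _ : E => (0 : E [⋀^Fin 1]→L[ℝ] ℂ)) (chartAt E x x) = 0 := by
      rw [extDeriv, fderiv_fun_const]
      exact (ContinuousAlternatingMap.alternatizeUncurryFinCLM ℝ E ℂ (n := 1)).map_zero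
    rw [iddbarFlat, h2, h3, smul_zero]

variable (E X) in
/-- Currents of dimension `2` on `X`: linear functionals on `𝒟²(X)` which are continuous, i.e.
`T α_j → 0` whenever the supports of the `α_j` are all contained in a compact set and
the `α_j` tend to `0` locally uniformly with all their derivatives. -/
structure Current where
  toFun : testForms E X →ₗ[ℂ] ℂ
  continuous' : ∀ (K : Set X) (α : ℕ → testForms E X), IsCompact K →
    (∀ j, tsupport (α j : TwoForm E X) ⊆ K) →
    (∀ e ∈ atlas E X, ∀ L ⊆ e.target, IsCompact L → ∀ k : ℕ,
      TendstoUniformlyOn (fun j => iteratedFDeriv ℝ k (TwoForm.inChart (α j) e)) 0 atTop L) →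
    Tendsto (fun j => toFun (α j)) atTop (𝓝 0)

namespace Current

instance : CoeFun (Current E X) (fun _ => testForms E X → ℂ) := ⟨fun T => T.toFun⟩

instance : Zero (Current E X) := ⟨⟨0, fun _ _ _ _ _ => tendsto_const_nhds⟩⟩

/-- The support of a current: the complement of the largest open set on which it vanishes. -/
def support (T : Current E X) : Set X :=
  {x | ∀ U : Set X, IsOpen U → x ∈ U →
    ∃ α : testForms E X, tsupport (α : TwoForm E X) ⊆ U ∧ T α ≠ 0}

/-- `T` is of bidimension `(1,1)`: it vanishes on the forms of bidegree `(2,0)` and `(0,2)`. -/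
def IsBidimOneOne (T : Current E X) : Prop :=
  ∀ α : testForms E X,
    ((∀ x, ∀ v w : E, α.1 x ![Complex.I • v, w] = Complex.I * α.1 x ![v, w]) ∨
      (∀ x, ∀ v w : E, α.1 x ![Complex.I • v, w] = -Complex.I * α.1 x ![v, w])) → T α = 0

end Current

/-- The form `α` is at `x` a positive form of bidegree `(1,1)`: it is invariant under the complex
structure `J`, and `α(v, Jv)` is real and nonnegative for all tangent vectors `v`. -/
def TwoForm.IsPositiveAt (α : TwoForm E X) (x : X) : Prop :=
  (∀ v w : E, α x ![Complex.I • v, Complex.I • w] = α x ![v, w]) ∧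
    ∀ v : E, 0 ≤ (α x ![v, Complex.I • v]).re ∧ (α x ![v, Complex.I • v]).im = 0

/-- A current (of bidimension `(1,1)`) is positive if it is nonnegative on the positive
`(1,1)`-forms. -/
def Current.IsPositive (T : Current E X) : Prop :=
  ∀ α : testForms E X, (∀ x, TwoForm.IsPositiveAt (α : TwoForm E X) x) →
    0 ≤ (T α).re ∧ (T α).im = 0

variable (E) in
/-- `u ∈ Psh⁰(X)`: `u` is continuous and plurisubharmonic, i.e. it satisfies the sub-mean value
inequality on all holomorphic discs (maps which are holomorphic near the closed unit disc). -/
structure IsPshZero (u : X → ℝ) : Prop where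
  continuous : Continuous u
  submean : ∀ (f : ℂ → X) (r : ℝ), 1 < r →
    MDifferentiableOn 𝓘(ℂ, ℂ) 𝓘(ℂ, E) f (Metric.ball 0 r) →
    u (f 0) ≤ Real.circleAverage (fun z => u (f z)) 0 1

variable (E) in
/-- `w` is smooth and plurisubharmonic on the open set `U`, i.e. `i∂∂̄w ≥ 0` on `U`. -/
structure IsSmoothPshOn (w : X → ℝ) (U : Set X) : Prop where
  smooth : ContMDiffOn 𝓘(ℝ, E) 𝓘(ℝ, ℝ) ∞ w U
  nonneg : ∀ x ∈ U, TwoForm.IsPositiveAt (iddbar (fun y => (w y : ℂ)) : TwoForm E X) x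

theorem IsSmoothPshOn.smooth_ofReal {w : X → ℝ} {U : Set X} (hw : IsSmoothPshOn E w U) :
    ContMDiffOn 𝓘(ℝ, E) 𝓘(ℝ, ℂ) ∞ (fun y => (w y : ℂ)) U :=
  (Complex.ofRealCLM.contDiff.contMDiff (n := ∞)).comp_contMDiffOn hw.smooth

/-- The test form `i∂∂̄φ`, for `φ` a test function. -/
def ddbarForm [IsManifold 𝓘(ℂ, E) ω X] (φ : X → ℂ) (hφ : IsTestFunction E φ) : testForms E X :=
  ⟨iddbar φ, iddbar_mem hφ⟩

/-- The test form `φ i∂∂̄w`, for `w` smooth plurisubharmonic on `U` and `φ` a test function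
supported in `U`. -/
def smulDdbarForm [IsManifold 𝓘(ℂ, E) ω X] (φ : X → ℂ) (w : X → ℝ) {U : Set X} (hU : IsOpen U)
    (hw : IsSmoothPshOn E w U) (hφ : IsTestFunction E φ) (hφU : tsupport φ ⊆ U) :
    testForms E X :=
  ⟨fun x => φ x • iddbar (fun y => (w y : ℂ)) x, smul_iddbar_mem hU hw.smooth_ofReal hφ hφU⟩

/-- `T ∧ i∂∂̄u = S`, for `u` continuous and plurisubharmonic and `S` a functional on test functions:
as usual, `T ∧ i∂∂̄u` is the limit of `T ∧ i∂∂̄u_j` on each open set `U`, for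
any sequence of smooth plurisubharmonic functions `u_j` on `U` that converges to `u` locally
uniformly on `U`. (Such sequences exist near every point, by convolution in a chart.) -/
def Current.IsWedgeDdbar [IsManifold 𝓘(ℂ, E) ω X] (T : Current E X) (u : X → ℝ)
    (S : (X → ℂ) → ℂ) : Prop :=
  ∀ (U : Set X) (hU : IsOpen U) (w : ℕ → X → ℝ) (hw : ∀ j, IsSmoothPshOn E (w j) U),
    TendstoLocallyUniformlyOn w u atTop U →
    ∀ (φ : X → ℂ) (hφ : IsTestFunction E φ) (hφU : tsupport φ ⊆ U),
      Tendsto (fun j => T (smulDdbarForm φ (w j) hU (hw j) hφ hφU)) atTop (𝓝 (S φ))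

/-- Levi currents. -/
structure Current.IsLevi [IsManifold 𝓘(ℂ, E) ω X] (T : Current E X) : Prop where
  ne_zero : T ≠ 0
  bidim : T.IsBidimOneOne
  pos : T.IsPositive
  ddbar_closed : ∀ (φ : X → ℂ) (hφ : IsTestFunction E φ), T (ddbarForm φ hφ) = 0
  wedge_eq_zero : ∀ u : X → ℝ, IsPshZero E u → T.IsWedgeDdbar u 0

section LevelSets

variable (E) in
/-- The tangent space at `x` of the level set of `u` through `x`, when `x` is a regular point
of `u`. -/
def levelTangent (u : X → ℝ) (x : X) : Submodule ℝ E :=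
  LinearMap.ker (mfderiv 𝓘(ℝ, E) 𝓘(ℝ, ℝ) u x : E →L[ℝ] ℝ).toLinearMap

variable (E) in
/-- `c` is a regular value of the function `u`. -/
def IsRegularValue (u : X → ℝ) (c : ℝ) : Prop :=
  ∀ x, u x = c → Function.Surjective (mfderiv 𝓘(ℝ, E) 𝓘(ℝ, ℝ) u x : E →L[ℝ] ℝ)

variable (E) in
/-- (Not necessarily continuous) complex valued `2`-forms on the hypersurface `Y_c = {u = c}`. -/
abbrev LevelTwoForm (u : X → ℝ) (c : ℝ) :=
  ∀ y : {x : X // u x = c}, levelTangent E u y.1 [⋀^Fin 2]→L[ℝ] ℂ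

/-- Points of `Y_c` in the domain of the chart `e` of `X` and pairs of
vectors tangent to `Y_c` there, read in the chart `e`: the triples `(z, v, w)` with `e⁻¹(z) ∈ Y_c`
such that `d(e⁻¹)_z v` and `d(e⁻¹)_z w` are tangent to `Y_c`. -/
def LevelPairs (u : X → ℝ) (c : ℝ) (e : OpenPartialHomeomorph X E) : Type _ :=
  {p : E × E × E // p.1 ∈ e.target ∧ u (e.symm p.1) = c ∧
    (mfderiv 𝓘(ℝ, E) 𝓘(ℝ, E) e.symm p.1 : E →L[ℝ] E) p.2.1 ∈ levelTangent E u (e.symm p.1) ∧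
    (mfderiv 𝓘(ℝ, E) 𝓘(ℝ, E) e.symm p.1 : E →L[ℝ] E) p.2.2 ∈ levelTangent E u (e.symm p.1)}

instance (u : X → ℝ) (c : ℝ) (e : OpenPartialHomeomorph X E) : TopologicalSpace (LevelPairs u c e) :=
  inferInstanceAs (TopologicalSpace {_p : E × E × E // _})

/-- The evaluation of a `2`-form of `Y_c` on pairs of tangent vectors, in the chart `e`. -/
def LevelTwoForm.inChart {u : X → ℝ} {c : ℝ} (β : LevelTwoForm E u c)
    (e : OpenPartialHomeomorph X E) (p : LevelPairs u c e) : ℂ :=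
  β ⟨e.symm p.1.1, p.2.2.1⟩ ![⟨_, p.2.2.2.1⟩, ⟨_, p.2.2.2.2⟩]

theorem LevelTwoForm.inChart_add {u : X → ℝ} {c : ℝ} (β γ : LevelTwoForm E u c)
    (e : OpenPartialHomeomorph X E) :
    LevelTwoForm.inChart (β + γ) e = β.inChart e + γ.inChart e := rfl

theorem LevelTwoForm.inChart_smul {u : X → ℝ} {c : ℝ} (a : ℂ) (β : LevelTwoForm E u c)
    (e : OpenPartialHomeomorph X E) :
    LevelTwoForm.inChart (a • β) e = a • β.inChart e := rfl

/-- The support of a `2`-form of `Y_c`. -/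
def LevelTwoForm.support {u : X → ℝ} {c : ℝ} (β : LevelTwoForm E u c) : Set {x : X // u x = c} :=
  closure {y | β y ≠ 0}

variable (E) in
/-- The space of continuous complex valued `2`-forms with compact support on `Y_c`. (`Y_c` being
only a hypersurface of class `C¹`, continuous is the only regularity which is meaningful for
forms on it.) -/
def levelForms (u : X → ℝ) (c : ℝ) : Submodule ℂ (LevelTwoForm E u c) where
  carrier := {β | (∀ e ∈ atlas E X, Continuous (β.inChart e)) ∧ IsCompact β.support}
  add_mem' := by
    rintro β γ ⟨h1, h2⟩ ⟨h3, h4⟩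
    refine ⟨fun e he => (h1 e he).add (h3 e he), (h2.union h4).of_isClosed_subset isClosed_closure
      (closure_minimal (fun y hy => ?_) (isClosed_closure.union isClosed_closure))⟩
    by_contra h
    rw [mem_union, not_or] at h
    have hβ : β y = 0 := by
      by_contra h'
      exact h.1 (subset_closure h')
    have hγ : γ y = 0 := by
      by_contra h'
      exact h.2 (subset_closure h')
    exact hy (by simp [hβ, hγ])
  zero_mem' := by
    refine ⟨fun e he => continuous_const (y := 0), ?_⟩
    simp [LevelTwoForm.support]
  smul_mem' := by
    rintro a β ⟨h1, h2⟩
    refine ⟨fun e he => (h1 e he).const_smul a, h2.of_isClosed_subset isClosed_closure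
      (closure_mono fun y hy h' => hy ?_)⟩
    simp [h']

variable (E) in
/-- Currents of dimension `2` on the `C¹` hypersurface `Y_c`: continuous linear functionals
on the space of continuous `2`-forms with compact support on `Y_c`. -/
structure LevelCurrent (u : X → ℝ) (c : ℝ) where
  toFun : levelForms E u c →ₗ[ℂ] ℂ
  continuous' : ∀ (K : Set {x : X // u x = c}) (β : ℕ → levelForms E u c), IsCompact K →
    (∀ j, LevelTwoForm.support (β j).1 ⊆ K) →
    (∀ e ∈ atlas E X, ∀ L ⊆ e.target, IsCompact L →
      TendstoUniformlyOn (fun j => LevelTwoForm.inChart (β j).1 e) 0 atTop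
        {p | p.1.1 ∈ L ∧ ‖p.1.2.1‖ ≤ 1 ∧ ‖p.1.2.2‖ ≤ 1}) →
    Tendsto (fun j => toFun (β j)) atTop (𝓝 0)

/-- The restriction `j^*α` to `Y_c` of a `2`-form of `X`. -/
def TwoForm.restrict (α : TwoForm E X) (u : X → ℝ) (c : ℝ) : LevelTwoForm E u c :=
  fun y => (α y.1).compContinuousLinearMap (levelTangent E u y.1).subtypeL

theorem restrict_mem {α : TwoForm E X} (hα : α ∈ testForms E X) {u : X → ℝ} (hu : Continuous u)
    (c : ℝ) : α.restrict u c ∈ levelForms E u c := by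
  refine ⟨fun e he => ?_, ?_⟩
  · have h1 := (hα.1 e he).continuousOn
    have h2 : Continuous fun p : LevelPairs u c e => TwoForm.inChart α e p.1.1 :=
      h1.comp_continuous (continuous_fst.comp continuous_subtype_val) fun p => p.property.1
    have h3 : Continuous fun p : LevelPairs u c e => ![p.1.2.1, p.1.2.2] := by
      have h4 : Continuous fun p : LevelPairs u c e => p.1 := continuous_subtype_val
      fun_prop
    have h5 : Continuous fun p : LevelPairs u c e =>
        TwoForm.inChart α e p.1.1 ![p.1.2.1, p.1.2.2] := by
      fun_prop
    refine h5.congr fun p => ?_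
    change α (e.symm p.1.1) _ = α (e.symm p.1.1) _
    refine congrArg _ (funext fun i => ?_)
    fin_cases i <;> rfl
  · have hK : IsCompact ((↑) ⁻¹' tsupport α : Set {x : X // u x = c}) :=
      ((isClosed_singleton.preimage hu).isClosedEmbedding_subtypeVal).isCompact_preimage hα.2
    refine hK.of_isClosed_subset isClosed_closure (closure_minimal (fun y hy => ?_)
      ((isClosed_tsupport α).preimage continuous_subtype_val))
    by_contra h
    refine hy ?_
    have h0 : α y.1 = 0 := image_eq_zero_of_notMem_tsupport h
    ext v
    simp [TwoForm.restrict, h0]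

/-- `T = j_*S`, for `j` the inclusion of `Y_c` in `X`, i.e. `⟨T, α⟩ = ⟨S, j^*α⟩` for all `α`. -/
def IsPushforward (T : Current E X) {u : X → ℝ} (hu : Continuous u) {c : ℝ}
    (S : LevelCurrent E u c) : Prop :=
  ∀ α : testForms E X, T α = S.toFun ⟨TwoForm.restrict α.1 u c, restrict_mem α.2 hu c⟩

end LevelSets

end Manifold

end

end LeviCurrents

/-! A positive current of bidimension `(1,1)` has order zero. Hence `T = ∫ τ dσ`, where `σ` is a
finite measure on the disjoint union `ℕ × E` of countably many charts and `τ` is a measurable field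
of positive functionals on `(1,1)`-forms (`exists_current_eq`). Disintegrate `σ` along the function
`u` read in the charts, into probability measures `σ_c`, and put `T_c = ∫ τ dσ_c`. Positivity,
bidimension, the integral formula and, for almost every `c`, the support condition are then soft.
The substance is that almost every `T_c` is `∂∂̄`-closed, that it is annihilated by `i∂∂̄v` for
every continuous plurisubharmonic `v`, and that it is tangent to `Y_c` when `u` is `C¹`.

All of this rests on `T ∧ i∂u∧∂̄u = 0`. For smooth plurisubharmonic `a_n → u` one has `i∂∂̄e^{a_n} =
e^{a_n}(i∂∂̄a_n + i∂a_n∧∂̄a_n)`, and `e^u` is again plurisubharmonic; so both `T ∧ i∂∂̄a_n` and `T ∧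
i∂a_n∧∂̄a_n` tend to zero (`Current.IsLevi.exists_regularization`).

Closedness. Test `i∂∂̄T = 0` on `φ h(a_n)`. The terms with derivatives of `h(a_n)` disappear in the
limit, the cross term by Cauchy–Schwarz, and there remains `T(h(u) i∂∂̄φ) = 0` for all `h`
(`Density.integral_comp_mul_eq_zero`). Thus `T_c(i∂∂̄φ) = 0` for almost every `c`, and the
separability of the test forms makes the null set independent of `φ`.

Wedge products. If `a_n → v` is a regularization, the masses `T(θ i∂∂̄a_n) → 0` are integrals over
`c` of nonnegative masses for `T_c`. By Fatou, almost every `T_c` has arbitrarily small mass on some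
`a_n` close to `v`. The estimate `ev_sq_ddc_le` says that uniformly close plurisubharmonic functions
have comparable masses up to a small error; it carries the conclusion over to every sequence
converging to `v`. A countable dense family of functions `v` takes care of the null sets.

Tangency. For `u` of class `C¹` the gradients of the `a_n` converge, so almost every functional `τ`
vanishes on the square of `l = du`. By Cauchy–Schwarz it vanishes on all products with `l`, and
therefore sees only the restriction of a form to `ker l`, the tangent space of `Y_c`
(`Density.val_eq_val_comp`).

In the end `T_c` is replaced by `0` on the null set of bad values of `c`, and `μ` is restricted to
the values where `T_c ≠ 0`. -/

namespace LeviCurrents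

noncomputable section

set_option linter.unusedSectionVars false

/-! ### Linear algebra of positive `(1,1)`-forms -/

section Algebra

variable {E : Type*} [NormedAddCommGroup E] [NormedSpace ℂ E]

variable (E) in
/-- Alternating complex valued real bilinear forms on `E`. -/
abbrev Alt2 := E [⋀^Fin 2]→L[ℝ] ℂ

theorem Alt2.ext' {ξ η : Alt2 E} (h : ∀ v w, ξ ![v, w] = η ![v, w]) : ξ = η := by
  ext x
  have : x = ![x 0, x 1] := by ext i; fin_cases i <;> rfl
  rw [this]
  exact h _ _

theorem comp_pair (ξ : Alt2 E) (L : E →L[ℝ] E) (v w : E) :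
    ξ.compContinuousLinearMap L ![v, w] = ξ ![L v, L w] := by
  rw [ContinuousAlternatingMap.compContinuousLinearMap_apply]
  congr 1
  ext i; fin_cases i <;> rfl

theorem Alt2.swap (ξ : Alt2 E) (v w : E) : ξ ![w, v] = -ξ ![v, w] := by
  have h := ξ.map_swap (v := ![v, w]) (i := 0) (j := 1) (by simp)
  have h2 : ![v, w] ∘ Equiv.swap (0 : Fin 2) 1 = ![w, v] := by
    ext i; fin_cases i <;> simp
  rw [← h2]; exact h

theorem update_pair {E : Type*} (v w x : E) : Function.update ![v, w] 0 x = ![x, w] := by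
  ext i; fin_cases i <;> simp

theorem Alt2.add_left (ξ : Alt2 E) (v v' w : E) : ξ ![v + v', w] = ξ ![v, w] + ξ ![v', w] := by
  have h := ξ.map_update_add ![v, w] 0 v v'
  rwa [update_pair, update_pair, update_pair] at h

theorem Alt2.smul_left (ξ : Alt2 E) (a : ℝ) (v w : E) : ξ ![a • v, w] = a • ξ ![v, w] := by
  have h := ξ.map_update_smul ![v, w] 0 a v
  rwa [update_pair, update_pair] at h

theorem Alt2.add_right (ξ : Alt2 E) (v w w' : E) : ξ ![v, w + w'] = ξ ![v, w] + ξ ![v, w'] := by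
  rw [ξ.swap _ v, ξ.add_left, ξ.swap v w, ξ.swap v w']; ring

theorem Alt2.smul_right (ξ : Alt2 E) (a : ℝ) (v w : E) : ξ ![v, a • w] = a • ξ ![v, w] := by
  rw [ξ.swap _ v, ξ.smul_left, ξ.swap v w]; simp

theorem Alt2.neg_left (ξ : Alt2 E) (v w : E) : ξ ![-v, w] = -ξ ![v, w] := by
  have := ξ.smul_left (-1) v w
  simpa using this

theorem Alt2.neg_right (ξ : Alt2 E) (v w : E) : ξ ![v, -w] = -ξ ![v, w] := by
  have := ξ.smul_right (-1) v w
  simpa using this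

theorem Alt2.self (ξ : Alt2 E) (v : E) : ξ ![v, v] = 0 := by
  have := ξ.swap v v
  exact self_eq_neg.1 this

/-- Partial evaluation of an alternating form. -/
def Alt2.contract (ξ : Alt2 E) (v : E) : E →L[ℝ] ℂ where
  toFun w := ξ ![v, w]
  map_add' := ξ.add_right v
  map_smul' a w := ξ.smul_right a v w
  cont := by
    have : Continuous fun w : E => ![v, w] := by fun_prop
    exact ξ.cont.comp this

@[simp] theorem Alt2.contract_apply (ξ : Alt2 E) (v w : E) : ξ.contract v w = ξ ![v, w] := rfl

/-- Antisymmetrization of a bilinear form. -/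
def alt2 : (E →L[ℝ] E →L[ℝ] ℂ) →L[ℝ] Alt2 E :=
  (ContinuousAlternatingMap.alternatizeUncurryFinCLM ℝ E ℂ (n := 1)).comp
    (ContinuousLinearMap.compL ℝ E (E →L[ℝ] ℂ) (E [⋀^Fin 1]→L[ℝ] ℂ)
      (ContinuousAlternatingMap.ofSubsingletonLIE (𝕜 := ℝ) (E := E) (F := ℂ)
        (0 : Fin 1)).toContinuousLinearEquiv.toContinuousLinearMap)

theorem alt2_apply (B : E →L[ℝ] E →L[ℝ] ℂ) (v w : E) : alt2 B ![v, w] = B v w - B w v := by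
  simp [alt2, ContinuousAlternatingMap.alternatizeUncurryFin_apply, Fin.sum_univ_two,
    ContinuousAlternatingMap.ofSubsingletonLIE]
  change B v w + -B w v = _
  ring

@[simp] theorem mulI_apply (v : E) : mulI v = Complex.I • v := rfl

theorem I_smul_I_smul (v : E) : Complex.I • Complex.I • v = -v := by
  rw [smul_smul, Complex.I_mul_I, neg_one_smul]

/-- The form `(i/2)(∂f ∧ ∂̄g + ∂g ∧ ∂̄f)` for real functions `f`, `g` with differentials `l`, `m`. -/
def gam (l m : E →L[ℝ] ℝ) : Alt2 E :=
  alt2 ((-(1 / 4 : ℝ)) •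
    (l.smulRight (Complex.ofRealCLM.comp (m.comp mulI)) +
      m.smulRight (Complex.ofRealCLM.comp (l.comp mulI))))

theorem gam_apply (l m : E →L[ℝ] ℝ) (v w : E) : gam l m ![v, w] =
    ((1 / 4 * (l (Complex.I • v) * m w + m (Complex.I • v) * l w
      - l v * m (Complex.I • w) - m v * l (Complex.I • w)) : ℝ) : ℂ) := by
  simp only [gam, alt2_apply, smul_apply, add_apply,
    ContinuousLinearMap.smulRight_apply, ContinuousLinearMap.comp_apply, mulI_apply,
    Complex.ofRealCLM_apply, Complex.real_smul]
  push_cast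
  ring

theorem gam_symm (l m : E →L[ℝ] ℝ) : gam l m = gam m l :=
  Alt2.ext' fun v w => by rw [gam_apply, gam_apply]; congr 1; ring

theorem gam_add_left (l l' m : E →L[ℝ] ℝ) : gam (l + l') m = gam l m + gam l' m :=
  Alt2.ext' fun v w => by
    simp only [gam_apply, ContinuousAlternatingMap.add_apply, add_apply]
    push_cast; ring

theorem gam_smul_left (a : ℝ) (l m : E →L[ℝ] ℝ) : gam (a • l) m = a • gam l m :=
  Alt2.ext' fun v w => by
    simp only [gam_apply, ContinuousAlternatingMap.smul_apply, smul_apply,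
      smul_eq_mul, Complex.real_smul]
    push_cast; ring

theorem gam_add_right (l m m' : E →L[ℝ] ℝ) : gam l (m + m') = gam l m + gam l m' := by
  rw [gam_symm, gam_add_left, gam_symm m, gam_symm m']

theorem gam_smul_right (a : ℝ) (l m : E →L[ℝ] ℝ) : gam l (a • m) = a • gam l m := by
  rw [gam_symm, gam_smul_left, gam_symm]

/-- Polarization reduces mixed forms to squares. It is used to span the `(1,1)`-forms by the
positive forms `gam m m`, and to see that positive functionals are real on `gam l m`. -/
theorem gam_polar (l m : E →L[ℝ] ℝ) : gam (l + m) (l + m) - gam l l - gam m m = (2 : ℝ) • gam l m := by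
  simp only [gam_add_left, gam_add_right]
  rw [gam_symm m l]
  module

/-- Positive forms of bidegree `(1,1)` on the vector space `E`. -/
def PosForm (ξ : Alt2 E) : Prop :=
  (∀ v w : E, ξ ![Complex.I • v, Complex.I • w] = ξ ![v, w]) ∧
    ∀ v : E, 0 ≤ (ξ ![v, Complex.I • v]).re ∧ (ξ ![v, Complex.I • v]).im = 0

theorem posForm_zero : PosForm (0 : Alt2 E) := by simp [PosForm]

theorem PosForm.add {ξ η : Alt2 E} (h : PosForm ξ) (h' : PosForm η) : PosForm (ξ + η) := by
  refine ⟨fun v w => ?_, fun v => ⟨?_, ?_⟩⟩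
  · simp [h.1, h'.1]
  · simpa using add_nonneg (h.2 v).1 (h'.2 v).1
  · simp [(h.2 v).2, (h'.2 v).2]

theorem PosForm.smul {ξ : Alt2 E} (h : PosForm ξ) {a : ℝ} (ha : 0 ≤ a) : PosForm (a • ξ) := by
  refine ⟨fun v w => ?_, fun v => ⟨?_, ?_⟩⟩
  · simp [h.1]
  · simpa using mul_nonneg ha (h.2 v).1
  · simp [(h.2 v).2]

theorem PosForm.comp {ξ : Alt2 E} (h : PosForm ξ) {L : E →L[ℝ] E}
    (hL : ∀ v, L (Complex.I • v) = Complex.I • L v) :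
    PosForm (ξ.compContinuousLinearMap L) := by
  refine ⟨fun v w => ?_, fun v => ?_⟩
  · rw [comp_pair, comp_pair, hL, hL, h.1]
  · rw [comp_pair, hL]; exact h.2 _

theorem gam_inv (l m : E →L[ℝ] ℝ) (v w : E) :
    gam l m ![Complex.I • v, Complex.I • w] = gam l m ![v, w] := by
  rw [gam_apply, gam_apply, I_smul_I_smul, I_smul_I_smul]
  simp only [map_neg]; congr 1; ring

/-- On the pair `(v, iv)` the form takes the value `(l(v)² + l(iv)²) / 2`. -/
theorem posForm_gam (l : E →L[ℝ] ℝ) : PosForm (gam l l) := by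
  refine ⟨gam_inv l l, fun v => ?_⟩
  rw [gam_apply, I_smul_I_smul]
  refine ⟨?_, Complex.ofReal_im _⟩
  rw [Complex.ofReal_re]
  simp only [map_neg]
  nlinarith [sq_nonneg (l v), sq_nonneg (l (Complex.I • v))]

/-- This is `gam` of `a • l + b • m` with itself, expanded. It serves as the Cauchy–Schwarz
inequality which absorbs cross terms in the estimates below. -/
theorem posForm_gam_sq (a b : ℝ) (l m : E →L[ℝ] ℝ) :
    PosForm (a ^ 2 • gam l l + (2 * a * b) • gam l m + b ^ 2 • gam m m) := by
  have h := posForm_gam (a • l + b • m)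
  simp only [gam_add_left, gam_add_right, gam_smul_left, gam_smul_right] at h
  rw [gam_symm m l] at h
  convert h using 1
  module

/-- A positive form is real. -/
theorem PosForm.im_eq_zero {ξ : Alt2 E} (h : PosForm ξ) (v w : E) : (ξ ![v, w]).im = 0 := by
  -- By invariance under `i` the bilinear form `ξ(·, i·)` is symmetric, hence determined by its
  -- diagonal, which is real.
  have key : ∀ v w : E, (ξ ![v, Complex.I • w]).im = 0 := by
    intro v w
    have h1 := (h.2 (v + w)).2
    have h2 : ξ ![w, Complex.I • v] = ξ ![v, Complex.I • w] := by
      rw [← h.1 w, I_smul_I_smul, ξ.swap, ξ.neg_left, neg_neg]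
    rw [smul_add, ξ.add_left, ξ.add_right, ξ.add_right, h2] at h1
    have h3 := (h.2 v).2
    have h4 := (h.2 w).2
    simp only [Complex.add_im] at h1
    linarith
  have h5 := key v (-(Complex.I • w))
  rwa [smul_neg, I_smul_I_smul, neg_neg] at h5

/-- The `(1,1)`-part of a form. -/
def pr11 (ξ : Alt2 E) : Alt2 E := (1 / 2 : ℂ) • (ξ + ξ.compContinuousLinearMap mulI)

theorem pr11_apply (ξ : Alt2 E) (v w : E) :
    pr11 ξ ![v, w] = (1 / 2 : ℂ) * (ξ ![v, w] + ξ ![Complex.I • v, Complex.I • w]) := by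
  rw [pr11, ContinuousAlternatingMap.smul_apply, ContinuousAlternatingMap.add_apply, comp_pair]
  rfl

/-- Multiplication by `1 + i`. -/
def mulOneAddI : E →L[ℝ] E := ContinuousLinearMap.id ℝ E + mulI

/-- The `(2,0)`-part (for `ε = 1`) and the `(0,2)`-part (for `ε = -1`) of a form. -/
def pr20 (ε : ℂ) (ξ : Alt2 E) : Alt2 E :=
  (1 / 2 : ℂ) • ((ξ - pr11 ξ) -
    (ε * Complex.I / 2) • (ξ - pr11 ξ).compContinuousLinearMap mulOneAddI)

theorem pr20_apply (ε : ℂ) (ξ : Alt2 E) (v w : E) :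
    pr20 ε ξ ![v, w] = (1 / 4 : ℂ) * (ξ ![v, w] - ξ ![Complex.I • v, Complex.I • w]
      - ε * Complex.I * (ξ ![Complex.I • v, w] + ξ ![v, Complex.I • w])) := by
  simp only [pr20, ContinuousAlternatingMap.smul_apply, ContinuousAlternatingMap.sub_apply,
    comp_pair, pr11_apply, mulOneAddI, add_apply,
    ContinuousLinearMap.id_apply, mulI_apply, ξ.add_left, ξ.add_right, smul_add, I_smul_I_smul,
    ξ.neg_left, ξ.neg_right, smul_eq_mul]
  ring

theorem pr20_type (ε : ℂ) (hε : ε * ε = 1) (ξ : Alt2 E) (v w : E) :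
    pr20 ε ξ ![Complex.I • v, w] = ε * Complex.I * pr20 ε ξ ![v, w] := by
  rw [pr20_apply, pr20_apply, I_smul_I_smul]
  simp only [ξ.neg_left]
  linear_combination (1 / 4 : ℂ) * (ε * ε * (ξ ![Complex.I • v, w] + ξ ![v, Complex.I • w])) *
    Complex.I_mul_I - (1 / 4 : ℂ) * (ξ ![Complex.I • v, w] + ξ ![v, Complex.I • w]) * hε

/-- Pulling back by `i` is an involution on forms, and `pr11` projects to its invariant part. On the
anti-invariant part, multiplying one argument by `i` is an operation with square `-1`; `pr20 1` and
`pr20 (-1)` are the projections to its eigenspaces. -/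
theorem pr_decomp (ξ : Alt2 E) : ξ = pr11 ξ + (pr20 1 ξ + pr20 (-1) ξ) :=
  Alt2.ext' fun v w => by
    simp only [ContinuousAlternatingMap.add_apply, pr11_apply, pr20_apply]
    ring

theorem pr11_of_inv {ξ : Alt2 E} (h : ∀ v w : E, ξ ![Complex.I • v, Complex.I • w] = ξ ![v, w]) :
    pr11 ξ = ξ :=
  Alt2.ext' fun v w => by rw [pr11_apply, h]; ring

/-- Multiplying both arguments by `i` multiplies `ξ` by `ε² = -1`, so the invariant part vanishes.
-/
theorem pr11_of_type {ξ : Alt2 E} {ε : ℂ} (hε : ε * ε = -1)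
    (h : ∀ v w : E, ξ ![Complex.I • v, w] = ε * ξ ![v, w]) : pr11 ξ = 0 :=
  Alt2.ext' fun v w => by
    rw [pr11_apply, h, ξ.swap (Complex.I • w), h, ξ.swap v w]
    change _ = (0 : ℂ)
    linear_combination (1 / 2 : ℂ) * ξ ![v, w] * hε

/-- Operations on forms which commute with pull-backs by complex linear maps. -/
theorem pr11_comp (ξ : Alt2 E) {L : E →L[ℝ] E} (hL : ∀ v, L (Complex.I • v) = Complex.I • L v) :
    (pr11 ξ).compContinuousLinearMap L = pr11 (ξ.compContinuousLinearMap L) :=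
  Alt2.ext' fun v w => by simp only [comp_pair, pr11_apply, hL]

theorem pr20_comp (ε : ℂ) (ξ : Alt2 E) {L : E →L[ℝ] E}
    (hL : ∀ v, L (Complex.I • v) = Complex.I • L v) :
    (pr20 ε ξ).compContinuousLinearMap L = pr20 ε (ξ.compContinuousLinearMap L) :=
  Alt2.ext' fun v w => by simp only [comp_pair, pr20_apply, hL]

theorem gam_comp (l m : E →L[ℝ] ℝ) {L : E →L[ℝ] E}
    (hL : ∀ v, L (Complex.I • v) = Complex.I • L v) :
    (gam l m).compContinuousLinearMap L = gam (l.comp L) (m.comp L) :=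
  Alt2.ext' fun v w => by
    simp only [comp_pair, gam_apply, ContinuousLinearMap.comp_apply, hL]

theorem contDiff_pr11 : ContDiff ℝ ∞ (pr11 : Alt2 E → Alt2 E) := by
  unfold pr11
  exact (contDiff_id.add (ContinuousAlternatingMap.compContinuousLinearMapCLM
    (mulI (E := E)) : Alt2 E →L[ℝ] Alt2 E).contDiff).const_smul _

theorem contDiff_pr20 (ε : ℂ) : ContDiff ℝ ∞ (pr20 ε : Alt2 E → Alt2 E) := by
  unfold pr20
  have h : ContDiff ℝ ∞ (fun ξ : Alt2 E => ξ - pr11 ξ) := contDiff_id.sub contDiff_pr11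
  exact (h.sub (((ContinuousAlternatingMap.compContinuousLinearMapCLM
    (mulOneAddI (E := E)) : Alt2 E →L[ℝ] Alt2 E).contDiff.comp h).const_smul (ε * Complex.I / 2))).const_smul (1 / 2 : ℂ)

theorem pr11_zero : pr11 (0 : Alt2 E) = 0 := Alt2.ext' fun v w => by simp [pr11_apply]

theorem pr20_zero (ε : ℂ) : pr20 ε (0 : Alt2 E) = 0 := Alt2.ext' fun v w => by simp [pr20_apply]

end Algebra

/-! ### Coordinates on forms, and squares spanning the `(1,1)`-forms -/

section FiniteDim

variable {E : Type*} [NormedAddCommGroup E] [NormedSpace ℂ E] [FiniteDimensional ℂ E]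

variable (E) in
/-- Coordinates on `E`. -/
abbrev Idx := Fin (Module.finrank ℝ E)

variable (E) in
/-- A real basis of `E`. -/
def bas : Module.Basis (Idx E) ℝ E := Module.finBasis ℝ E

/-- The real coordinate functions on `E`. -/
def coor (j : Idx E) : E →L[ℝ] ℝ := LinearMap.toContinuousLinearMap ((bas E).coord j)

theorem sum_coor (v : E) : ∑ j, coor j v • bas E j = v := (bas E).sum_repr v

theorem contract_sum (ξ : Alt2 E) (v w : E) :
    ξ ![v, w] = ∑ j, ∑ k, (coor j v * coor k w) • ξ ![bas E j, bas E k] := by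
  have h1 : ∀ v, ξ ![v, w] = ∑ k, coor k w • ξ ![v, bas E k] := fun v => by
    conv_lhs => rw [← sum_coor w, ← Alt2.contract_apply, map_sum]
    simp
  have h2 : ∀ k, ξ ![v, bas E k] = ∑ j, coor j v • ξ ![bas E j, bas E k] := fun k => by
    conv_lhs => rw [← sum_coor v, ξ.swap (bas E k), ← Alt2.contract_apply, map_sum,
      ← Finset.sum_neg_distrib]
    refine Finset.sum_congr rfl fun j _ => ?_
    rw [map_smul, Alt2.contract_apply, ξ.swap (bas E j)]
    simp
  rw [h1, Finset.sum_comm]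
  refine Finset.sum_congr rfl fun k _ => ?_
  rw [h2, Finset.smul_sum]
  refine Finset.sum_congr rfl fun j _ => ?_
  rw [smul_smul, mul_comm]

theorem Alt2.ext_bas {ξ η : Alt2 E} (h : ∀ j k, ξ ![bas E j, bas E k] = η ![bas E j, bas E k]) :
    ξ = η :=
  Alt2.ext' fun v w => by rw [contract_sum, contract_sum η]; simp only [h]

variable (E) in
/-- Evaluation of a form at basis vectors. -/
def coords : Alt2 E →ₗ[ℝ] (Idx E → Idx E → ℂ) where
  toFun ξ j k := ξ ![bas E j, bas E k]
  map_add' _ _ := rfl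
  map_smul' _ _ := rfl

theorem coords_injective : Function.Injective (coords E) := fun _ _ h =>
  Alt2.ext_bas fun j k => congrFun (congrFun h j) k

instance : FiniteDimensional ℝ (Alt2 E) := FiniteDimensional.of_injective (coords E) coords_injective

instance : ProperSpace (Alt2 E) := FiniteDimensional.proper ℝ _

/-- A functional on forms is determined by, and continuous in, the evaluations on pairs of
vectors. -/
theorem tendsto_alt2 {ι : Type*} {l : Filter ι} {ξ : ι → Alt2 E} {η : Alt2 E}
    (h : ∀ v w, Tendsto (fun i => ξ i ![v, w]) l (𝓝 (η ![v, w]))) : Tendsto ξ l (𝓝 η) := by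
  have hinj : LinearMap.ker (coords E) = ⊥ := LinearMap.ker_eq_bot.2 coords_injective
  have hemb := (LinearMap.isClosedEmbedding_of_injective hinj).isInducing
  rw [hemb.tendsto_nhds_iff]
  refine tendsto_pi_nhds.2 fun j => tendsto_pi_nhds.2 fun k => ?_
  exact h _ _

variable (E) in
/-- The index set for a spanning family of positive forms. -/
abbrev PIdx := (Idx E × Idx E) × Fin 3

/-- The linear forms `m` for which the `gam m m` span the `(1,1)`-forms. -/
def plin (p : PIdx E) : E →L[ℝ] ℝ :=
  ![(coor p.1.1).comp mulI + coor p.1.2, (coor p.1.1).comp mulI, coor p.1.2] p.2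

/-- Coefficients of the `(1,1)`-part of a form in terms of the `gam m m`. -/
def pcoef (p : PIdx E) (ξ : Alt2 E) : ℂ :=
  (![-1 / 2, 1 / 2, 1 / 2] p.2 : ℂ) * pr11 ξ ![bas E p.1.1, bas E p.1.2]

/-- In real coordinates the `(1,1)`-part is a combination of the mixed forms `gam ((coor j) ∘ i)
(coor k)`, and polarization rewrites each of them by three squares; this is the origin of the
coefficients `-1/2, 1/2, 1/2`. The point is that a positive current paired with such a square is a
positive measure. -/
theorem pr11_eq_sum (ξ : Alt2 E) : pr11 ξ = ∑ p : PIdx E, pcoef p ξ • gam (plin p) (plin p) := by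
  rw [Fintype.sum_prod_type, Fintype.sum_prod_type]
  have h1 : ∀ j k : Idx E, ∑ q : Fin 3, pcoef ((j, k), q) ξ • gam (plin ((j, k), q)) (plin ((j, k), q))
      = (-pr11 ξ ![bas E j, bas E k]) • gam ((coor j).comp mulI) (coor k) := by
    intro j k
    have h := gam_polar ((coor j).comp mulI) (coor k)
    rw [Fin.sum_univ_three]
    simp only [pcoef, plin, Matrix.cons_val_zero, Matrix.cons_val_one, 
      Matrix.cons_val]
    set a := pr11 ξ ![bas E j, bas E k]
    have h' : gam ((coor j).comp mulI + coor k) ((coor j).comp mulI + coor k) =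
        (2 : ℂ) • gam ((coor j).comp mulI) (coor k) + gam ((coor j).comp mulI) ((coor j).comp mulI)
        + gam (coor k) (coor k) := by
      have h3 : (2 : ℂ) • gam ((coor j).comp mulI) (coor k)
        = (2 : ℝ) • gam ((coor j).comp mulI) (coor k) := by
        rw [← Complex.coe_smul (E := Alt2 E)]; norm_num
      rw [h3, ← h]; abel
    rw [h']
    module
  simp only [h1]
  have hJ : ∀ v w : E, pr11 ξ ![Complex.I • v, Complex.I • w] = pr11 ξ ![v, w] := by
    intro v w
    rw [pr11_apply, pr11_apply, I_smul_I_smul, I_smul_I_smul, ξ.neg_left, ξ.neg_right]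
    ring
  refine Alt2.ext' fun v w => ?_
  have e1 := contract_sum (pr11 ξ) v w
  have e2 := contract_sum (pr11 ξ) w v
  have e3 := contract_sum (pr11 ξ) (Complex.I • v) (Complex.I • w)
  have e4 := contract_sum (pr11 ξ) (Complex.I • w) (Complex.I • v)
  rw [hJ] at e3 e4
  -- Averaging over the antisymmetry and over the invariance under `i` produces exactly the four
  -- terms of `gam`.
  have e5 : pr11 ξ ![v, w] = (1 / 4 : ℂ) * (pr11 ξ ![v, w] - pr11 ξ ![w, v] + pr11 ξ ![v, w]
      - pr11 ξ ![w, v]) := by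
    rw [(pr11 ξ).swap v w]; ring
  have hs : ∀ f : Idx E → Idx E → Alt2 E, (∑ j, ∑ k, f j k) ![v, w] = ∑ j, ∑ k, f j k ![v, w] := by
    intro f
    simp only [ContinuousAlternatingMap.sum_apply]
  rw [hs]
  conv_lhs => rw [e5]
  nth_rewrite 1 [e1]
  nth_rewrite 1 [e2]
  nth_rewrite 1 [e3]
  nth_rewrite 1 [e4]
  simp only [← Finset.sum_sub_distrib, ← Finset.sum_add_distrib, Finset.mul_sum]
  refine Finset.sum_congr rfl fun j _ => Finset.sum_congr rfl fun k _ => ?_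
  rw [ContinuousAlternatingMap.smul_apply, gam_apply]
  simp only [ContinuousLinearMap.comp_apply, mulI_apply, I_smul_I_smul, map_neg, Complex.real_smul,
    smul_eq_mul]
  push_cast
  ring

end FiniteDim

/-! ### The Levi form in terms of the real Hessian -/

section Hessian

variable {E : Type*} [NormedAddCommGroup E] [NormedSpace ℂ E]

/-- The derivative of `∂̄f` is half of `H + i H(·, i·)`. Antisymmetrizing kills the first term
because the Hessian `H` is symmetric. -/
theorem iddbarFlat_apply {f : E → ℂ} {z : E} (hf : ContDiffAt ℝ 2 f z) (v w : E) :
    iddbarFlat f z ![v, w] = (1 / 2 : ℂ) * (fderiv ℝ (fderiv ℝ f) z (Complex.I • v) w -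
      fderiv ℝ (fderiv ℝ f) z v (Complex.I • w)) := by
  have hsym : IsSymmSndFDerivAt ℝ f z := hf.isSymmSndFDerivAt (by simp)
  have hd : DifferentiableAt ℝ (fderiv ℝ f) z :=
    (hf.fderiv_right (m := 1) (by norm_num)).differentiableAt (by simp)
  set H := fderiv ℝ (fderiv ℝ f) z with hH
  have h0 : HasFDerivAt (fderiv ℝ f) H z := hd.hasFDerivAt
  set C : (E →L[ℝ] ℂ) →L[ℝ] (E →L[ℝ] ℂ) :=
    (ContinuousLinearMap.compL ℝ E E ℂ).flip (mulI (E := E)) with hC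
  have h1 : HasFDerivAt (fun y => (1 / 2 : ℂ) • (fderiv ℝ f y +
      Complex.I • (fderiv ℝ f y).comp (mulI (E := E))))
      ((1 / 2 : ℂ) • (H + Complex.I • C.comp H)) z := by
    have h2 : HasFDerivAt (fun y => (fderiv ℝ f y).comp (mulI (E := E))) (C.comp H) z :=
      C.hasFDerivAt.comp z h0
    exact (h0.add (h2.const_smul Complex.I)).const_smul (1 / 2 : ℂ)
  set Λ := (ContinuousAlternatingMap.ofSubsingletonLIE (𝕜 := ℝ) (E := E) (F := ℂ)
        (0 : Fin 1)).toContinuousLinearEquiv.toContinuousLinearMap with hΛ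
  have h3 : HasFDerivAt (dbar f) (Λ.comp ((1 / 2 : ℂ) • (H + Complex.I • C.comp H))) z :=
    Λ.hasFDerivAt.comp z h1
  have h4 : iddbarFlat f z = Complex.I • alt2 ((1 / 2 : ℂ) • (H + Complex.I • C.comp H)) := by
    rw [iddbarFlat, extDeriv, h3.fderiv]
    rfl
  rw [h4, ContinuousAlternatingMap.smul_apply, alt2_apply]
  simp only [smul_apply, add_apply, ContinuousLinearMap.comp_apply,
    hC, ContinuousLinearMap.flip_apply, ContinuousLinearMap.compL_apply, mulI_apply, smul_eq_mul]
  rw [hsym.eq w v, hsym.eq w (Complex.I • v)]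
  linear_combination (1 / 2 : ℂ) * (H v (Complex.I • w) - H (Complex.I • v) w) * Complex.I_mul_I

theorem fderiv_ofReal_comp {f : E → ℝ} {z : E} (hf : DifferentiableAt ℝ f z) :
    fderiv ℝ (fun y => (f y : ℂ)) z = Complex.ofRealCLM.comp (fderiv ℝ f z) :=
  (Complex.ofRealCLM.hasFDerivAt.comp z hf.hasFDerivAt).fderiv

/-- The second derivative. -/
abbrev hess (f : E → ℝ) (z : E) : E →L[ℝ] E →L[ℝ] ℝ := fderiv ℝ (fderiv ℝ f) z

theorem hasFDerivAt_fderiv {f : E → ℝ} {z : E} (hf : ContDiffAt ℝ 2 f z) :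
    HasFDerivAt (fderiv ℝ f) (hess f z) z :=
  ((hf.fderiv_right (m := 1) (by norm_num)).differentiableAt (by simp)).hasFDerivAt

theorem eventually_differentiableAt {f : E → ℝ} {z : E} (hf : ContDiffAt ℝ 2 f z) :
    ∀ᶠ y in 𝓝 z, DifferentiableAt ℝ f y := by
  filter_upwards [hf.eventually (by simp)] with y hy
  exact hy.differentiableAt (by simp)

theorem iddbarFlat_ofReal {f : E → ℝ} {z : E} (hf : ContDiffAt ℝ 2 f z) (v w : E) :
    iddbarFlat (fun y => (f y : ℂ)) z ![v, w] =
      ((1 / 2 * (hess f z (Complex.I • v) w - hess f z v (Complex.I • w)) : ℝ) : ℂ) := by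
  have hf' : ContDiffAt ℝ 2 (fun y => (f y : ℂ)) z :=
    Complex.ofRealCLM.contDiff.contDiffAt.comp z hf
  have h : fderiv ℝ (fun y => (f y : ℂ)) =ᶠ[𝓝 z] fun y => Complex.ofRealCLM.comp (fderiv ℝ f y) := by
    filter_upwards [eventually_differentiableAt hf] with y hy using fderiv_ofReal_comp hy
  have h2 : fderiv ℝ (fderiv ℝ (fun y => (f y : ℂ))) z =
      (ContinuousLinearMap.compL ℝ E ℝ ℂ Complex.ofRealCLM).comp (hess f z) := by
    rw [h.fderiv_eq]
    exact ((ContinuousLinearMap.compL ℝ E ℝ ℂ Complex.ofRealCLM).hasFDerivAt.comp z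
      (hasFDerivAt_fderiv hf)).fderiv
  rw [iddbarFlat_apply hf', h2]
  simp

theorem hess_mul {f g : E → ℝ} {z : E} (hf : ContDiffAt ℝ 2 f z) (hg : ContDiffAt ℝ 2 g z)
    (v w : E) : hess (fun y => f y * g y) z v w = f z * hess g z v w + g z * hess f z v w +
      fderiv ℝ f z v * fderiv ℝ g z w + fderiv ℝ g z v * fderiv ℝ f z w := by
  have h : fderiv ℝ (fun y => f y * g y) =ᶠ[𝓝 z] fun y => f y • fderiv ℝ g y + g y • fderiv ℝ f y := by
    filter_upwards [eventually_differentiableAt hf, eventually_differentiableAt hg] with y h1 h2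
      using fderiv_fun_mul h1 h2
  have h2 := ((hf.differentiableAt (by simp)).hasFDerivAt.smul (hasFDerivAt_fderiv hg)).add
    ((hg.differentiableAt (by simp)).hasFDerivAt.smul (hasFDerivAt_fderiv hf))
  rw [hess, h.fderiv_eq]
  erw [h2.fderiv]
  simp
  ring

theorem hess_comp {f : E → ℝ} {h : ℝ → ℝ} {z : E} (hf : ContDiffAt ℝ 2 f z) (hh : ContDiff ℝ 2 h)
    (v w : E) : hess (fun y => h (f y)) z v w = deriv h (f z) * hess f z v w +
      deriv (deriv h) (f z) * (fderiv ℝ f z v * fderiv ℝ f z w) := by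
  have hd : Differentiable ℝ h := hh.differentiable (by simp)
  have hd' : ContDiff ℝ 1 (deriv h) := ((contDiff_succ_iff_deriv (n := 1)).1 (by rw [one_add_one_eq_two]; exact hh)).2.2
  have hd2 : Differentiable ℝ (deriv h) := hd'.differentiable (by simp)
  have h1 : fderiv ℝ (fun y => h (f y)) =ᶠ[𝓝 z] fun y => deriv h (f y) • fderiv ℝ f y := by
    filter_upwards [eventually_differentiableAt hf] with y hy
    exact ((hd (f y)).hasDerivAt.comp_hasFDerivAt y hy.hasFDerivAt).fderiv
  have h2 := ((hd2 (f z)).hasDerivAt.comp_hasFDerivAt z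
    (hf.differentiableAt (by simp)).hasFDerivAt).smul (hasFDerivAt_fderiv hf)
  rw [hess, h1.fderiv_eq]
  erw [h2.fderiv]
  simp
  ring

theorem hess_add {f g : E → ℝ} {z : E} (hf : ContDiffAt ℝ 2 f z) (hg : ContDiffAt ℝ 2 g z) :
    hess (fun y => f y + g y) z = hess f z + hess g z := by
  have h : fderiv ℝ (fun y => f y + g y) =ᶠ[𝓝 z] fun y => fderiv ℝ f y + fderiv ℝ g y := by
    filter_upwards [eventually_differentiableAt hf, eventually_differentiableAt hg] with y h1 h2
      using fderiv_fun_add h1 h2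
  rw [hess, h.fderiv_eq]
  exact ((hasFDerivAt_fderiv hf).add (hasFDerivAt_fderiv hg)).fderiv

end Hessian

/-! ### Product and chain rules for `i∂∂̄` on the manifold -/

section Forms

variable {E : Type*} [NormedAddCommGroup E] [NormedSpace ℂ E]
variable {X : Type*} [TopologicalSpace X] [ChartedSpace E X]

/-- The form `i∂∂̄f` of a real function. -/
def ddc (f : X → ℝ) : TwoForm E X := iddbar fun y => (f y : ℂ)

variable (E) in
/-- A real function is smooth near `x`. -/
abbrev SmoothAt (f : X → ℝ) (x : X) : Prop := ContMDiffAt 𝓘(ℝ, E) 𝓘(ℝ, ℝ) ∞ f x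

variable (E) in
/-- The differential of `f` at `x`, in the preferred chart. -/
def dif (f : X → ℝ) (x : X) : E →L[ℝ] ℝ := fderiv ℝ (f ∘ (chartAt E x).symm) (chartAt E x x)

theorem SmoothAt.flat {f : X → ℝ} {x : X} (hf : SmoothAt E f x) :
    ContDiffAt ℝ ∞ (f ∘ (chartAt E x).symm) (chartAt E x x) := by
  have h := (contMDiffAt_iff.1 hf).2
  simp only [mfld_simps, contDiffWithinAt_univ] at h
  exact h

theorem two_le_infty : (2 : WithTop ℕ∞) ≤ ∞ := WithTop.coe_le_coe.2 le_top

theorem SmoothAt.flat2 {f : X → ℝ} {x : X} (hf : SmoothAt E f x) :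
    ContDiffAt ℝ 2 (f ∘ (chartAt E x).symm) (chartAt E x x) :=
  hf.flat.of_le two_le_infty

/-- The second derivative of `f` at `x`, in the preferred chart. -/
def hessAt (f : X → ℝ) (x : X) : E →L[ℝ] E →L[ℝ] ℝ :=
  hess (f ∘ (chartAt E x).symm) (chartAt E x x)

theorem ddc_apply {f : X → ℝ} {x : X} (hf : SmoothAt E f x) (v w : E) : ddc f x ![v, w] =
    ((1 / 2 * (hessAt f x (Complex.I • v) w - hessAt f x v (Complex.I • w)) : ℝ) : ℂ) :=
  iddbarFlat_ofReal hf.flat2 v w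

/-- The two products of first derivatives in the Hessian of `f g` recombine, after the twist by `i`,
into `2 gam`. This rule and `ddc_comp` are the differential calculus behind the estimates on `T`. -/
theorem ddc_mul {f g : X → ℝ} {x : X} (hf : SmoothAt E f x) (hg : SmoothAt E g x) :
    ddc (fun y => f y * g y) x = f x • ddc g x + g x • ddc f x +
      (2 : ℝ) • gam (dif E f x) (dif E g x) := by
  refine Alt2.ext' fun v w => ?_
  have hfg : SmoothAt E (fun y => f y * g y) x := hf.mul hg
  have e : ∀ v w : E, hessAt (fun y => f y * g y) x v w =
      f x * hessAt g x v w + g x * hessAt f x v w +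
      dif E f x v * dif E g x w + dif E g x v * dif E f x w := fun v w => by
    have h := hess_mul hf.flat2 hg.flat2 v w
    simp only [Function.comp_apply, (chartAt E x).left_inv (mem_chart_source E x)] at h
    exact h
  rw [ddc_apply hfg]
  simp only [ContinuousAlternatingMap.add_apply, ContinuousAlternatingMap.smul_apply,
    ddc_apply hf, ddc_apply hg, gam_apply, e, Complex.real_smul]
  push_cast
  ring

theorem ddc_comp {f : X → ℝ} {h : ℝ → ℝ} {x : X} (hf : SmoothAt E f x) (hh : ContDiff ℝ ∞ h) :
    ddc (fun y => h (f y)) x = deriv h (f x) • ddc f x +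
      deriv (deriv h) (f x) • gam (dif E f x) (dif E f x) := by
  refine Alt2.ext' fun v w => ?_
  have hfg : SmoothAt E (fun y => h (f y)) x := hh.contDiffAt.contMDiffAt.comp x hf
  have e : ∀ v w : E, hessAt (fun y => h (f y)) x v w = deriv h (f x) * hessAt f x v w +
      deriv (deriv h) (f x) * (dif E f x v * dif E f x w) := fun v w => by
    have h := hess_comp hf.flat2 (hh.of_le two_le_infty) v w
    simp only [Function.comp_apply, (chartAt E x).left_inv (mem_chart_source E x)] at h
    exact h
  rw [ddc_apply hfg]
  simp only [ContinuousAlternatingMap.add_apply, ContinuousAlternatingMap.smul_apply,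
    ddc_apply hf, gam_apply, e, Complex.real_smul]
  push_cast
  ring

theorem ddc_add {f g : X → ℝ} {x : X} (hf : SmoothAt E f x) (hg : SmoothAt E g x) :
    ddc (fun y => f y + g y) x = (ddc f x + ddc g x : Alt2 E) := by
  refine Alt2.ext' fun v w => ?_
  have hfg : SmoothAt E (fun y => f y + g y) x := hf.add hg
  have e : (hessAt (fun y => f y + g y) x : E →L[ℝ] E →L[ℝ] ℝ) = hessAt f x + hessAt g x :=
    hess_add hf.flat2 hg.flat2
  rw [ddc_apply hfg]
  simp only [ContinuousAlternatingMap.add_apply, ddc_apply hf, ddc_apply hg, e, add_apply]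
  push_cast
  ring

theorem dif_mul {f g : X → ℝ} {x : X} (hf : SmoothAt E f x) (hg : SmoothAt E g x) :
    dif E (fun y => f y * g y) x = f x • dif E g x + g x • dif E f x := by
  have h := fderiv_mul (hf.flat.differentiableAt (by simp)) (hg.flat.differentiableAt (by simp))
  simp only [Function.comp_apply, (chartAt E x).left_inv (mem_chart_source E x)] at h
  exact h

theorem dif_comp {f : X → ℝ} {h : ℝ → ℝ} {x : X} (hf : SmoothAt E f x) (hh : ContDiff ℝ ∞ h) :
    dif E (fun y => h (f y)) x = deriv h (f x) • dif E f x := by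
  have h2 := (((hh.differentiable (by simp)) ((f ∘ (chartAt E x).symm) (chartAt E x x))).hasDerivAt.comp_hasFDerivAt _
    (hf.flat.differentiableAt (by simp)).hasFDerivAt).fderiv
  simp only [Function.comp_apply, (chartAt E x).left_inv (mem_chart_source E x)] at h2
  exact h2

theorem dif_add {f g : X → ℝ} {x : X} (hf : SmoothAt E f x) (hg : SmoothAt E g x) :
    dif E (fun y => f y + g y) x = dif E f x + dif E g x :=
  fderiv_add (hf.flat.differentiableAt (by simp)) (hg.flat.differentiableAt (by simp))

omit [NormedSpace ℂ E] in
theorem tendsto_chart_symm (x : X) : Tendsto (chartAt E x).symm (𝓝 (chartAt E x x)) (𝓝 x) := by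
  have := (chartAt E x).continuousAt_symm (mem_chart_target E x)
  rwa [ContinuousAt, (chartAt E x).left_inv (mem_chart_source E x)] at this

theorem ddc_congr {f g : X → ℝ} {x : X} (h : f =ᶠ[𝓝 x] g) : (ddc f x : Alt2 E) = ddc g x := by
  refine iddbarFlat_congr ?_
  filter_upwards [(tendsto_chart_symm (E := E) x).eventually h] with y hy
  simp [hy]

theorem dif_congr {f g : X → ℝ} {x : X} (h : f =ᶠ[𝓝 x] g) : dif E f x = dif E g x := by
  refine Filter.EventuallyEq.fderiv_eq ?_
  filter_upwards [(tendsto_chart_symm (E := E) x).eventually h] with y hy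
  simp [hy]

theorem ddc_const (a : ℝ) (x : X) : (ddc (fun _ : X => a) x : Alt2 E) = 0 := by
  refine Alt2.ext' fun v w => ?_
  have e : (hessAt (fun _ : X => a) x : E →L[ℝ] E →L[ℝ] ℝ) = 0 := by
    simp [hessAt, hess, Function.comp_def]
  rw [ddc_apply contMDiffAt_const, e]
  simp

theorem dif_const (a : ℝ) (x : X) : dif E (fun _ : X => a) x = 0 := by
  simp [dif, Function.comp_def]

theorem ddc_const_mul {f : X → ℝ} {x : X} (hf : SmoothAt E f x) (a : ℝ) :
    ddc (fun y => a * f y) x = (a • ddc f x : Alt2 E) := by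
  rw [ddc_mul contMDiffAt_const hf, ddc_const, dif_const]
  have : gam (0 : E →L[ℝ] ℝ) (dif E f x) = 0 := by
    exact Alt2.ext' fun v w => by simp [gam_apply]
  rw [this]
  module

/-- A complex function and its real and imaginary parts. -/
theorem iddbar_re_im {φ : X → ℂ} {x : X} (hφ : ContMDiffAt 𝓘(ℝ, E) 𝓘(ℝ, ℂ) ∞ φ x) :
    (iddbar φ x : Alt2 E) = ddc (fun y => (φ y).re) x + Complex.I • ddc (fun y => (φ y).im) x := by
  have hre : SmoothAt E (fun y => (φ y).re) x :=
    Complex.reCLM.contDiff.contDiffAt.contMDiffAt.comp x hφ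
  have him : SmoothAt E (fun y => (φ y).im) x :=
    Complex.imCLM.contDiff.contDiffAt.contMDiffAt.comp x hφ
  have hf : ContDiffAt ℝ ∞ (φ ∘ (chartAt E x).symm) (chartAt E x x) := by
    have h := (contMDiffAt_iff.1 hφ).2
    simp only [mfld_simps, contDiffWithinAt_univ] at h
    exact h
  have hf2 : ContDiffAt ℝ 2 (φ ∘ (chartAt E x).symm) (chartAt E x x) :=
    hf.of_le two_le_infty
  set F := φ ∘ (chartAt E x).symm
  set z := chartAt E x x
  have hcomp : ∀ L : ℂ →L[ℝ] ℝ, ∀ v w, hess (fun y => L (F y)) z v w =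
      L (fderiv ℝ (fderiv ℝ F) z v w) := by
    intro L v w
    have h : fderiv ℝ (fun y => L (F y)) =ᶠ[𝓝 z] fun y => L.comp (fderiv ℝ F y) := by
      filter_upwards [hf2.eventually (by simp)] with y hy
      exact (L.hasFDerivAt.comp y (hy.differentiableAt (by simp)).hasFDerivAt).fderiv
    have hd : DifferentiableAt ℝ (fderiv ℝ F) z :=
      (hf2.fderiv_right (m := 1) (by norm_num)).differentiableAt (by simp)
    rw [hess, h.fderiv_eq]
    have h3 := ((ContinuousLinearMap.compL ℝ E ℂ ℝ L).hasFDerivAt.comp z hd.hasFDerivAt).fderiv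
    erw [h3]
    rfl
  refine Alt2.ext' fun v w => ?_
  rw [ContinuousAlternatingMap.add_apply, ContinuousAlternatingMap.smul_apply, ddc_apply hre,
    ddc_apply him]
  have h1 : ∀ v w : E, hessAt (fun y => (φ y).re) x v w = (fderiv ℝ (fderiv ℝ F) z v w).re :=
    hcomp Complex.reCLM
  have h2 : ∀ v w : E, hessAt (fun y => (φ y).im) x v w = (fderiv ℝ (fderiv ℝ F) z v w).im :=
    hcomp Complex.imCLM
  have h3 : iddbar φ x ![v, w] = _ := iddbarFlat_apply hf2 v w
  rw [h1, h1, h2, h2, h3]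
  apply Complex.ext <;> simp

end Forms

/-! ### Smooth forms, test functions and values of currents -/

section TestForms

variable {E : Type*} [NormedAddCommGroup E] [NormedSpace ℂ E]
variable {X : Type*} [TopologicalSpace X] [ChartedSpace E X]

/-- A `2`-form is smooth on `U`. -/
def SmoothFormOn (α : TwoForm E X) (U : Set X) : Prop :=
  ∀ e ∈ atlas E X, ContDiffOn ℝ ∞ (α.inChart e) (e.target ∩ e.symm ⁻¹' U)

theorem SmoothFormOn.congr {α β : TwoForm E X} {U : Set X} (h : SmoothFormOn α U)
    (hαβ : ∀ x ∈ U, β x = α x) : SmoothFormOn β U :=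
  fun e he => (h e he).congr fun z hz => by simp only [TwoForm.inChart, hαβ _ hz.2]

theorem SmoothFormOn.add {α β : TwoForm E X} {U : Set X} (h : SmoothFormOn α U)
    (h' : SmoothFormOn β U) : SmoothFormOn (fun x => α x + β x) U :=
  fun e he => (h e he).add (h' e he)

theorem SmoothFormOn.const_smul {α : TwoForm E X} {U : Set X} (h : SmoothFormOn α U) (a : ℂ) :
    SmoothFormOn (fun x => a • α x) U :=
  fun e he => (h e he).const_smul a

theorem SmoothFormOn.smul [IsManifold 𝓘(ℂ, E) ω X] {α : TwoForm E X} {U : Set X}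
    (h : SmoothFormOn α U) {g : X → ℂ}
    (hg : ContMDiffOn 𝓘(ℝ, E) 𝓘(ℝ, ℂ) ∞ g U) : SmoothFormOn (fun x => g x • α x) U := by
  intro e he
  have h1 := contDiffOn_comp_symm hg he
  have h3 : TwoForm.inChart (fun x => g x • α x) e =
      fun y => (g ∘ e.symm) y • α.inChart e y := by
    funext y
    ext v
    rfl
  rw [h3]
  exact ContDiffOn.smul h1 (h e he)

theorem SmoothFormOn.mem {α : TwoForm E X} {U : Set X} (h : SmoothFormOn α U) (hU : IsOpen U)
    (hc : HasCompactSupport α) (hs : tsupport α ⊆ U) : α ∈ testForms E X := by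
  refine mem_testForms.2 ⟨fun e he z hz => ?_, hc⟩
  by_cases hzU : e.symm z ∈ U
  · exact ((h e he).contDiffAt ((e.isOpen_inter_preimage_symm hU).mem_nhds
      ⟨hz, hzU⟩)).contDiffWithinAt
  · have hn : e.target ∩ e.symm ⁻¹' (tsupport α)ᶜ ∈ 𝓝 z :=
      (e.isOpen_inter_preimage_symm (isClosed_tsupport α).isOpen_compl).mem_nhds
        ⟨hz, fun h' => hzU (hs h')⟩
    refine ContDiffAt.contDiffWithinAt ((contDiffAt_const (c := 0)).congr_of_eventuallyEq ?_)
    filter_upwards [hn] with y hy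
    have : α (e.symm y) = 0 := image_eq_zero_of_notMem_tsupport hy.2
    ext v
    simp only [TwoForm.inChart, this]
    rfl

theorem smoothFormOn_of_mem {α : TwoForm E X} (hα : α ∈ testForms E X) (U : Set X) :
    SmoothFormOn α U :=
  fun e he => (hα.1 e he).mono inter_subset_left

theorem contMDiffOn_ofReal {f : X → ℝ} {U : Set X} (hf : ContMDiffOn 𝓘(ℝ, E) 𝓘(ℝ, ℝ) ∞ f U) :
    ContMDiffOn 𝓘(ℝ, E) 𝓘(ℝ, ℂ) ∞ (fun y => (f y : ℂ)) U :=
  (Complex.ofRealCLM.contDiff.contMDiff (n := ∞)).comp_contMDiffOn hf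

theorem smoothFormOn_ddc [IsManifold 𝓘(ℂ, E) ω X] {f : X → ℝ} {U : Set X} (hU : IsOpen U)
    (hf : ContMDiffOn 𝓘(ℝ, E) 𝓘(ℝ, ℝ) ∞ f U) : SmoothFormOn (E := E) (ddc f) U :=
  fun _ he => contDiffOn_iddbar_inChart hU (contMDiffOn_ofReal hf) he

theorem SmoothFormOn.real_smul [IsManifold 𝓘(ℂ, E) ω X] {α : TwoForm E X} {U : Set X}
    (h : SmoothFormOn α U) {g : X → ℝ}
    (hg : ContMDiffOn 𝓘(ℝ, E) 𝓘(ℝ, ℝ) ∞ g U) : SmoothFormOn (fun x => g x • α x) U := by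
  exact (h.smul (contMDiffOn_ofReal hg)).congr fun x _ => (Complex.coe_smul (g x) (α x)).symm

variable (E) in
/-- The form `(i/2)(∂f ∧ ∂̄g + ∂g ∧ ∂̄f)`. -/
def gamForm (f g : X → ℝ) : TwoForm E X := fun x => gam (dif E f x) (dif E g x)

theorem ContMDiffOn.smoothAt {f : X → ℝ} {U : Set X} (hf : ContMDiffOn 𝓘(ℝ, E) 𝓘(ℝ, ℝ) ∞ f U)
    (hU : IsOpen U) {x : X} (hx : x ∈ U) : SmoothAt E f x :=
  hf.contMDiffAt (hU.mem_nhds hx)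

/-- The product rule expresses `gamForm E f g` by `i∂∂̄` of `f g`, `f` and `g`, whose smoothness in
all charts is already known. -/
theorem smoothFormOn_gamForm [IsManifold 𝓘(ℂ, E) ω X] {f g : X → ℝ} {U : Set X} (hU : IsOpen U)
    (hf : ContMDiffOn 𝓘(ℝ, E) 𝓘(ℝ, ℝ) ∞ f U) (hg : ContMDiffOn 𝓘(ℝ, E) 𝓘(ℝ, ℝ) ∞ g U) :
    SmoothFormOn (gamForm E f g) U := by
  have h := (((smoothFormOn_ddc hU (hf.mul hg)).add
    (((smoothFormOn_ddc hU hg).real_smul hf).const_smul (-1))).add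
    (((smoothFormOn_ddc hU hf).real_smul hg).const_smul (-1))).const_smul (1 / 2)
  refine h.congr fun x hx => ?_
  have e := ddc_mul (ContMDiffOn.smoothAt hf hU hx) (ContMDiffOn.smoothAt hg hU hx)
  have e' : (ddc (f * g) x : Alt2 E) = f x • ddc g x + g x • ddc f x +
    (2 : ℝ) • gam (dif E f x) (dif E g x) := e
  rw [e']
  change gam (dif E f x) (dif E g x) = _
  module

variable (E) in
/-- Smooth real functions with compact support. -/
structure IsRTest (φ : X → ℝ) : Prop where
  smooth : ContMDiff 𝓘(ℝ, E) 𝓘(ℝ, ℝ) ∞ φ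
  compact : HasCompactSupport φ

theorem IsRTest.ofReal {φ : X → ℝ} (h : IsRTest E φ) : IsTestFunction E fun x => (φ x : ℂ) :=
  ⟨(Complex.ofRealCLM.contDiff.contMDiff (n := ∞)).comp h.smooth,
    h.compact.comp_left (g := fun r : ℝ => (r : ℂ)) rfl⟩

theorem IsTestFunction.re {φ : X → ℂ} (h : IsTestFunction E φ) : IsRTest E fun x => (φ x).re :=
  ⟨(Complex.reCLM.contDiff.contMDiff (n := ∞)).comp h.smooth,
    h.compact.comp_left (g := Complex.re) rfl⟩

theorem IsTestFunction.im {φ : X → ℂ} (h : IsTestFunction E φ) : IsRTest E fun x => (φ x).im :=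
  ⟨(Complex.imCLM.contDiff.contMDiff (n := ∞)).comp h.smooth,
    h.compact.comp_left (g := Complex.im) rfl⟩

theorem IsRTest.ddc_mem [IsManifold 𝓘(ℂ, E) ω X] {φ : X → ℝ} (h : IsRTest E φ) :
    (ddc φ : TwoForm E X) ∈ testForms E X := iddbar_mem h.ofReal

omit [ChartedSpace E X] in
theorem tsupport_smul_form_subset (φ : X → ℝ) (α : TwoForm E X) :
    tsupport (fun x => φ x • α x : TwoForm E X) ⊆ tsupport φ := by
  refine closure_mono fun x hx h0 => hx ?_
  change φ x • α x = 0
  rw [h0]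
  exact zero_smul ℝ (α x)

theorem IsRTest.smul_mem [IsManifold 𝓘(ℂ, E) ω X] {φ : X → ℝ} (h : IsRTest E φ) {U : Set X}
    (hU : IsOpen U) (hs : tsupport φ ⊆ U) {α : TwoForm E X} (hα : SmoothFormOn α U) :
    (fun x => φ x • α x : TwoForm E X) ∈ testForms E X :=
  (hα.real_smul h.smooth.contMDiffOn).mem hU
    (h.compact.of_isClosed_subset (isClosed_tsupport _) (tsupport_smul_form_subset φ α))
    ((tsupport_smul_form_subset φ α).trans hs)

theorem IsRTest.mul {φ : X → ℝ} (h : IsRTest E φ) {U : Set X}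
    (hU : IsOpen U) (hs : tsupport φ ⊆ U) {g : X → ℝ} (hg : ContMDiffOn 𝓘(ℝ, E) 𝓘(ℝ, ℝ) ∞ g U) :
    IsRTest E (fun x => φ x * g x) := by
  refine ⟨fun x => ?_, h.compact.mul_right⟩
  by_cases hx : x ∈ U
  · exact (h.smooth x).mul (hg.contMDiffAt (hU.mem_nhds hx))
  · have h0 : φ =ᶠ[𝓝 x] fun _ => 0 :=
      notMem_tsupport_iff_eventuallyEq.1 fun h' => hx (hs h')
    refine (contMDiffAt_const (c := (0 : ℝ))).congr_of_eventuallyEq ?_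
    filter_upwards [h0] with y hy
    simp [hy]

theorem IsRTest.const_mul {φ : X → ℝ} (h : IsRTest E φ) (a : ℝ) :
    IsRTest E (fun x => a * φ x) := ⟨contMDiff_const.mul h.smooth, h.compact.mul_left⟩

theorem IsRTest.sq {φ : X → ℝ} (h : IsRTest E φ) : IsRTest E (fun x => φ x ^ 2) := by
  simpa [pow_two] using h.mul isOpen_univ (subset_univ _) h.smooth.contMDiffOn

/-- The value of a current on a form which is known to be a test form. -/
def Current.ev (T : Current E X) (α : TwoForm E X) : ℂ := by
  classical exact if h : α ∈ testForms E X then T ⟨α, h⟩ else 0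

namespace Current

variable (T : Current E X)

theorem ev_eq {α : TwoForm E X} (h : α ∈ testForms E X) : T.ev α = T ⟨α, h⟩ := by
  simp [ev, h]

theorem ev_add {α β : TwoForm E X} (hα : α ∈ testForms E X) (hβ : β ∈ testForms E X) :
    T.ev (fun x => α x + β x) = T.ev α + T.ev β := by
  rw [T.ev_eq hα, T.ev_eq hβ, ← map_add, ← T.ev_eq]
  rfl

theorem ev_smul {α : TwoForm E X} (hα : α ∈ testForms E X) (a : ℂ) :
    T.ev (fun x => a • α x) = a * T.ev α := by
  rw [T.ev_eq hα, ← smul_eq_mul, ← map_smul, ← T.ev_eq]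
  rfl

theorem ev_real_smul {α : TwoForm E X} (hα : α ∈ testForms E X) (a : ℝ) :
    T.ev (fun x => a • α x) = a * T.ev α := by
  rw [← T.ev_smul hα]
  congr 1

theorem real_smul_mem {α : TwoForm E X} (hα : α ∈ testForms E X) (a : ℝ) :
    (fun x => a • α x : TwoForm E X) ∈ testForms E X := by
  have := (testForms E X).smul_mem (a : ℂ) hα
  convert this using 1
  funext x
  exact (Complex.coe_smul a (α x)).symm

theorem add_mem {α β : TwoForm E X} (hα : α ∈ testForms E X) (hβ : β ∈ testForms E X) :
    (fun x => α x + β x : TwoForm E X) ∈ testForms E X := (testForms E X).add_mem hα hβ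

theorem sum_mem {κ : Type*} (s : Finset κ) {α : κ → TwoForm E X}
    (hα : ∀ k ∈ s, α k ∈ testForms E X) :
    (fun x => ∑ k ∈ s, α k x : TwoForm E X) ∈ testForms E X := by
  have := (testForms E X).sum_mem hα
  convert this using 1
  funext x
  rw [Finset.sum_apply]

theorem ev_sum {κ : Type*} (s : Finset κ) {α : κ → TwoForm E X}
    (hα : ∀ k ∈ s, α k ∈ testForms E X) :
    T.ev (fun x => ∑ k ∈ s, α k x) = ∑ k ∈ s, T.ev (α k) := by
  classical
  induction s using Finset.induction_on with
  | empty =>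
    simp only [Finset.sum_empty]
    rw [T.ev_eq (α := fun _ => 0) (testForms E X).zero_mem]
    exact map_zero T.toFun
  | insert a s ha ih =>
    simp only [Finset.sum_insert ha]
    rw [T.ev_add (hα a (Finset.mem_insert_self a s))
      (sum_mem s fun k hk => hα k (Finset.mem_insert_of_mem hk)),
      ih fun k hk => hα k (Finset.mem_insert_of_mem hk)]

variable {T}

theorem IsPositive.ev_nonneg (hT : T.IsPositive) {α : TwoForm E X} (hα : α ∈ testForms E X)
    (h : ∀ x, PosForm (α x)) : 0 ≤ (T.ev α).re := by
  rw [T.ev_eq hα]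
  exact (hT ⟨α, hα⟩ h).1

theorem IsPositive.ev_im (hT : T.IsPositive) {α : TwoForm E X} (hα : α ∈ testForms E X)
    (h : ∀ x, PosForm (α x)) : (T.ev α).im = 0 := by
  rw [T.ev_eq hα]
  exact (hT ⟨α, hα⟩ h).2

theorem IsPositive.ev_mono (hT : T.IsPositive) {α β : TwoForm E X} (hα : α ∈ testForms E X)
    (hβ : β ∈ testForms E X) (h : ∀ x, PosForm (β x + (-1 : ℝ) • α x)) :
    (T.ev α).re ≤ (T.ev β).re := by
  have h1 := hT.ev_nonneg (add_mem hβ (real_smul_mem hα (-1))) h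
  rw [T.ev_add hβ (real_smul_mem hα (-1)), T.ev_real_smul hα] at h1
  simp only [Complex.add_re, Complex.re_ofReal_mul] at h1
  linarith

end Current

end TestForms

open MeasureTheory Metric

/-! ### Covers by coordinate balls and functions lifted from charts -/

section Cover

variable {E : Type*} [NormedAddCommGroup E] [NormedSpace ℂ E]
variable {X : Type*} [TopologicalSpace X] [ChartedSpace E X]

variable (E X) in
/-- A countable cover of `X` by preimages of balls under charts, together with a subordinate smooth
partition of unity. -/
structure Cover where
  p : ℕ → X
  r : ℕ → ℝ
  r_pos : ∀ i, 0 < r i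
  closedBall_subset : ∀ i, closedBall (chartAt E (p i) (p i)) (3 * r i) ⊆ (chartAt E (p i)).target
  χ : SmoothPartitionOfUnity ℕ 𝓘(ℝ, E) X univ
  tsupport_subset : ∀ i, tsupport (χ i) ⊆
    (chartAt E (p i)).source ∩ chartAt E (p i) ⁻¹' ball (chartAt E (p i) (p i)) (r i)

/-- The radii are a third of what the charts allow: the partition of unity lives in the balls of
radius `r`, and the shells up to `3 r` leave room for cutoffs and convolutions. -/
theorem exists_cover [FiniteDimensional ℂ E] [T2Space X] [SecondCountableTopology X]
    [IsManifold 𝓘(ℂ, E) ω X] [Nonempty X] : Nonempty (Cover E X) := by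
  have := isManifold_real E X
  have : LocallyCompactSpace X := ChartedSpace.locallyCompactSpace E X
  have h1 : ∀ x : X, ∃ r : ℝ, 0 < r ∧ closedBall (chartAt E x x) (3 * r) ⊆ (chartAt E x).target := by
    intro x
    obtain ⟨δ, hδ, h⟩ := nhds_basis_closedBall.mem_iff.1
      ((chartAt E x).open_target.mem_nhds (mem_chart_target E x))
    exact ⟨δ / 3, by positivity, by rwa [mul_div_cancel₀ _ (by norm_num : (3 : ℝ) ≠ 0)]⟩
  choose r hr hsub using h1
  set U : X → Set X := fun x => (chartAt E x).source ∩ chartAt E x ⁻¹' ball (chartAt E x x) (r x)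
  have hUo : ∀ x, IsOpen (U x) := fun x => (chartAt E x).isOpen_inter_preimage isOpen_ball
  have hU : ∀ x, U x ∈ 𝓝 x := fun x =>
    (hUo x).mem_nhds ⟨mem_chart_source E x, mem_ball_self (hr x)⟩
  obtain ⟨s, hs, hcov⟩ := TopologicalSpace.countable_cover_nhds hU
  have hne : s.Nonempty := by
    by_contra h
    rw [not_nonempty_iff_eq_empty] at h
    rw [h, biUnion_empty] at hcov
    exact empty_ne_univ hcov
  obtain ⟨p, rfl⟩ := hs.exists_eq_range hne
  obtain ⟨χ, hχ⟩ := SmoothPartitionOfUnity.exists_isSubordinate 𝓘(ℝ, E) (isClosed_univ (X := X))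
    (fun n => U (p n)) (fun n => hUo _) (by rw [← hcov]; simp)
  exact ⟨⟨p, fun n => r (p n), fun n => hr _, fun n => hsub _, χ, hχ⟩⟩

/-- The extension by zero of a function which is given in a chart. -/
def lift (e : OpenPartialHomeomorph X E) (g : E → ℝ) (x : X) : ℝ := by
  classical exact if x ∈ e.source then g (e x) else 0

omit [NormedSpace ℂ E] [ChartedSpace E X] in
theorem lift_of_mem {e : OpenPartialHomeomorph X E} {g : E → ℝ} {x : X} (hx : x ∈ e.source) :
    lift e g x = g (e x) := by simp [lift, hx]

omit [NormedSpace ℂ E] [ChartedSpace E X] in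
theorem lift_of_notMem {e : OpenPartialHomeomorph X E} {g : E → ℝ} {x : X} (hx : x ∉ e.source) :
    lift e g x = 0 := by simp [lift, hx]

omit [NormedSpace ℂ E] [ChartedSpace E X] in
theorem tsupport_lift [T2Space X] {e : OpenPartialHomeomorph X E} {g : E → ℝ}
    (hc : HasCompactSupport g) (hs : tsupport g ⊆ e.target) :
    IsCompact (e.symm '' tsupport g) ∧ tsupport (lift e g) ⊆ e.symm '' tsupport g := by
  have h1 : IsCompact (e.symm '' tsupport g) := hc.isCompact.image_of_continuousOn
    (e.continuousOn_symm.mono hs)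
  refine ⟨h1, closure_minimal (fun x hx => ?_) h1.isClosed⟩
  by_cases h : x ∈ e.source
  · rw [Function.mem_support, lift_of_mem h] at hx
    exact ⟨e x, subset_tsupport g hx, e.left_inv h⟩
  · exact absurd (lift_of_notMem h) hx

theorem contMDiffOn_chart [IsManifold 𝓘(ℂ, E) ω X] {e : OpenPartialHomeomorph X E}
    (he : e ∈ atlas E X) : ContMDiffOn 𝓘(ℝ, E) 𝓘(ℝ, E) ∞ e e.source := by
  have := isManifold_real E X
  exact contMDiffOn_of_mem_maximalAtlas (IsManifold.subset_maximalAtlas he)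

theorem contMDiffOn_comp_chart [IsManifold 𝓘(ℂ, E) ω X] {e : OpenPartialHomeomorph X E}
    (he : e ∈ atlas E X) {g : E → ℝ} {V : Set E} (hg : ContDiffOn ℝ ∞ g V) :
    ContMDiffOn 𝓘(ℝ, E) 𝓘(ℝ, ℝ) ∞ (fun x => g (e x)) (e.source ∩ e ⁻¹' V) :=
  hg.contMDiffOn.comp ((contMDiffOn_chart he).mono inter_subset_left) fun _ hx => hx.2

theorem isRTest_lift [T2Space X] [IsManifold 𝓘(ℂ, E) ω X] {e : OpenPartialHomeomorph X E}
    (he : e ∈ atlas E X) {g : E → ℝ} (hg : ContDiff ℝ ∞ g) (hc : HasCompactSupport g)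
    (hs : tsupport g ⊆ e.target) : IsRTest E (lift e g) := by
  obtain ⟨h1, h2⟩ := tsupport_lift hc hs
  have hsub : e.symm '' tsupport g ⊆ e.source := by
    rintro _ ⟨z, hz, rfl⟩
    exact e.map_target (hs hz)
  refine ⟨fun x => ?_, h1.of_isClosed_subset (isClosed_tsupport _) h2⟩
  by_cases h : x ∈ e.source
  · have h3 : ContMDiffAt 𝓘(ℝ, E) 𝓘(ℝ, ℝ) ∞ (fun x => g (e x)) x :=
      (contMDiffOn_comp_chart he hg.contDiffOn (V := univ)).contMDiffAt
        (by simpa using e.open_source.mem_nhds h)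
    refine h3.congr_of_eventuallyEq ?_
    filter_upwards [e.open_source.mem_nhds h] with y hy using lift_of_mem hy
  · have h0 : lift e g =ᶠ[𝓝 x] fun _ => 0 :=
      notMem_tsupport_iff_eventuallyEq.1 fun h' => h (hsub (h2 h'))
    exact (contMDiffAt_const (c := (0 : ℝ))).congr_of_eventuallyEq h0

/-- The differential of the inverse of a chart, as a map of `E`. -/
def symmD (e : OpenPartialHomeomorph X E) (z : E) : E →L[ℝ] E :=
  mfderiv 𝓘(ℝ, E) 𝓘(ℝ, E) e.symm z

theorem inChart_apply (α : TwoForm E X) (e : OpenPartialHomeomorph X E) (z v w : E) :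
    α.inChart e z ![v, w] = α (e.symm z) ![symmD e z v, symmD e z w] :=
  comp_pair (α (e.symm z)) (symmD e z) v w

theorem symmD_eq [IsManifold 𝓘(ℂ, E) ω X] {e : OpenPartialHomeomorph X E}
    (he : e ∈ atlas E X) {z : E} (hz : z ∈ e.target) :
    symmD e z = fderiv ℝ (chartAt E (e.symm z) ∘ e.symm) z := mfderiv_symm_eq he hz

/-- The differential of the inverse of a chart is complex linear. -/
theorem symmD_I [IsManifold 𝓘(ℂ, E) ω X] {e : OpenPartialHomeomorph X E}
    (he : e ∈ atlas E X) {z : E} (hz : z ∈ e.target) (v : E) :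
    symmD e z (Complex.I • v) = Complex.I • symmD e z v := by
  rw [symmD_eq he hz]
  have hsrc : z ∈ (e.symm ≫ₕ chartAt E (e.symm z)).source := by simp [hz]
  have hg : ContDiffAt ℂ ω (chartAt E (e.symm z) ∘ e.symm) z :=
    (contDiffOn_transition he (chart_mem_atlas E _)).contDiffAt
      ((e.symm ≫ₕ chartAt E (e.symm z)).open_source.mem_nhds hsrc)
  have e1 := (hg.differentiableAt (by simp)).fderiv_restrictScalars ℝ
  rw [e1]
  exact map_smul (fderiv ℂ (chartAt E (e.symm z) ∘ e.symm) z) Complex.I v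

/-- The differential of the inverse of a chart is surjective. -/
theorem symmD_surj [IsManifold 𝓘(ℂ, E) ω X] {e : OpenPartialHomeomorph X E}
    (he : e ∈ atlas E X) {z : E} (hz : z ∈ e.target) :
    Function.Surjective (symmD e z) := by
  have := isManifold_real E X
  have : IsManifold 𝓘(ℝ, E) 1 X := .of_le (n := ∞) (by simp)
  have h1 := mdifferentiableAt_atlas_symm (I := 𝓘(ℝ, E)) he hz
  have h2 := mdifferentiableAt_atlas (I := 𝓘(ℝ, E)) he (e.map_target hz)
  have h3 : (mfderiv 𝓘(ℝ, E) 𝓘(ℝ, E) (e.symm ∘ e) (e.symm z)) = _ :=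
    mfderiv_comp (e.symm z) (by rw [e.right_inv hz]; exact h1) h2
  have h4 : (mfderiv 𝓘(ℝ, E) 𝓘(ℝ, E) (e.symm ∘ e) (e.symm z)) =
      mfderiv 𝓘(ℝ, E) 𝓘(ℝ, E) (id : X → X) (e.symm z) := by
    refine Filter.EventuallyEq.mfderiv_eq ?_
    filter_upwards [e.open_source.mem_nhds (e.map_target hz)] with y hy
    simp [e.left_inv hy]
  rw [h4, mfderiv_id] at h3
  rw [e.right_inv hz] at h3
  intro v
  refine ⟨(mfderiv 𝓘(ℝ, E) 𝓘(ℝ, E) e (e.symm z) : E →L[ℝ] E) v, ?_⟩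
  exact (congrArg (fun L : E →L[ℝ] E => L v) h3).symm

theorem eq_of_inChart_eq [IsManifold 𝓘(ℂ, E) ω X] {e : OpenPartialHomeomorph X E}
    (he : e ∈ atlas E X) {x : X} (hx : x ∈ e.source) {α β : TwoForm E X}
    (h : α.inChart e (e x) = β.inChart e (e x)) : α x = β x := by
  refine Alt2.ext' fun v w => ?_
  obtain ⟨v', hv⟩ := symmD_surj he (e.map_source hx) v
  obtain ⟨w', hw⟩ := symmD_surj he (e.map_source hx) w
  have h2 := congrArg (fun ξ : Alt2 E => ξ ![v', w']) h
  have e1 : ∀ γ : TwoForm E X, γ.inChart e (e x) ![v', w'] = γ x ![v, w] := by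
    intro γ
    rw [inChart_apply, hv, hw, e.left_inv hx]
  rw [← e1, ← e1]; exact h2

end Cover

/-! ### Currents given by a density and a measure -/

section Density

variable {E : Type*} [NormedAddCommGroup E] [NormedSpace ℂ E]
variable {X : Type*} [TopologicalSpace X] [ChartedSpace E X]

namespace Cover

/-- The charts of a cover. -/
abbrev e (𝒦 : Cover E X) (i : ℕ) : OpenPartialHomeomorph X E := chartAt E (𝒦.p i)

/-- The centers of the balls of a cover. -/
abbrev c (𝒦 : Cover E X) (i : ℕ) : E := 𝒦.e i (𝒦.p i)

/-- The region of the chart where the partition of unity lives. -/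
abbrev B (𝒦 : Cover E X) (i : ℕ) : Set E := ball (𝒦.c i) (𝒦.r i)

variable (𝒦 : Cover E X)

theorem closedBall_subset_target (i : ℕ) {s : ℝ} (hs : s ≤ 3 * 𝒦.r i) :
    closedBall (𝒦.c i) s ⊆ (𝒦.e i).target :=
  (closedBall_subset_closedBall hs).trans (𝒦.closedBall_subset i)

theorem B_subset_target (i : ℕ) : 𝒦.B i ⊆ (𝒦.e i).target :=
  ball_subset_closedBall.trans
    (𝒦.closedBall_subset_target i (by linarith [𝒦.r_pos i]))

theorem finite_meeting {K : Set X} (hK : IsCompact K) :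
    {i | (tsupport (𝒦.χ i) ∩ K).Nonempty}.Finite :=
  𝒦.χ.locallyFinite.closure.finite_nonempty_inter_compact hK

end Cover

variable [FiniteDimensional ℂ E]

theorem pcoef_add (p : PIdx E) (ξ η : Alt2 E) : pcoef p (ξ + η) = pcoef p ξ + pcoef p η := by
  simp only [pcoef, pr11_apply, ContinuousAlternatingMap.add_apply]; ring

theorem pcoef_smul (p : PIdx E) (a : ℂ) (ξ : Alt2 E) : pcoef p (a • ξ) = a * pcoef p ξ := by
  simp only [pcoef, pr11_apply, ContinuousAlternatingMap.smul_apply, smul_eq_mul]; ring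

/-- A seminorm of forms, given by the evaluations on finitely many pairs of vectors. -/
def nrm (ξ : Alt2 E) : ℝ :=
  ∑ j, ∑ k, (‖ξ ![bas E j, bas E k]‖ + ‖ξ ![Complex.I • bas E j, Complex.I • bas E k]‖)

theorem nrm_nonneg (ξ : Alt2 E) : 0 ≤ nrm ξ :=
  Finset.sum_nonneg fun _ _ => Finset.sum_nonneg fun _ _ => by positivity

theorem norm_pcoef_le (p : PIdx E) (ξ : Alt2 E) : ‖pcoef p ξ‖ ≤ nrm ξ := by
  obtain ⟨⟨j, k⟩, q⟩ := p
  have h1 : ‖(![-1 / 2, 1 / 2, 1 / 2] q : ℂ)‖ ≤ 1 := by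
    fin_cases q <;> norm_num
  have h2 : ‖pr11 ξ ![bas E j, bas E k]‖ ≤
      ‖ξ ![bas E j, bas E k]‖ + ‖ξ ![Complex.I • bas E j, Complex.I • bas E k]‖ := by
    rw [pr11_apply, norm_mul]
    have := norm_add_le (ξ ![bas E j, bas E k]) (ξ ![Complex.I • bas E j, Complex.I • bas E k])
    have h3 : ‖(1 / 2 : ℂ)‖ ≤ 1 := by norm_num
    nlinarith [norm_nonneg (ξ ![bas E j, bas E k] +
      ξ ![Complex.I • bas E j, Complex.I • bas E k])]
  have h4 : ‖ξ ![bas E j, bas E k]‖ + ‖ξ ![Complex.I • bas E j, Complex.I • bas E k]‖ ≤ nrm ξ := by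
    refine le_trans ?_ (Finset.single_le_sum (f := fun j => ∑ k, (‖ξ ![bas E j, bas E k]‖ +
      ‖ξ ![Complex.I • bas E j, Complex.I • bas E k]‖)) (fun _ _ => Finset.sum_nonneg fun _ _ => by
        positivity) (Finset.mem_univ j))
    exact Finset.single_le_sum (f := fun k => (‖ξ ![bas E j, bas E k]‖ +
      ‖ξ ![Complex.I • bas E j, Complex.I • bas E k]‖)) (fun _ _ => by positivity)
        (Finset.mem_univ k)
  rw [pcoef, norm_mul]
  calc _ ≤ 1 * ‖pr11 ξ ![bas E j, bas E k]‖ := by gcongr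
    _ ≤ nrm ξ := by rw [one_mul]; exact h2.trans h4

theorem nrm_le : ∃ C : ℝ, 0 ≤ C ∧ ∀ ξ : Alt2 E, nrm ξ ≤ C * ‖ξ‖ := by
  have h : ∀ (ξ : Alt2 E) (v w : E), ‖ξ ![v, w]‖ ≤ (‖v‖ * ‖w‖) * ‖ξ‖ := by
    intro ξ v w
    have := ξ.le_opNorm ![v, w]
    rw [Fin.prod_univ_two] at this
    simpa [mul_comm] using this
  refine ⟨∑ j : Idx E, ∑ k : Idx E, (‖bas E j‖ * ‖bas E k‖ +
    ‖Complex.I • bas E j‖ * ‖Complex.I • bas E k‖), by positivity, fun ξ => ?_⟩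
  rw [nrm, Finset.sum_mul]
  refine Finset.sum_le_sum fun j _ => ?_
  rw [Finset.sum_mul]
  refine Finset.sum_le_sum fun k _ => ?_
  rw [add_mul]
  exact add_le_add (h _ _ _) (h _ _ _)

variable [MeasurableSpace E]

/-- A measurable family of positive functionals on `(1,1)`-forms, along a cover of `X`. -/
structure Density (𝒦 : Cover E X) where
  g : ℕ → PIdx E → E → ℝ
  meas : ∀ i p, Measurable (g i p)
  bdd : ∀ i, ∃ C : ℝ, ∀ p z, |g i p z| ≤ C
  supp : ∀ i p z, g i p z ≠ 0 → z ∈ 𝒦.B i ∧ (𝒦.e i).symm z ∈ tsupport (𝒦.χ i)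
  pos : ∀ i z (ξ : Alt2 E), PosForm ξ → 0 ≤ (∑ p, (g i p z : ℂ) * pcoef p ξ).re

theorem PosForm.pcoef_im {ξ : Alt2 E} (h : PosForm ξ) (p : PIdx E) : (pcoef p ξ).im = 0 := by
  obtain ⟨⟨j, k⟩, q⟩ := p
  rw [pcoef, pr11_of_inv h.1, Complex.mul_im, h.im_eq_zero]
  have : (![-1 / 2, 1 / 2, 1 / 2] q : ℂ).im = 0 := by
    fin_cases q <;> norm_num
  rw [this]
  simp

namespace Density

variable {𝒦 : Cover E X} (τ : Density 𝒦)

/-- The functional at a point. -/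
def val (o : ℕ × E) (ξ : Alt2 E) : ℂ := ∑ p, (τ.g o.1 p o.2 : ℂ) * pcoef p ξ

theorem val_add (o : ℕ × E) (ξ η : Alt2 E) : τ.val o (ξ + η) = τ.val o ξ + τ.val o η := by
  simp only [val, pcoef_add, mul_add, Finset.sum_add_distrib]

theorem val_smul (o : ℕ × E) (a : ℂ) (ξ : Alt2 E) : τ.val o (a • ξ) = a * τ.val o ξ := by
  simp only [val, pcoef_smul, Finset.mul_sum]
  exact Finset.sum_congr rfl fun _ _ => by ring

theorem val_real_smul (o : ℕ × E) (a : ℝ) (ξ : Alt2 E) : τ.val o (a • ξ) = a * τ.val o ξ := by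
  rw [← val_smul]; rfl

theorem val_zero (o : ℕ × E) : τ.val o 0 = 0 := by
  simp [val, pcoef, pr11_zero]

theorem val_sub (o : ℕ × E) (ξ η : Alt2 E) : τ.val o (ξ - η) = τ.val o ξ - τ.val o η := by
  have h : ξ - η = ξ + (-1 : ℂ) • η := by module
  rw [h, val_add, val_smul]; ring

theorem val_eq_zero {o : ℕ × E}
    (h : ¬ (o.2 ∈ 𝒦.B o.1 ∧ (𝒦.e o.1).symm o.2 ∈ tsupport (𝒦.χ o.1))) (ξ : Alt2 E) :
    τ.val o ξ = 0 := by
  refine Finset.sum_eq_zero fun p _ => ?_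
  have : τ.g o.1 p o.2 = 0 := by
    by_contra h'
    exact h (τ.supp _ _ _ h')
  rw [this]; simp

theorem val_nonneg (o : ℕ × E) {ξ : Alt2 E} (hξ : PosForm ξ) : 0 ≤ (τ.val o ξ).re :=
  τ.pos o.1 o.2 ξ hξ

theorem val_im (o : ℕ × E) {ξ : Alt2 E} (hξ : PosForm ξ) : (τ.val o ξ).im = 0 := by
  rw [val, Complex.im_sum]
  refine Finset.sum_eq_zero fun p _ => ?_
  rw [Complex.im_ofReal_mul, hξ.pcoef_im, mul_zero]

theorem val_of_pr11 (o : ℕ × E) {ξ : Alt2 E} (hξ : pr11 ξ = 0) : τ.val o ξ = 0 := by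
  refine Finset.sum_eq_zero fun p _ => ?_
  rw [pcoef, hξ]; simp

theorem val_bound (i : ℕ) : ∃ C : ℝ, 0 ≤ C ∧ ∀ z ξ, ‖τ.val (i, z) ξ‖ ≤ C * nrm ξ := by
  obtain ⟨C, hC⟩ := τ.bdd i
  refine ⟨∑ _p : PIdx E, |C|, by positivity, fun z ξ => ?_⟩
  rw [val, Finset.sum_mul]
  refine (norm_sum_le _ _).trans (Finset.sum_le_sum fun p _ => ?_)
  rw [norm_mul, Complex.norm_real]
  gcongr
  · exact (hC p z).trans (le_abs_self C)
  · exact norm_pcoef_le p ξ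

/-- The evaluation of a field of forms. -/
def evalField (F : ℕ → E → Alt2 E) (o : ℕ × E) : ℂ := τ.val o (F o.1 o.2)

theorem measurable_evalField [BorelSpace E] {F : ℕ → E → Alt2 E}
    (hF : ∀ i v w, Measurable ((𝒦.B i).indicator fun z => F i z ![v, w])) :
    Measurable (τ.evalField F) := by
  refine measurable_from_prod_countable_right fun i => ?_
  have h : (fun z => τ.evalField F (i, z)) = fun z => ∑ p : PIdx E, (τ.g i p z : ℂ) *
      ((![-1 / 2, 1 / 2, 1 / 2] p.2 : ℂ) * ((1 / 2 : ℂ) *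
        ((𝒦.B i).indicator (fun z => F i z ![bas E p.1.1, bas E p.1.2]) z +
        (𝒦.B i).indicator (fun z => F i z ![Complex.I • bas E p.1.1, Complex.I • bas E p.1.2]) z)))
      := by
    funext z
    rw [evalField, val]
    refine Finset.sum_congr rfl fun p _ => ?_
    by_cases hz : z ∈ 𝒦.B i
    · simp only [indicator_of_mem hz, pcoef, pr11_apply]
    · have : τ.g i p z = 0 := by
        by_contra h'
        exact hz (τ.supp _ _ _ h').1
      simp [this]
  rw [h]
  refine Finset.measurable_sum _ fun p _ => ?_
  exact (Complex.measurable_ofReal.comp (τ.meas i p)).mul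
    ((((hF i _ _).add (hF i _ _)).const_mul _).const_mul _)

/-- Fields of forms which are bounded in each chart and vanish in all but finitely many. -/
theorem exists_bound_evalField {F : ℕ → E → Alt2 E} {I : Set ℕ} (hI : I.Finite)
    (h0 : ∀ i ∉ I, ∀ z ∈ 𝒦.B i, (𝒦.e i).symm z ∈ tsupport (𝒦.χ i) → F i z = 0)
    {C : ℕ → ℝ} (hC : ∀ i z ξ, ‖τ.val (i, z) ξ‖ ≤ C i * nrm ξ) (hC0 : ∀ i, 0 ≤ C i)
    {M : ℝ} (hM : ∀ i ∈ I, ∀ z ∈ 𝒦.B i, (𝒦.e i).symm z ∈ tsupport (𝒦.χ i) → nrm (F i z) ≤ M)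
    (hM0 : 0 ≤ M) (o : ℕ × E) :
    ‖τ.evalField F o‖ ≤ (∑ i ∈ hI.toFinset, C i) * M := by
  have hp : 0 ≤ (∑ i ∈ hI.toFinset, C i) * M :=
    mul_nonneg (Finset.sum_nonneg fun i _ => hC0 i) hM0
  by_cases h : o.2 ∈ 𝒦.B o.1 ∧ (𝒦.e o.1).symm o.2 ∈ tsupport (𝒦.χ o.1)
  · by_cases hi : o.1 ∈ I
    · refine (hC o.1 o.2 _).trans ?_
      have h2 : C o.1 ≤ ∑ i ∈ hI.toFinset, C i :=
        Finset.single_le_sum (fun i _ => hC0 i) (hI.mem_toFinset.2 hi)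
      exact mul_le_mul h2 (hM _ hi _ h.1 h.2) (nrm_nonneg _) (Finset.sum_nonneg fun i _ => hC0 i)
    · rw [evalField, h0 _ hi _ h.1 h.2, val_zero, norm_zero]; exact hp
  · rw [evalField, τ.val_eq_zero h, norm_zero]; exact hp

/-- The field of forms given by a form on `X`. -/
def field (𝒦 : Cover E X) (α : TwoForm E X) (i : ℕ) (z : E) : Alt2 E := α.inChart (𝒦.e i) z

theorem continuousOn_field {α : TwoForm E X} (hα : α ∈ testForms E X) (i : ℕ) :
    ContinuousOn (field 𝒦 α i) (𝒦.e i).target :=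
  (hα.1 _ (chart_mem_atlas E _)).continuousOn

theorem field_eq_zero {α : TwoForm E X} {i : ℕ} {z : E} (h : α ((𝒦.e i).symm z) = 0) :
    field 𝒦 α i z = 0 := by
  refine Alt2.ext' fun v w => ?_
  rw [field, inChart_apply, h]; rfl

theorem measurable_evalField_form [BorelSpace E] {α : TwoForm E X} (hα : α ∈ testForms E X) :
    Measurable (τ.evalField (field 𝒦 α)) := by
  refine τ.measurable_evalField fun i v w => ?_
  have h : ContinuousOn (fun z => field 𝒦 α i z ![v, w]) (𝒦.B i) := by
    have h1 := (continuousOn_field hα i).mono (𝒦.B_subset_target i)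
    have h2 : Continuous fun ξ : Alt2 E => ξ ![v, w] := by fun_prop
    exact h2.comp_continuousOn h1
  classical
  rw [← piecewise_eq_indicator]
  exact h.measurable_piecewise continuousOn_const isOpen_ball.measurableSet

/-- A compact support meets only finitely many patches, and on each of them the density and the
coefficients of `α` are bounded. The measures being finite, boundedness is all that integrability
requires. -/
theorem exists_bound_form {α : TwoForm E X} (hα : α ∈ testForms E X) :
    ∃ M, ∀ o, ‖τ.evalField (field 𝒦 α) o‖ ≤ M := by
  have hI := 𝒦.finite_meeting hα.2.isCompact
  choose C hC0 hC using τ.val_bound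
  obtain ⟨C', hC'0, hC'⟩ := nrm_le (E := E)
  have hb : ∀ i, ∃ M, ∀ z ∈ 𝒦.B i, ‖field 𝒦 α i z‖ ≤ M := fun i => by
    have hcl : closedBall (𝒦.c i) (𝒦.r i) ⊆ (𝒦.e i).target :=
      𝒦.closedBall_subset_target i (by linarith [𝒦.r_pos i])
    have := FiniteDimensional.proper ℝ E
    obtain ⟨M, hM⟩ := (isCompact_closedBall (𝒦.c i) (𝒦.r i)).exists_bound_of_continuousOn
      ((continuousOn_field hα i).mono hcl)
    exact ⟨M, fun z hz => hM z (ball_subset_closedBall hz)⟩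
  choose M hM using hb
  refine ⟨_, τ.exists_bound_evalField hI (fun i hi z hz hz2 => field_eq_zero ?_) hC hC0
    (M := ∑ i ∈ hI.toFinset, |C' * M i|) (fun i hi z hz _ => ?_)
    (Finset.sum_nonneg fun _ _ => abs_nonneg _)⟩
  · by_contra h
    exact hi ⟨_, hz2, subset_tsupport α h⟩
  · refine (hC' _).trans ?_
    refine (mul_le_mul_of_nonneg_left (hM i z hz) hC'0).trans ((le_abs_self _).trans ?_)
    exact Finset.single_le_sum (f := fun i => |C' * M i|) (fun i _ => abs_nonneg _)
      (hI.mem_toFinset.2 hi)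

theorem integrable_form [BorelSpace E] {α : TwoForm E X} (hα : α ∈ testForms E X)
    (σ : Measure (ℕ × E)) [IsFiniteMeasure σ] : Integrable (τ.evalField (field 𝒦 α)) σ := by
  obtain ⟨M, hM⟩ := τ.exists_bound_form hα
  exact Integrable.of_bound (τ.measurable_evalField_form hα).aestronglyMeasurable M
    (Eventually.of_forall hM)

/-- Uniform convergence of forms. -/
theorem tendsto_integral {σ : Measure (ℕ × E)} [IsFiniteMeasure σ] [BorelSpace E]
    {κ : Type*} {l : Filter κ} {α : κ → TwoForm E X} {β : TwoForm E X}
    (hα : ∀ j, α j ∈ testForms E X) (hβ : β ∈ testForms E X) {K : Set X} (hK : IsCompact K)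
    (hαK : ∀ j, tsupport (α j) ⊆ K) (hβK : tsupport β ⊆ K)
    (h : ∀ i, TendstoUniformlyOn (fun j => (α j).inChart (𝒦.e i)) (β.inChart (𝒦.e i)) l
      (closedBall (𝒦.c i) (𝒦.r i))) :
    Tendsto (fun j => ∫ o, τ.evalField (field 𝒦 (α j)) o ∂σ) l
      (𝓝 (∫ o, τ.evalField (field 𝒦 β) o ∂σ)) := by
  have hI := 𝒦.finite_meeting hK
  choose C hC0 hC using τ.val_bound
  obtain ⟨C', hC'0, hC'⟩ := nrm_le (E := E)
  set S := ∑ i ∈ hI.toFinset, C i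
  have hS : 0 ≤ S := Finset.sum_nonneg fun i _ => hC0 i
  rw [Metric.tendsto_nhds]
  intro ε hε
  set R := σ.real univ
  have hR : 0 ≤ R := measureReal_nonneg
  -- `δ` compensates the mass of `σ` and the bounds of the density on the finitely many patches
  -- which meet `K`; the `+ 1` avoids a division by zero.
  obtain ⟨δ, hδ, hδε⟩ : ∃ δ > 0, S * (C' * δ) * R < ε := by
    refine ⟨ε / (2 * (S * C' * R + 1)), by positivity, ?_⟩
    have h1 : 0 < S * C' * R + 1 := by positivity
    have : S * (C' * (ε / (2 * (S * C' * R + 1)))) * R = ε / 2 * (S * C' * R / (S * C' * R + 1)) := by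
      field_simp
    rw [this]
    have h2 : S * C' * R / (S * C' * R + 1) ≤ 1 := by
      rw [div_le_one h1]; linarith
    nlinarith
  have hev : ∀ᶠ j in l, ∀ i ∈ hI.toFinset, ∀ z ∈ closedBall (𝒦.c i) (𝒦.r i),
      dist ((β.inChart (𝒦.e i)) z) ((α j).inChart (𝒦.e i) z) < δ :=
    (Finset.eventually_all _).2 fun i _ => Metric.tendstoUniformlyOn_iff.1 (h i) δ hδ
  filter_upwards [hev] with j hj
  rw [dist_comm, dist_eq_norm, ← integral_sub (τ.integrable_form hβ σ) (τ.integrable_form (hα j) σ)]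
  have hb : ∀ o, ‖τ.evalField (field 𝒦 β) o - τ.evalField (field 𝒦 (α j)) o‖ ≤ S * (C' * δ) := by
    intro o
    rw [evalField, evalField, ← val_sub]
    refine τ.exists_bound_evalField (F := fun i z => field 𝒦 β i z - field 𝒦 (α j) i z) hI
      (fun i hi z hz hz2 => ?_) hC hC0 (fun i hi z hz _ => ?_) (by positivity) o
    · have h1 : (𝒦.e i).symm z ∉ K := fun h => hi ⟨_, hz2, h⟩
      rw [field_eq_zero (image_eq_zero_of_notMem_tsupport fun h => h1 (hβK h)),
        field_eq_zero (image_eq_zero_of_notMem_tsupport fun h => h1 (hαK j h)), sub_zero]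
    · refine (hC' _).trans (mul_le_mul_of_nonneg_left ?_ hC'0)
      rw [← dist_eq_norm]
      exact (hj i (hI.mem_toFinset.2 hi) z (ball_subset_closedBall hz)).le
  refine (norm_integral_le_of_norm_le_const (Eventually.of_forall hb)).trans_lt ?_
  exact hδε

theorem evalField_form_add (α β : TwoForm E X) (o : ℕ × E) :
    τ.evalField (field 𝒦 (α + β)) o = τ.evalField (field 𝒦 α) o + τ.evalField (field 𝒦 β) o := by
  have h : field 𝒦 (α + β) o.1 o.2 = field 𝒦 α o.1 o.2 + field 𝒦 β o.1 o.2 :=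
    congrFun (TwoForm.inChart_add α β (𝒦.e o.1)) o.2
  rw [evalField, h, val_add, evalField, evalField]

theorem evalField_form_smul (a : ℂ) (α : TwoForm E X) (o : ℕ × E) :
    τ.evalField (field 𝒦 (a • α)) o = a * τ.evalField (field 𝒦 α) o := by
  have h : field 𝒦 (a • α) o.1 o.2 = a • field 𝒦 α o.1 o.2 :=
    congrFun (TwoForm.inChart_smul a α (𝒦.e o.1)) o.2
  rw [evalField, h, val_smul, evalField]

theorem field_zero (i : ℕ) (z : E) : field 𝒦 0 i z = 0 := field_eq_zero rfl

theorem evalField_form_zero (o : ℕ × E) : τ.evalField (field 𝒦 0) o = 0 := by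
  rw [evalField, field_zero, val_zero]

/-- The integral of test forms against a density. -/
def integralForm [BorelSpace E] (σ : Measure (ℕ × E)) [IsFiniteMeasure σ] :
    testForms E X →ₗ[ℂ] ℂ where
  toFun α := ∫ o, τ.evalField (field 𝒦 α.1) o ∂σ
  map_add' α β := by
    rw [← integral_add (τ.integrable_form α.2 σ) (τ.integrable_form β.2 σ)]
    exact integral_congr_ae (Eventually.of_forall fun o => τ.evalField_form_add α.1 β.1 o)
  map_smul' a α := by
    rw [RingHom.id_apply, smul_eq_mul, ← integral_const_mul]
    exact integral_congr_ae (Eventually.of_forall fun o => τ.evalField_form_smul a α.1 o)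

/-- Only the uniform convergence of the forms themselves enters, that is `k = 0`: these currents
have order zero. -/
theorem integralForm_continuous [BorelSpace E] (σ : Measure (ℕ × E)) [IsFiniteMeasure σ]
    (K : Set X) (α : ℕ → testForms E X) (hK : IsCompact K)
    (hαK : ∀ j, tsupport (α j : TwoForm E X) ⊆ K)
    (h : ∀ e ∈ atlas E X, ∀ L ⊆ e.target, IsCompact L → ∀ k : ℕ,
      TendstoUniformlyOn (fun j => iteratedFDeriv ℝ k (TwoForm.inChart (α j) e)) 0 atTop L) :
    Tendsto (fun j => τ.integralForm σ (α j)) atTop (𝓝 0) := by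
  have := FiniteDimensional.proper ℝ E
  have hu : ∀ i, TendstoUniformlyOn (fun j => (α j).1.inChart (𝒦.e i))
      ((0 : TwoForm E X).inChart (𝒦.e i)) atTop (closedBall (𝒦.c i) (𝒦.r i)) := by
    intro i
    have h1 := h _ (chart_mem_atlas E (𝒦.p i)) _
      (𝒦.closedBall_subset_target i (by linarith [𝒦.r_pos i]))
      (isCompact_closedBall (𝒦.c i) (𝒦.r i)) 0
    rw [Metric.tendstoUniformlyOn_iff] at h1 ⊢
    intro ε hε
    filter_upwards [h1 ε hε] with j hj z hz
    have h2 := hj z hz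
    rw [Pi.zero_apply, dist_zero_left, norm_iteratedFDeriv_zero] at h2
    have h3 : TwoForm.inChart (0 : TwoForm E X) (𝒦.e i) z = 0 := field_zero i z
    rw [h3, dist_zero_left]
    exact h2
  have h0 := τ.tendsto_integral (σ := σ) (fun j => (α j).2) (testForms E X).zero_mem hK hαK
    (by simp [tsupport]) hu
  have h4 : ∫ o, τ.evalField (field 𝒦 0) o ∂σ = 0 := by simp [τ.evalField_form_zero]
  rw [h4] at h0
  exact h0

/-- The current defined by a density and a measure. -/
def current [BorelSpace E] (σ : Measure (ℕ × E)) [IsFiniteMeasure σ] : Current E X :=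
  ⟨τ.integralForm σ, τ.integralForm_continuous σ⟩

theorem current_apply [BorelSpace E] (σ : Measure (ℕ × E)) [IsFiniteMeasure σ]
    (α : testForms E X) : τ.current σ α = ∫ o, τ.evalField (field 𝒦 α.1) o ∂σ := rfl

theorem current_ev [BorelSpace E] (σ : Measure (ℕ × E)) [IsFiniteMeasure σ]
    {α : TwoForm E X} (hα : α ∈ testForms E X) :
    (τ.current σ).ev α = ∫ o, τ.evalField (field 𝒦 α) o ∂σ := by
  rw [Current.ev_eq _ hα, current_apply]

theorem field_posForm [IsManifold 𝓘(ℂ, E) ω X] {α : TwoForm E X} {i : ℕ} {z : E} (hz : z ∈ 𝒦.B i)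
    (h : PosForm (α ((𝒦.e i).symm z))) : PosForm (field 𝒦 α i z) :=
  h.comp (L := symmD (𝒦.e i) z) (symmD_I (chart_mem_atlas E _) (𝒦.B_subset_target i hz))

theorem evalField_form_nonneg [IsManifold 𝓘(ℂ, E) ω X] {α : TwoForm E X}
    (h : ∀ x, PosForm (α x)) (o : ℕ × E) :
    0 ≤ (τ.evalField (field 𝒦 α) o).re ∧ (τ.evalField (field 𝒦 α) o).im = 0 := by
  by_cases hz : o.2 ∈ 𝒦.B o.1
  · exact ⟨τ.val_nonneg o (field_posForm hz (h _)), τ.val_im o (field_posForm hz (h _))⟩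
  · rw [evalField, τ.val_eq_zero fun h => hz h.1]; simp

theorem current_isPositive [IsManifold 𝓘(ℂ, E) ω X] [BorelSpace E] (σ : Measure (ℕ × E))
    [IsFiniteMeasure σ] : (τ.current σ).IsPositive := by
  intro α hα
  have h := τ.evalField_form_nonneg hα
  have h1 : τ.current σ α = ((∫ o, (τ.evalField (field 𝒦 α.1) o).re ∂σ : ℝ) : ℂ) := by
    rw [current_apply, ← integral_complex_ofReal]
    refine integral_congr_ae (Eventually.of_forall fun o => ?_)
    exact Complex.ext rfl (by simpa using (h o).2)
  rw [h1]
  exact ⟨by simpa using integral_nonneg fun o => (h o).1, by simp⟩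

/-- The functionals `val` see only the `(1,1)`-part, and charts preserve types because the
differential of their inverse is complex linear. -/
theorem current_isBidimOneOne [IsManifold 𝓘(ℂ, E) ω X] [BorelSpace E] (σ : Measure (ℕ × E))
    [IsFiniteMeasure σ] : (τ.current σ).IsBidimOneOne := by
  intro α hα
  rw [current_apply]
  refine integral_eq_zero_of_ae (Eventually.of_forall fun o => ?_)
  by_cases hz : o.2 ∈ 𝒦.B o.1
  · have hI := symmD_I (X := X) (chart_mem_atlas E (𝒦.p o.1)) (𝒦.B_subset_target _ hz)
    refine τ.val_of_pr11 o ?_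
    rcases hα with hα | hα
    · refine pr11_of_type Complex.I_mul_I fun v w => ?_
      rw [field, inChart_apply, inChart_apply, hI]
      exact hα _ _ _
    · refine pr11_of_type (ε := -Complex.I) (by simp) fun v w => ?_
      rw [field, inChart_apply, inChart_apply, hI]
      exact hα _ _ _
  · exact τ.val_eq_zero (fun h => hz h.1) _

end Density

end Density

/-! ### Positive functionals on smooth functions are measures -/

section RealAnalysis

variable {V : Type*} [NormedAddCommGroup V] [NormedSpace ℝ V] [FiniteDimensional ℝ V]

/-- A smooth compactly supported function which equals one on a given compact set. -/
theorem exists_contDiff_bump {K : Set V} (hK : IsCompact K) : ∃ b : V → ℝ, ContDiff ℝ ∞ b ∧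
    HasCompactSupport b ∧ (∀ x, 0 ≤ b x ∧ b x ≤ 1) ∧ ∀ x ∈ K, b x = 1 := by
  obtain ⟨R, hR⟩ := hK.isBounded.subset_closedBall (0 : V)
  let b : ContDiffBump (0 : V) := ⟨|R| + 1, |R| + 2, by positivity, by linarith⟩
  refine ⟨b, b.contDiff, b.hasCompactSupport, fun x => ⟨b.nonneg, b.le_one⟩, fun x hx => ?_⟩
  refine b.one_of_mem_closedBall (closedBall_subset_closedBall ?_ (hR hx))
  exact (le_abs_self R).trans (by simp [b])

variable [MeasurableSpace V] [BorelSpace V]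

/-- Positive functionals on smooth compactly supported functions are measures. -/
theorem exists_measure_of_nonneg (L : (V → ℝ) → ℝ)
    (hadd : ∀ φ ψ, ContDiff ℝ ∞ φ → HasCompactSupport φ → ContDiff ℝ ∞ ψ → HasCompactSupport ψ →
      L (fun x => φ x + ψ x) = L φ + L ψ)
    (hsmul : ∀ (a : ℝ) φ, ContDiff ℝ ∞ φ → HasCompactSupport φ → L (fun x => a * φ x) = a * L φ)
    (hpos : ∀ φ, ContDiff ℝ ∞ φ → HasCompactSupport φ → (∀ x, 0 ≤ φ x) → 0 ≤ L φ) :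
    ∃ n : Measure V, IsFiniteMeasureOnCompacts n ∧
      ∀ φ, ContDiff ℝ ∞ φ → HasCompactSupport φ → L φ = ∫ x, φ x ∂n := by
  have := FiniteDimensional.proper ℝ V
  let S : Submodule ℝ (CompactlySupportedContinuousMap V ℝ) :=
    { carrier := {f | ContDiff ℝ ∞ f}
      add_mem' := fun {f g} (hf : ContDiff ℝ ∞ f) (hg : ContDiff ℝ ∞ g) => hf.add hg
      zero_mem' := (contDiff_const (c := (0 : ℝ)) : ContDiff ℝ ∞ fun _ : V => (0 : ℝ))
      smul_mem' := fun a f (hf : ContDiff ℝ ∞ f) => hf.const_smul a }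
  let P : PointedCone ℝ (CompactlySupportedContinuousMap V ℝ) :=
    { carrier := {f | ∀ x, 0 ≤ f x}
      add_mem' := fun {f g} hf hg x => add_nonneg (hf x) (hg x)
      zero_mem' := fun x => le_rfl
      smul_mem' := fun a f hf x => mul_nonneg a.2 (hf x) }
  let f : CompactlySupportedContinuousMap V ℝ →ₗ.[ℝ] ℝ :=
    { domain := S
      toFun :=
        { toFun := fun φ => L φ.1
          map_add' := fun φ ψ => hadd φ.1 ψ.1 φ.2 φ.1.2 ψ.2 ψ.1.2
          map_smul' := fun a φ => hsmul a φ.1 φ.2 φ.1.2 } }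
  -- The M. Riesz extension theorem applies because every compactly supported continuous `y`
  -- satisfies `y + |M| b ≥ 0`, with `b` smooth and equal to one on the support of `y` and `M` a
  -- bound of `y`. The extended positive functional is then a measure by Riesz–Markov–Kakutani.
  obtain ⟨g, hg1, hg2⟩ := riesz_extension P f
    (fun φ hφ => hpos φ.1 φ.2 φ.1.2 hφ) (fun y => by
      obtain ⟨b, hb1, hb2, hb3, hb4⟩ := exists_contDiff_bump y.2.isCompact
      obtain ⟨M, hM⟩ := y.2.exists_bound_of_continuous y.1.2
      have hb1' : ContDiff ℝ ∞ (fun x => |M| * b x) := contDiff_const.mul hb1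
      refine ⟨⟨⟨⟨fun x => |M| * b x, hb1'.continuous⟩, hb2.mul_left⟩, hb1'⟩, fun x => ?_⟩
      change 0 ≤ |M| * b x + y x
      by_cases hx : x ∈ tsupport y
      · rw [hb4 x hx, mul_one]
        have h1 : ‖y x‖ ≤ M := hM x
        rw [Real.norm_eq_abs] at h1
        linarith [neg_abs_le (y x), le_abs_self M]
      · rw [image_eq_zero_of_notMem_tsupport hx, add_zero]
        exact mul_nonneg (abs_nonneg _) (hb3 x).1)
  refine ⟨RealRMK.rieszMeasure (PositiveLinearMap.mk₀ g hg2), inferInstance, fun φ h1 h2 => ?_⟩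
  have h3 := RealRMK.integral_rieszMeasure (PositiveLinearMap.mk₀ g hg2) ⟨⟨φ, h1.continuous⟩, h2⟩
  have h4 := hg1 ⟨⟨⟨φ, h1.continuous⟩, h2⟩, h1⟩
  exact (h3.trans h4).symm

/-- A function whose integrals against nonnegative smooth functions are nonnegative. -/
theorem ae_nonneg_of_integral_contDiff {n : Measure V} [IsFiniteMeasureOnCompacts n] {g : V → ℝ}
    (hg : Measurable g) (hgb : ∃ C, ∀ x, |g x| ≤ C)
    (h : ∀ φ : V → ℝ, ContDiff ℝ ∞ φ → HasCompactSupport φ → (∀ x, 0 ≤ φ x) →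
      0 ≤ ∫ x, φ x * g x ∂n) : ∀ᵐ x ∂n, 0 ≤ g x := by
  have := FiniteDimensional.proper ℝ V
  by_contra hcon
  have hN : MeasurableSet {x | g x < 0} := measurableSet_lt hg measurable_const
  have hpos : 0 < n {x | g x < 0} := by
    rw [pos_iff_ne_zero]
    intro h0
    refine hcon ?_
    rw [ae_iff]
    simpa using h0
  obtain ⟨K, hKN, hK, hK0⟩ := hN.exists_lt_isCompact hpos
  obtain ⟨C, hC⟩ := hgb
  obtain ⟨b, hb1, hb2, hb3, hb4⟩ := exists_contDiff_bump hK
  -- `f` takes values in `[0, 1]` and vanishes exactly on `K`, so the smooth functions `b (1 - f)^j`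
  -- tend to the indicator of `K`. The hypothesis then contradicts `g < 0` on `K`, which has
  -- positive measure.
  obtain ⟨f, hf1, hf2, hf3⟩ := hK.isClosed.isOpen_compl.exists_contDiff_support_eq (n := ⊤)
  have hf3' : ∀ x, 0 ≤ f x ∧ f x ≤ 1 := fun x => hf3 ⟨x, rfl⟩
  have hlim : Tendsto (fun j : ℕ => ∫ x, (b x * (1 - f x) ^ j) * g x ∂n) atTop
      (𝓝 (∫ x, K.indicator g x ∂n)) := by
    refine tendsto_integral_of_dominated_convergence (fun x => b x * C) (fun j => ?_) ?_ ?_ ?_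
    · exact ((hb1.continuous.mul ((continuous_const.sub hf2.continuous).pow j)).measurable.mul
        hg).aestronglyMeasurable
    · exact (hb1.continuous.integrable_of_hasCompactSupport hb2).mul_const C
    · refine fun j => Eventually.of_forall fun x => ?_
      rw [norm_mul, norm_mul, Real.norm_of_nonneg (hb3 x).1, norm_pow, Real.norm_eq_abs,
        Real.norm_eq_abs]
      have h1 : |1 - f x| ≤ 1 := abs_le.2 ⟨by linarith [(hf3' x).2], by linarith [(hf3' x).1]⟩
      have h2 : |1 - f x| ^ j ≤ 1 := pow_le_one₀ (abs_nonneg _) h1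
      calc b x * |1 - f x| ^ j * |g x| ≤ b x * 1 * C := by
            gcongr
            · exact mul_nonneg (hb3 x).1 (by norm_num)
            · exact (hb3 x).1
            · exact hC x
        _ = b x * C := by ring
    · refine Eventually.of_forall fun x => ?_
      by_cases hx : x ∈ K
      · have hfx : f x = 0 := by
          by_contra h'
          have : x ∈ Function.support f := h'
          rw [hf1] at this
          exact this hx
        simp only [hfx, sub_zero, one_pow, hb4 x hx, mul_one, one_mul, indicator_of_mem hx]
        exact tendsto_const_nhds
      · have hfx : 0 < f x := by
          have : x ∈ Function.support f := by rw [hf1]; exact hx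
          exact lt_of_le_of_ne (hf3' x).1 (Ne.symm this)
        rw [indicator_of_notMem hx]
        have h1 : Tendsto (fun j : ℕ => (1 - f x) ^ j) atTop (𝓝 0) :=
          tendsto_pow_atTop_nhds_zero_of_lt_one (by linarith [(hf3' x).2]) (by linarith)
        simpa using (h1.const_mul (b x)).mul_const (g x)
  have h0 : 0 ≤ ∫ x, K.indicator g x ∂n := by
    refine ge_of_tendsto' hlim fun j => ?_
    refine h _ (hb1.mul ((contDiff_const.sub hf2).pow j)) hb2.mul_right fun x => ?_
    exact mul_nonneg (hb3 x).1 (pow_nonneg (by linarith [(hf3' x).2]) _)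
  rw [integral_indicator hK.measurableSet] at h0
  have hint : IntegrableOn (fun x => -g x) K n := by
    have : IsFiniteMeasure (n.restrict K) := ⟨by simpa using hK.measure_lt_top⟩
    exact Integrable.of_bound hg.neg.aestronglyMeasurable C
      (Eventually.of_forall fun x => by simpa using hC x)
  have h1 : 0 < ∫ x in K, -g x ∂n := by
    rw [setIntegral_pos_iff_support_of_nonneg_ae _ hint]
    · have : Function.support (fun x => -g x) ∩ K = K := by
        refine inter_eq_right.2 fun x hx => ?_
        have : g x < 0 := hKN hx
        simp [this.ne]
      rwa [this]
    · rw [EventuallyLE, ae_restrict_iff' hK.measurableSet]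
      refine Eventually.of_forall fun x hx => ?_
      have : g x < 0 := hKN hx
      simp [this.le]
  rw [integral_neg] at h1
  linarith

end RealAnalysis

/-! ### Test forms built in a chart -/

section ChartForms

variable {E : Type*} [NormedAddCommGroup E] [NormedSpace ℂ E]
variable {X : Type*} [TopologicalSpace X] [ChartedSpace E X]

/-- The differential of the inverse chart is complex linear and onto, so positivity can be tested on
vectors in its image. -/
theorem posForm_of_inChart [IsManifold 𝓘(ℂ, E) ω X] {e : OpenPartialHomeomorph X E}
    (he : e ∈ atlas E X) {x : X} (hx : x ∈ e.source) {α : TwoForm E X}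
    (h : PosForm (α.inChart e (e x))) : PosForm (α x) := by
  have hz := e.map_source hx
  have key : ∀ v w, α x ![symmD e (e x) v, symmD e (e x) w] = α.inChart e (e x) ![v, w] := by
    intro v w
    rw [inChart_apply, e.left_inv hx]
  refine ⟨fun v w => ?_, fun v => ?_⟩
  · obtain ⟨v, rfl⟩ := symmD_surj he hz v
    obtain ⟨w, rfl⟩ := symmD_surj he hz w
    rw [← symmD_I he hz, ← symmD_I he hz, key, key, h.1]
  · obtain ⟨v, rfl⟩ := symmD_surj he hz v
    rw [← symmD_I he hz, key]
    exact h.2 v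

/-- An operation that commutes with complex linear pull-backs reads in each chart as `P` applied to
the coefficients of `α`; smoothness follows from that of `P`. -/
theorem map_mem [IsManifold 𝓘(ℂ, E) ω X] {P : Alt2 E → Alt2 E} (hP : ContDiff ℝ ∞ P)
    (h0 : P 0 = 0)
    (hcomp : ∀ (ξ : Alt2 E) (L : E →L[ℝ] E), (∀ v, L (Complex.I • v) = Complex.I • L v) →
      (P ξ).compContinuousLinearMap L = P (ξ.compContinuousLinearMap L))
    {α : TwoForm E X} (hα : α ∈ testForms E X) :
    (fun x => P (α x) : TwoForm E X) ∈ testForms E X := by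
  refine ⟨fun e he => ?_, hα.2.comp_left (g := P) h0⟩
  refine (hP.comp_contDiffOn (hα.1 e he)).congr fun z hz => ?_
  exact hcomp (α (e.symm z)) (symmD e z) (symmD_I he hz)

theorem hess_linear (m : E →L[ℝ] ℝ) (z : E) : hess (fun y => m y) z = 0 := by
  have : fderiv ℝ (fun y => m y) = fun _ => m := by
    funext y; exact m.fderiv
  rw [hess, this]; simp

/-- The form on the domain of a chart which reads `gam m m` in this chart. -/
def constForm (e : OpenPartialHomeomorph X E) (m : E →L[ℝ] ℝ) : TwoForm E X :=
  fun x => (1 / 2 : ℝ) • ddc (fun y => m (e y) * m (e y)) x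

theorem contMDiffOn_quad [IsManifold 𝓘(ℂ, E) ω X] {e : OpenPartialHomeomorph X E}
    (he : e ∈ atlas E X) (m : E →L[ℝ] ℝ) :
    ContMDiffOn 𝓘(ℝ, E) 𝓘(ℝ, ℝ) ∞ (fun y => m (e y) * m (e y)) e.source := by
  have h := contMDiffOn_comp_chart (X := X) he (V := univ) (g := fun y => m y * m y)
    (m.contDiff.mul m.contDiff).contDiffOn
  simpa using h

theorem smoothFormOn_constForm [IsManifold 𝓘(ℂ, E) ω X] {e : OpenPartialHomeomorph X E}
    (he : e ∈ atlas E X) (m : E →L[ℝ] ℝ) : SmoothFormOn (constForm e m) e.source := by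
  have h := (smoothFormOn_ddc e.open_source (contMDiffOn_quad he m)).const_smul
    (((1 / 2 : ℝ) : ℂ))
  exact h.congr fun x _ => (Complex.coe_smul (1 / 2 : ℝ) (ddc (fun y => m (e y) * m (e y)) x :
    Alt2 E)).symm

/-- Since `i∂∂̄` commutes with charts, it suffices to look at `m²` on `E`, whose Hessian is `2 m ⊗
m`. -/
theorem constForm_inChart [IsManifold 𝓘(ℂ, E) ω X] {e : OpenPartialHomeomorph X E}
    (he : e ∈ atlas E X) (m : E →L[ℝ] ℝ) {z : E} (hz : z ∈ e.target) :
    (constForm e m).inChart e z = gam m m := by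
  have h1 := iddbar_inChart e.open_source (contMDiffOn_ofReal (contMDiffOn_quad he m)) he hz
    (e.map_target hz)
  have h2 : ((fun y => ((m (e y) * m (e y) : ℝ) : ℂ)) ∘ e.symm) =ᶠ[𝓝 z]
      fun y => ((m y * m y : ℝ) : ℂ) := by
    filter_upwards [e.open_target.mem_nhds hz] with y hy
    simp [e.right_inv hy]
  rw [iddbarFlat_congr h2] at h1
  refine Alt2.ext' fun v w => ?_
  have h3 : (constForm e m).inChart e z ![v, w] =
      (1 / 2 : ℝ) • TwoForm.inChart (iddbar fun y => ((m (e y) * m (e y) : ℝ) : ℂ)) e z ![v, w] := rfl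
  have h4 : ∀ v w, hess (fun y => m y * m y) z v w = 2 * (m v * m w) := by
    intro v w
    rw [hess_mul m.contDiff.contDiffAt m.contDiff.contDiffAt, hess_linear, m.fderiv]
    simp; ring
  rw [h3, h1, iddbarFlat_ofReal (m.contDiff.mul m.contDiff).contDiffAt, gam_apply, h4, h4,
    Complex.real_smul]
  push_cast
  ring

theorem posForm_constForm [IsManifold 𝓘(ℂ, E) ω X] {e : OpenPartialHomeomorph X E}
    (he : e ∈ atlas E X) (m : E →L[ℝ] ℝ) {x : X} (hx : x ∈ e.source) :
    PosForm (constForm e m x) :=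
  posForm_of_inChart he hx (by
    rw [constForm_inChart he m (e.map_source hx)]; exact posForm_gam m)

/-- `lift` commutes with the algebraic operations. -/
theorem lift_add (e : OpenPartialHomeomorph X E) (g h : E → ℝ) (x : X) :
    lift e (fun z => g z + h z) x = lift e g x + lift e h x := by
  by_cases hx : x ∈ e.source
  · simp only [lift_of_mem hx]
  · simp only [lift_of_notMem hx, add_zero]

theorem lift_const_mul (e : OpenPartialHomeomorph X E) (a : ℝ) (g : E → ℝ) (x : X) :
    lift e (fun z => a * g z) x = a * lift e g x := by
  by_cases hx : x ∈ e.source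
  · simp only [lift_of_mem hx]
  · simp only [lift_of_notMem hx, mul_zero]

theorem posForm_lift_smul {e : OpenPartialHomeomorph X E} {g : E → ℝ} (hg : ∀ z, 0 ≤ g z)
    {α : TwoForm E X} (hα : ∀ x ∈ e.source, PosForm (α x)) (x : X) :
    PosForm (lift e g x • α x) := by
  by_cases hx : x ∈ e.source
  · rw [lift_of_mem hx]; exact (hα x hx).smul (hg _)
  · rw [lift_of_notMem hx]
    convert posForm_zero (E := E) using 1
    exact zero_smul ℝ (α x)

theorem lift_smul_mem [T2Space X] [IsManifold 𝓘(ℂ, E) ω X] {e : OpenPartialHomeomorph X E}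
    (he : e ∈ atlas E X) {g : E → ℝ} (hg : ContDiff ℝ ∞ g) (hc : HasCompactSupport g)
    (hs : tsupport g ⊆ e.target) {α : TwoForm E X} (hα : SmoothFormOn α e.source) :
    (fun x => lift e g x • α x : TwoForm E X) ∈ testForms E X := by
  refine (isRTest_lift he hg hc hs).smul_mem e.open_source ((tsupport_lift hc hs).2.trans ?_) hα
  rintro _ ⟨z, hz, rfl⟩
  exact e.map_target (hs hz)

variable [T2Space X] [IsManifold 𝓘(ℂ, E) ω X]
variable {e : OpenPartialHomeomorph X E} {η : E → ℝ}

/-- The positive functionals `φ ↦ T(ηφ α)` in a chart. -/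
theorem ev_lift_add (T : Current E X) (he : e ∈ atlas E X) (hη : ContDiff ℝ ∞ η)
    (hc : HasCompactSupport η) (hs : tsupport η ⊆ e.target) {α : TwoForm E X}
    (hα : SmoothFormOn α e.source) {φ ψ : E → ℝ} (hφ : ContDiff ℝ ∞ φ) (hψ : ContDiff ℝ ∞ ψ) :
    T.ev (fun x => lift e (fun z => η z * (φ z + ψ z)) x • α x) =
      T.ev (fun x => lift e (fun z => η z * φ z) x • α x) +
      T.ev (fun x => lift e (fun z => η z * ψ z) x • α x) := by
  rw [← T.ev_add (lift_smul_mem he (hη.mul hφ) hc.mul_right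
    ((tsupport_mul_subset_left).trans hs) hα) (lift_smul_mem he (hη.mul hψ) hc.mul_right
    ((tsupport_mul_subset_left).trans hs) hα)]
  congr 1
  funext x
  have : lift e (fun z => η z * (φ z + ψ z)) x = lift e (fun z => η z * φ z) x +
      lift e (fun z => η z * ψ z) x := by
    rw [← lift_add]; simp only [mul_add]
  rw [this]
  module

theorem ev_lift_smul (T : Current E X) (he : e ∈ atlas E X) (hη : ContDiff ℝ ∞ η)
    (hc : HasCompactSupport η) (hs : tsupport η ⊆ e.target) {α : TwoForm E X}
    (hα : SmoothFormOn α e.source) {φ : E → ℝ} (hφ : ContDiff ℝ ∞ φ) (a : ℝ) :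
    T.ev (fun x => lift e (fun z => η z * (a * φ z)) x • α x) =
      a * T.ev (fun x => lift e (fun z => η z * φ z) x • α x) := by
  rw [← T.ev_real_smul (lift_smul_mem he (hη.mul hφ) hc.mul_right
    ((tsupport_mul_subset_left).trans hs) hα)]
  congr 1
  funext x
  have : lift e (fun z => η z * (a * φ z)) x = a * lift e (fun z => η z * φ z) x := by
    rw [← lift_const_mul]; congr 1; funext z; ring
  rw [this, mul_smul]

/-- `T` is real on positive forms, and `4 φ = (φ + 1)² - (φ - 1)²` is a difference of nonnegative
functions. -/
theorem ev_lift_im {T : Current E X} (hT : T.IsPositive) (he : e ∈ atlas E X)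
    (hη : ContDiff ℝ ∞ η) (hc : HasCompactSupport η) (hs : tsupport η ⊆ e.target)
    (hη0 : ∀ z, 0 ≤ η z) {α : TwoForm E X}
    (hα : SmoothFormOn α e.source) (hαp : ∀ x ∈ e.source, PosForm (α x)) {φ : E → ℝ}
    (hφ : ContDiff ℝ ∞ φ) : (T.ev (fun x => lift e (fun z => η z * φ z) x • α x)).im = 0 := by
  have h1 : ∀ a : ℝ, (T.ev (fun x => lift e (fun z => η z * (φ z + a) ^ 2) x • α x)).im = 0 := by
    intro a
    refine hT.ev_im (lift_smul_mem he (hη.mul ((hφ.add contDiff_const).pow 2)) hc.mul_right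
      ((tsupport_mul_subset_left).trans hs) hα) fun x => posForm_lift_smul
        (fun z => mul_nonneg (hη0 z) (sq_nonneg _)) hαp x
  have h2 := ev_lift_add T he hη hc hs hα ((hφ.add contDiff_const).pow 2 (n := ∞))
    (ψ := fun z => (-1 : ℝ) * (φ z + (-1)) ^ 2)
    (contDiff_const.mul ((hφ.add contDiff_const).pow 2)) (φ := fun z => (φ z + 1) ^ 2)
  have h3 := ev_lift_smul T he hη hc hs hα ((hφ.add (contDiff_const (c := (-1 : ℝ)))).pow 2) (-1)
  have h4 := ev_lift_smul T he hη hc hs hα hφ 4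
  have h5 : (fun z => η z * ((φ z + 1) ^ 2 + (-1 : ℝ) * (φ z + (-1)) ^ 2)) =
      fun z => η z * (4 * φ z) := by funext z; ring
  rw [h5, h4, h3] at h2
  have h6 := congrArg Complex.im h2
  rw [Complex.im_ofReal_mul, Complex.add_im, Complex.im_ofReal_mul, h1, h1] at h6
  linarith

end ChartForms

/-! ### Simultaneous densities of finitely many measures -/

section LocalRepresentation

variable {E : Type*} [NormedAddCommGroup E] [NormedSpace ℂ E] [FiniteDimensional ℂ E]
  [MeasurableSpace E] [BorelSpace E]

omit [MeasurableSpace E] [BorelSpace E] in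
theorem continuous_pcoef (p : PIdx E) : Continuous (pcoef p : Alt2 E → ℂ) := by
  have : (pcoef p : Alt2 E → ℂ) = fun ξ => (![-1 / 2, 1 / 2, 1 / 2] p.2 : ℂ) *
      ((1 / 2 : ℂ) * (ξ ![bas E p.1.1, bas E p.1.2] +
        ξ ![Complex.I • bas E p.1.1, Complex.I • bas E p.1.2])) := by
    funext ξ
    rw [pcoef, pr11_apply]
  rw [this]
  fun_prop

omit [MeasurableSpace E] [BorelSpace E] in
-- The positivity of a functional on all positive forms is a closed condition, so it reduces to a
-- countable dense set of them. This lets an almost everywhere statement for each form hold for all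
-- forms at once.
theorem exists_dense_posForm : ∃ D : ℕ → Alt2 E, (∀ k, PosForm (D k)) ∧ ∀ a : PIdx E → ℝ,
    (∀ k, 0 ≤ ∑ p, (pcoef p (D k)).re * a p) → ∀ ξ, PosForm ξ → 0 ≤ ∑ p, (pcoef p ξ).re * a p := by
  have : Nonempty {ξ : Alt2 E // PosForm ξ} := ⟨⟨0, posForm_zero⟩⟩
  refine ⟨fun k => (TopologicalSpace.denseSeq {ξ : Alt2 E // PosForm ξ} k).1, fun k =>
    (TopologicalSpace.denseSeq {ξ : Alt2 E // PosForm ξ} k).2, fun a h ξ hξ => ?_⟩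
  have hc : Continuous fun ξ : {ξ : Alt2 E // PosForm ξ} => ∑ p, (pcoef p ξ.1).re * a p := by
    refine continuous_finsetSum _ fun p _ => ?_
    exact (Complex.continuous_re.comp
      ((continuous_pcoef p).comp continuous_subtype_val)).mul continuous_const
  refine DenseRange.induction_on (p := fun ξ : {ξ : Alt2 E // PosForm ξ} =>
    0 ≤ ∑ p, (pcoef p ξ.1).re * a p)
    (TopologicalSpace.denseRange_denseSeq {ξ : Alt2 E // PosForm ξ}) ⟨ξ, hξ⟩ ?_ h
  exact isClosed_le continuous_const hc

/-- A family of positive functionals with nonnegative combinations given by the coefficients of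
positive forms is represented by a measure and a family of densities. -/
theorem exists_density (L : PIdx E → (E → ℝ) → ℝ)
    (hadd : ∀ p φ ψ, ContDiff ℝ ∞ φ → HasCompactSupport φ → ContDiff ℝ ∞ ψ → HasCompactSupport ψ →
      L p (fun x => φ x + ψ x) = L p φ + L p ψ)
    (hsmul : ∀ p (a : ℝ) φ, ContDiff ℝ ∞ φ → HasCompactSupport φ →
      L p (fun x => a * φ x) = a * L p φ)
    (hpos : ∀ p φ, ContDiff ℝ ∞ φ → HasCompactSupport φ → (∀ x, 0 ≤ φ x) → 0 ≤ L p φ)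
    (hpos' : ∀ ξ : Alt2 E, PosForm ξ → ∀ φ, ContDiff ℝ ∞ φ → HasCompactSupport φ →
      (∀ x, 0 ≤ φ x) → 0 ≤ ∑ p, (pcoef p ξ).re * L p φ) :
    ∃ (σ : Measure E) (f : PIdx E → E → ℝ), IsFiniteMeasureOnCompacts σ ∧
      (∀ p, Measurable (f p)) ∧ (∀ p x, 0 ≤ f p x ∧ f p x ≤ 1) ∧
      (∀ x (ξ : Alt2 E), PosForm ξ → 0 ≤ ∑ p, (pcoef p ξ).re * f p x) ∧
      ∀ p φ, ContDiff ℝ ∞ φ → HasCompactSupport φ → L p φ = ∫ x, φ x * f p x ∂σ := by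
  have := FiniteDimensional.proper ℝ E
  have h1 := fun p => exists_measure_of_nonneg (L p) (hadd p) (hsmul p) (hpos p)
  choose n hn hnL using h1
  set σ : Measure E := Measure.sum n with hσ
  have hσf : IsFiniteMeasureOnCompacts σ := ⟨fun K hK => by
    rw [hσ, Measure.sum_apply _ hK.measurableSet, tsum_fintype]
    exact ENNReal.sum_lt_top.2 fun p _ => hK.measure_lt_top⟩
  have hle : ∀ p, n p ≤ σ := fun p => Measure.le_sum n p
  -- Every `n p` is at most the common sum `σ`, so its derivative is at most one almost everywhere;
  -- the minimum makes the bound hold everywhere.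
  set f₀ : PIdx E → E → ℝ := fun p x => min (((n p).rnDeriv σ x).toReal) 1 with hf₀
  have hf₀m : ∀ p, Measurable (f₀ p) := fun p =>
    ((Measure.measurable_rnDeriv _ _).ennreal_toReal).min measurable_const
  have hf₀b : ∀ p x, 0 ≤ f₀ p x ∧ f₀ p x ≤ 1 := fun p x =>
    ⟨le_min ENNReal.toReal_nonneg zero_le_one, min_le_right _ _⟩
  have hf₀i : ∀ p (φ : E → ℝ), ∫ x, φ x * f₀ p x ∂σ = ∫ x, φ x ∂(n p) := by
    intro p φ
    rw [← integral_rnDeriv_smul (hle p).absolutelyContinuous]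
    refine integral_congr_ae ?_
    filter_upwards [Measure.rnDeriv_le_one_of_le (hle p)] with x hx
    have : ((n p).rnDeriv σ x).toReal ≤ 1 := by
      have := ENNReal.toReal_mono ENNReal.one_ne_top hx
      simpa using this
    rw [hf₀, smul_eq_mul]
    simp only [min_eq_left this]
    ring
  have hint : ∀ (p : PIdx E) (φ : E → ℝ), Continuous φ → HasCompactSupport φ →
      Integrable (fun x => φ x * f₀ p x) σ := by
    intro p φ h1 h2
    refine (h1.integrable_of_hasCompactSupport h2).mul_bdd (c := 1)
      (hf₀m p).aestronglyMeasurable ?_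
    refine Eventually.of_forall fun x => ?_
    rw [Real.norm_of_nonneg (hf₀b p x).1]; exact (hf₀b p x).2
  have hae : ∀ ξ : Alt2 E, PosForm ξ → ∀ᵐ x ∂σ, 0 ≤ ∑ p, (pcoef p ξ).re * f₀ p x := by
    intro ξ hξ
    refine ae_nonneg_of_integral_contDiff
      (Finset.measurable_sum _ fun p _ => (hf₀m p).const_mul _)
      ⟨∑ p, |(pcoef p ξ).re|, fun x => ?_⟩ fun φ h1 h2 h3 => ?_
    · refine (Finset.abs_sum_le_sum_abs _ _).trans (Finset.sum_le_sum fun p _ => ?_)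
      rw [abs_mul, abs_of_nonneg (hf₀b p x).1]
      exact mul_le_of_le_one_right (abs_nonneg _) (hf₀b p x).2
    · have h4 := hpos' ξ hξ φ h1 h2 h3
      have h5 : ∫ x, φ x * ∑ p, (pcoef p ξ).re * f₀ p x ∂σ =
          ∑ p, (pcoef p ξ).re * L p φ := by
        have h6 : ∀ x, φ x * ∑ p, (pcoef p ξ).re * f₀ p x =
            ∑ p, (pcoef p ξ).re * (φ x * f₀ p x) := fun x => by
          rw [Finset.mul_sum]; exact Finset.sum_congr rfl fun p _ => by ring
        simp_rw [h6]
        rw [integral_finsetSum _ fun p _ => (hint p φ h1.continuous h2).const_mul _]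
        refine Finset.sum_congr rfl fun p _ => ?_
        rw [integral_const_mul, hf₀i, hnL p φ h1 h2]
      rw [h5]; exact h4
  obtain ⟨D, hD, hD'⟩ := exists_dense_posForm (E := E)
  have hall : ∀ᵐ x ∂σ, ∀ k : ℕ, 0 ≤ ∑ p, (pcoef p (D k)).re * f₀ p x :=
    ae_all_iff.2 fun k => hae _ (hD k)
  -- `G` has full measure. Setting the densities to zero outside of it makes positivity true at
  -- every point.
  set G : Set E := {x | ∀ k : ℕ, 0 ≤ ∑ p, (pcoef p (D k)).re * f₀ p x} with hG
  have hGm : MeasurableSet G := by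
    rw [hG, ofPred_forall]
    exact MeasurableSet.iInter fun k => measurableSet_le measurable_const
      (Finset.measurable_sum _ fun p _ => (hf₀m p).const_mul _)
  refine ⟨σ, fun p => G.indicator (f₀ p), hσf, fun p => (hf₀m p).indicator hGm, fun p x => ?_,
    fun x ξ hξ => ?_, fun p φ h1 h2 => ?_⟩
  · by_cases hx : x ∈ G
    · simpa only [indicator_of_mem hx] using hf₀b p x
    · simp only [indicator_of_notMem hx]; norm_num
  · by_cases hx : x ∈ G
    · simp only [indicator_of_mem hx]
      exact hD' (fun p => f₀ p x) hx ξ hξ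
    · simp only [indicator_of_notMem hx, mul_zero, Finset.sum_const_zero, le_refl]
  · rw [hnL p φ h1 h2, ← hf₀i]
    refine integral_congr_ae ?_
    filter_upwards [hall] with x hx
    rw [indicator_of_mem (show x ∈ G from hx)]

end LocalRepresentation

/-! ### Local representation of positive currents -/

section LocalRepresentation

variable {E : Type*} [NormedAddCommGroup E] [NormedSpace ℂ E] [FiniteDimensional ℂ E]
variable {X : Type*} [TopologicalSpace X] [ChartedSpace E X]

theorem contDiff_pcoef (p : PIdx E) : ContDiff ℝ ∞ (pcoef p : Alt2 E → ℂ) := by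
  let L : Alt2 E →ₗ[ℝ] ℂ :=
    { toFun := pcoef p
      map_add' := pcoef_add p
      map_smul' := fun a ξ => pcoef_smul p (a : ℂ) ξ }
  exact (LinearMap.toContinuousLinearMap L).contDiff

/-- A function given in a chart, with compact support there. -/
theorem contDiff_indicator_target {F : Type*} [NormedAddCommGroup F] [NormedSpace ℝ F]
    {e : OpenPartialHomeomorph X E} {g : E → F} (hg : ContDiffOn ℝ ∞ g e.target) {K : Set X}
    (hK : IsCompact K) (hKe : K ⊆ e.source) (h0 : ∀ z ∈ e.target, e.symm z ∉ K → g z = 0) :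
    ContDiff ℝ ∞ (e.target.indicator g) ∧ HasCompactSupport (e.target.indicator g) := by
  have hK' : IsCompact (e '' K) := hK.image_of_continuousOn (e.continuousOn.mono hKe)
  have h1 : ∀ z ∉ e '' K, e.target.indicator g z = 0 := by
    intro z hz
    by_cases hzt : z ∈ e.target
    · rw [indicator_of_mem hzt]
      exact h0 z hzt fun h => hz ⟨_, h, e.right_inv hzt⟩
    · exact indicator_of_notMem hzt _
  refine ⟨contDiff_iff_contDiffAt.2 fun z => ?_, HasCompactSupport.intro hK' h1⟩
  by_cases hzt : z ∈ e.target
  · refine (hg.contDiffAt (e.open_target.mem_nhds hzt)).congr_of_eventuallyEq ?_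
    filter_upwards [e.open_target.mem_nhds hzt] with y hy using indicator_of_mem hy _
  · refine (contDiffAt_const (c := (0 : F))).congr_of_eventuallyEq ?_
    have : z ∈ (e '' K)ᶜ := by
      rintro ⟨x, hx, rfl⟩
      exact hzt (e.map_source (hKe hx))
    filter_upwards [hK'.isClosed.isOpen_compl.mem_nhds this] with y hy using h1 y hy

/-- The remaining parts of `β` have types `(2,0)` and `(0,2)`. They are test forms because the
projections commute with complex linear pull-backs, so `T` vanishes on them. -/
theorem ev_pr11 [IsManifold 𝓘(ℂ, E) ω X] {T : Current E X} (hT : T.IsBidimOneOne)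
    {β : TwoForm E X} (hβ : β ∈ testForms E X) : T.ev β = T.ev (fun x => pr11 (β x)) := by
  have h1 := map_mem contDiff_pr11 pr11_zero (fun ξ L hL => pr11_comp ξ hL) hβ
  have h2 : ∀ ε, (fun x => pr20 ε (β x) : TwoForm E X) ∈ testForms E X := fun ε =>
    map_mem (contDiff_pr20 ε) (pr20_zero ε) (fun ξ L hL => pr20_comp ε ξ hL) hβ
  have h3 : T.ev (fun x => pr20 1 (β x)) = 0 := by
    rw [T.ev_eq (h2 1)]
    refine hT _ (Or.inl fun x v w => ?_)
    have := pr20_type 1 (by norm_num) (β x) v w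
    simpa using this
  have h4 : T.ev (fun x => pr20 (-1) (β x)) = 0 := by
    rw [T.ev_eq (h2 (-1))]
    refine hT _ (Or.inr fun x v w => ?_)
    have := pr20_type (-1) (by norm_num) (β x) v w
    simpa using this
  have h5 : β = fun x => pr11 (β x) + (pr20 1 (β x) + pr20 (-1) (β x)) :=
    funext fun x => pr_decomp (β x)
  have h6 := T.ev_add h1 (Current.add_mem (h2 1) (h2 (-1)))
  rw [T.ev_add (h2 1) (h2 (-1)), h3, h4, add_zero, add_zero] at h6
  rw [← h6, ← h5]

variable [MeasurableSpace E] [BorelSpace E]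
variable [T2Space X] [IsManifold 𝓘(ℂ, E) ω X]

/-- Currents which are positive, of bidimension `(1,1)`, are locally given by densities. -/
theorem exists_local_density {T : Current E X} (hT : T.IsPositive) (hT' : T.IsBidimOneOne)
    (𝒦 : Cover E X) (i : ℕ) :
    ∃ (σ : Measure E) (f : PIdx E → E → ℝ), IsFiniteMeasureOnCompacts σ ∧
      (∀ p, Measurable (f p)) ∧ (∀ p x, 0 ≤ f p x ∧ f p x ≤ 1) ∧
      (∀ x (ξ : Alt2 E), PosForm ξ → 0 ≤ ∑ p, (pcoef p ξ).re * f p x) ∧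
      ∀ β ∈ testForms E X, tsupport β ⊆ tsupport (𝒦.χ i) →
        T.ev β = ∫ z in 𝒦.B i, ∑ p, (f p z : ℂ) * pcoef p (β.inChart (𝒦.e i) z) ∂σ := by
  set e := 𝒦.e i with he_def
  have he : e ∈ atlas E X := chart_mem_atlas E _
  have hr := 𝒦.r_pos i
  -- `η` equals one on the ball of radius `2 r`, hence on the support in the chart of any form
  -- supported in `tsupport (χ i)`, and its support stays in the chart.
  let η : ContDiffBump (𝒦.c i) := ⟨2 * 𝒦.r i, 3 * 𝒦.r i, by linarith, by linarith⟩
  have hη : ContDiff ℝ ∞ η := η.contDiff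
  have hηc : HasCompactSupport η := η.hasCompactSupport
  have hηs : tsupport η ⊆ e.target := by
    rw [η.tsupport_eq]; exact 𝒦.closedBall_subset i
  have hη0 : ∀ z, 0 ≤ η z := fun z => η.nonneg
  have hs : ∀ {φ : E → ℝ}, tsupport (fun z => η z * φ z) ⊆ e.target := fun {φ} =>
    (tsupport_mul_subset_left (f := η) (g := φ)).trans hηs
  set A : PIdx E → TwoForm E X := fun p => constForm e (plin p)
  have hA : ∀ p, SmoothFormOn (A p) e.source := fun p => smoothFormOn_constForm he _
  have hAp : ∀ p, ∀ x ∈ e.source, PosForm (A p x) := fun p x hx => posForm_constForm he _ hx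
  set N : PIdx E → (E → ℝ) → TwoForm E X :=
    fun p φ x => lift e (fun z => η z * φ z) x • A p x with hN
  have hNm : ∀ p φ, ContDiff ℝ ∞ φ → N p φ ∈ testForms E X := fun p φ hφ =>
    lift_smul_mem he (hη.mul hφ) hηc.mul_right hs (hA p)
  set L : PIdx E → (E → ℝ) → ℝ := fun p φ => (T.ev (N p φ)).re with hL
  have hLev : ∀ p φ, ContDiff ℝ ∞ φ → T.ev (N p φ) = L p φ := fun p φ hφ =>
    Complex.ext rfl (by rw [Complex.ofReal_im]; exact ev_lift_im hT he hη hηc hηs hη0 (hA p) (hAp p) hφ)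
  obtain ⟨σ, f, h1, h2, h3, h4, h5⟩ := exists_density L
    (fun p φ ψ h1 _ h2 _ => by
      have := ev_lift_add T he hη hηc hηs (hA p) h1 h2
      exact congrArg Complex.re this)
    (fun p a φ h1 _ => by
      have := ev_lift_smul T he hη hηc hηs (hA p) h1 a
      have := congrArg Complex.re this
      rwa [Complex.re_ofReal_mul] at this)
    (fun p φ h1 _ h2 => hT.ev_nonneg (hNm p φ h1)
      fun x => posForm_lift_smul (fun z => mul_nonneg (hη0 z) (h2 z)) (hAp p) x)
    (fun ξ hξ φ h1 _ h2 => by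
      -- The combination of the forms `A p` with the coefficients of `ξ` reads as the constant form
      -- `ξ` in the chart. It is therefore positive, and the factor `η φ` is nonnegative.
      have h3 : ∑ p, (pcoef p ξ).re * L p φ =
          (T.ev (fun x => ∑ p, (pcoef p ξ).re • N p φ x)).re := by
        rw [T.ev_sum Finset.univ (α := fun p x => (pcoef p ξ).re • N p φ x)
          fun p _ => Current.real_smul_mem (hNm p φ h1) _, Complex.re_sum]
        refine Finset.sum_congr rfl fun p _ => ?_
        rw [T.ev_real_smul (hNm p φ h1), Complex.re_ofReal_mul]
      rw [h3]
      refine hT.ev_nonneg (Current.sum_mem _ fun p _ => Current.real_smul_mem (hNm p φ h1) _)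
        fun x => ?_
      by_cases hx : x ∈ e.source
      · have h4 : (∑ p, (pcoef p ξ).re • N p φ x : Alt2 E) =
            (η (e x) * φ (e x)) • ∑ p, (pcoef p ξ).re • A p x := by
          rw [Finset.smul_sum]
          refine Finset.sum_congr rfl fun p _ => ?_
          simp only [hN, lift_of_mem hx]
          exact smul_comm _ _ _
        rw [h4]
        refine PosForm.smul ?_ (mul_nonneg (hη0 _) (h2 _))
        refine posForm_of_inChart (α := fun x => ∑ p, (pcoef p ξ).re • A p x) he hx ?_
        have hz := e.map_source hx
        have h6 : TwoForm.inChart (fun x => ∑ p, (pcoef p ξ).re • A p x) e (e x) = ξ := by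
          refine Alt2.ext' fun v w => ?_
          have hsum : ∑ p : PIdx E, pcoef p ξ • gam (plin p) (plin p) = ξ := by
            rw [← pr11_eq_sum, pr11_of_inv hξ.1]
          refine Eq.trans ?_ (congrArg (fun ζ : Alt2 E => ζ ![v, w]) hsum)
          simp only [inChart_apply, ContinuousAlternatingMap.sum_apply]
          refine Finset.sum_congr rfl fun p _ => ?_
          have h7 : gam (plin p) (plin p) ![v, w] = (A p).inChart e (e x) ![v, w] := by
            rw [constForm_inChart he _ hz]
          have h8 : pcoef p ξ = ((pcoef p ξ).re : ℂ) :=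
            Complex.ext rfl (by rw [hξ.pcoef_im, Complex.ofReal_im])
          rw [ContinuousAlternatingMap.smul_apply, ContinuousAlternatingMap.smul_apply, h7,
            inChart_apply, smul_eq_mul, Complex.real_smul]
          conv_rhs => rw [h8]
        rw [h6]
        exact hξ
      · have h4 : (∑ p, (pcoef p ξ).re • N p φ x : Alt2 E) = 0 := by
          refine Finset.sum_eq_zero fun p _ => ?_
          simp only [hN, lift_of_notMem hx]
          exact Alt2.ext' fun v w => by simp
        rw [h4]; exact posForm_zero)
  refine ⟨σ, f, h1, h2, h3, h4, fun β hβ hβs => ?_⟩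
  have hsrc : tsupport β ⊆ e.source := fun x hx => (𝒦.tsupport_subset i (hβs hx)).1
  set ψ : PIdx E → E → ℂ := fun p => e.target.indicator fun z => pcoef p (β.inChart e z) with hψ
  have hψ0 : ∀ p, ∀ z ∈ e.target, e.symm z ∉ tsupport β → pcoef p (β.inChart e z) = 0 := by
    intro p z _ hz
    have : β.inChart e z = 0 := Density.field_eq_zero (𝒦 := 𝒦) (image_eq_zero_of_notMem_tsupport hz)
    rw [this]
    simp [pcoef, pr11_zero]
  have hψs := fun p => contDiff_indicator_target
    ((contDiff_pcoef p).comp_contDiffOn (hβ.1 e he)) hβ.2 hsrc (hψ0 p)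
  have hre : ∀ p, ContDiff ℝ ∞ (fun z => (ψ p z).re) ∧ HasCompactSupport (fun z => (ψ p z).re) :=
    fun p => ⟨Complex.reCLM.contDiff.comp (hψs p).1, (hψs p).2.comp_left (g := Complex.re) rfl⟩
  have him : ∀ p, ContDiff ℝ ∞ (fun z => (ψ p z).im) ∧ HasCompactSupport (fun z => (ψ p z).im) :=
    fun p => ⟨Complex.imCLM.contDiff.comp (hψs p).1, (hψs p).2.comp_left (g := Complex.im) rfl⟩
  -- The `(1,1)`-part of `β` is the combination of the squares `A p` with coefficient functions `ψ
  -- p`. The cutoff `η` may be inserted since it equals one wherever `ψ p` is nonzero.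
  have key : (fun x => pr11 (β x) : TwoForm E X) = fun x => ∑ p,
      (N p (fun z => (ψ p z).re) x + Complex.I • N p (fun z => (ψ p z).im) x) := by
    funext x
    by_cases hx : x ∈ e.source
    · have hz := e.map_source hx
      refine eq_of_inChart_eq (α := fun x => pr11 (β x)) (β := fun x => ∑ p,
        (N p (fun z => (ψ p z).re) x + Complex.I • N p (fun z => (ψ p z).im) x)) he hx ?_
      refine Alt2.ext' fun v w => ?_
      have h6 : TwoForm.inChart (fun x => pr11 (β x)) e (e x) = pr11 (β.inChart e (e x)) :=
        pr11_comp (β (e.symm (e x))) (symmD_I he hz)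
      rw [h6, pr11_eq_sum, inChart_apply, ContinuousAlternatingMap.sum_apply,
        ContinuousAlternatingMap.sum_apply]
      refine Finset.sum_congr rfl fun p _ => ?_
      have h7 : gam (plin p) (plin p) ![v, w] = (A p).inChart e (e x) ![v, w] := by
        rw [constForm_inChart he _ hz]
      rw [ContinuousAlternatingMap.add_apply, ContinuousAlternatingMap.smul_apply,
        ContinuousAlternatingMap.smul_apply, h7, inChart_apply, e.left_inv hx]
      simp only [hN, lift_of_mem hx]
      rw [ContinuousAlternatingMap.smul_apply, ContinuousAlternatingMap.smul_apply]
      have h8 : η (e x) * (ψ p (e x)).re = (ψ p (e x)).re ∧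
          η (e x) * (ψ p (e x)).im = (ψ p (e x)).im := by
        by_cases hxt : x ∈ tsupport β
        · have hb : e x ∈ closedBall (𝒦.c i) (2 * 𝒦.r i) :=
            closedBall_subset_closedBall (by linarith)
              (ball_subset_closedBall (𝒦.tsupport_subset i (hβs hxt)).2)
          have : η (e x) = 1 := η.one_of_mem_closedBall hb
          rw [this]; simp
        · have : ψ p (e x) = 0 := by
            rw [hψ]
            simp only [indicator_of_mem hz]
            exact hψ0 p _ hz (by rwa [e.left_inv hx])
          rw [this]; simp
      rw [h8.1, h8.2]
      have h9 : ψ p (e x) = pcoef p (β.inChart e (e x)) := indicator_of_mem hz _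
      rw [← h9, smul_eq_mul, smul_eq_mul, Complex.real_smul, Complex.real_smul]
      conv_lhs => rw [← Complex.re_add_im (ψ p (e x))]
      ring
    · have h6 : β x = 0 := image_eq_zero_of_notMem_tsupport fun h => hx (hsrc h)
      have h7 : ∀ p φ, N p φ x = 0 := fun p φ => by
        simp only [hN, lift_of_notMem hx]
        exact zero_smul ℝ (A p x)
      simp only [h6, h7, pr11_zero, zero_add]
      symm
      refine Finset.sum_eq_zero fun p _ => Alt2.ext' fun v w => by simp
  have hint : ∀ p, Integrable (fun z => ψ p z * (f p z : ℂ)) σ := by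
    intro p
    refine ((hψs p).1.continuous.integrable_of_hasCompactSupport (hψs p).2).mul_bdd (c := 1)
      (Complex.measurable_ofReal.comp (h2 p)).aestronglyMeasurable ?_
    refine Eventually.of_forall fun x => ?_
    rw [Complex.norm_real, Real.norm_of_nonneg (h3 p x).1]
    exact (h3 p x).2
  rw [ev_pr11 hT' hβ, key, T.ev_sum Finset.univ (α := fun p x =>
    (N p (fun z => (ψ p z).re) x + Complex.I • N p (fun z => (ψ p z).im) x)) fun p _ =>
      Current.add_mem (hNm p _ (hre p).1) ((testForms E X).smul_mem Complex.I (hNm p _ (him p).1))]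
  have hset : ∫ z in 𝒦.B i, ∑ p, (f p z : ℂ) * pcoef p (β.inChart e z) ∂σ =
      ∫ z, ∑ p, ψ p z * (f p z : ℂ) ∂σ := by
    rw [← integral_indicator isOpen_ball.measurableSet]
    refine integral_congr_ae (Eventually.of_forall fun z => ?_)
    by_cases hz : z ∈ 𝒦.B i
    · simp only [indicator_of_mem hz]
      refine Finset.sum_congr rfl fun p _ => ?_
      have : ψ p z = pcoef p (β.inChart e z) := indicator_of_mem (𝒦.B_subset_target i hz) _
      rw [this]
      ring
    · simp only [indicator_of_notMem hz]
      symm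
      refine Finset.sum_eq_zero fun p _ => ?_
      have : ψ p z = 0 := by
        by_cases hzt : z ∈ e.target
        · rw [hψ]
          simp only [indicator_of_mem hzt]
          refine hψ0 p z hzt fun h => hz ?_
          have h' : e (e.symm z) ∈ 𝒦.B i := (𝒦.tsupport_subset i (hβs h)).2
          rwa [e.right_inv hzt] at h' 
        · exact indicator_of_notMem hzt _
      rw [this, zero_mul]
  rw [hset, integral_finsetSum _ fun p _ => hint p]
  refine Finset.sum_congr rfl fun p _ => ?_
  have hadd : T.ev (fun x => N p (fun z => (ψ p z).re) x + Complex.I • N p (fun z => (ψ p z).im) x) =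
      T.ev (N p (fun z => (ψ p z).re)) + T.ev (fun x => Complex.I • N p (fun z => (ψ p z).im) x) :=
    T.ev_add (hNm p _ (hre p).1) ((testForms E X).smul_mem Complex.I (hNm p _ (him p).1))
  rw [hadd, T.ev_smul (hNm p _ (him p).1), hLev p _ (hre p).1, hLev p _ (him p).1,
    h5 p _ (hre p).1 (hre p).2, h5 p _ (him p).1 (him p).2]
  have e1 := integral_re (hint p)
  have e2 := integral_im (hint p)
  refine Complex.ext ?_ ?_
  · simp only [Complex.add_re, Complex.mul_re, Complex.I_re, Complex.I_im, Complex.ofReal_re,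
      Complex.ofReal_im]
    refine Eq.trans ?_ e1
    simp only [zero_mul, mul_zero, sub_zero, add_zero]
    refine integral_congr_ae (Eventually.of_forall fun z => ?_)
    simp
  · simp only [Complex.add_im, Complex.mul_im, Complex.I_re, Complex.I_im, Complex.ofReal_re,
      Complex.ofReal_im]
    refine Eq.trans ?_ e2
    simp only [zero_mul, one_mul, zero_add]
    refine integral_congr_ae (Eventually.of_forall fun z => ?_)
    simp

end LocalRepresentation

/-! ### Gluing the local representations -/

section GlobalRepresentation

variable {E : Type*} [NormedAddCommGroup E] [NormedSpace ℂ E] [FiniteDimensional ℂ E]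
variable {X : Type*} [TopologicalSpace X] [ChartedSpace E X]
variable [MeasurableSpace E] [BorelSpace E]
variable [T2Space X] [IsManifold 𝓘(ℂ, E) ω X]

theorem Cover.smul_mem (𝒦 : Cover E X) (i : ℕ) {α : TwoForm E X} (hα : α ∈ testForms E X) :
    (fun x => 𝒦.χ i x • α x : TwoForm E X) ∈ testForms E X := by
  have h := (smoothFormOn_of_mem hα univ).real_smul (𝒦.χ i).contMDiff.contMDiffOn
  exact h.mem isOpen_univ (hα.2.mono fun x hx h0 => hx (by
    change 𝒦.χ i x • α x = 0
    rw [h0]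
    exact Alt2.ext' fun v w => by simp)) (subset_univ _)

theorem Cover.ev_sum (𝒦 : Cover E X) (T : Current E X) {α : TwoForm E X}
    (hα : α ∈ testForms E X) :
    T.ev α = ∑ i ∈ (𝒦.finite_meeting hα.2.isCompact).toFinset, T.ev (fun x => 𝒦.χ i x • α x) := by
  rw [← T.ev_sum _ (α := fun i x => 𝒦.χ i x • α x) fun i _ => 𝒦.smul_mem i hα]
  congr 1
  funext x
  rw [← Finset.sum_smul]
  by_cases hx : α x = 0
  · rw [hx]; exact Alt2.ext' fun v w => by simp
  · have h1 := 𝒦.χ.sum_eq_one (mem_univ x)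
    rw [finsum_eq_sum_of_support_subset (s := (𝒦.finite_meeting hα.2.isCompact).toFinset)] at h1
    · rw [h1, one_smul]
    · intro i hi
      rw [Finite.coe_toFinset]
      exact ⟨x, subset_tsupport _ hi, subset_tsupport α hx⟩

theorem measurable_indicator_chart (𝒦 : Cover E X) (i : ℕ) {f : X → ℝ}
    (hf : Continuous f) :
    Measurable ((𝒦.B i).indicator fun z => f ((𝒦.e i).symm z)) := by
  have h : ContinuousOn (fun z => f ((𝒦.e i).symm z)) (𝒦.B i) :=
    hf.comp_continuousOn ((𝒦.e i).continuousOn_symm.mono (𝒦.B_subset_target i))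
  classical
  rw [← piecewise_eq_indicator]
  exact h.measurable_piecewise continuousOn_const isOpen_ball.measurableSet

/-- Positive currents of bidimension `(1,1)` are integrals of densities. -/
theorem exists_current_eq {T : Current E X} (hT : T.IsPositive) (hT' : T.IsBidimOneOne)
    (𝒦 : Cover E X) : ∃ (σ : Measure (ℕ × E)) (_ : IsFiniteMeasure σ) (τ : Density 𝒦),
      ∀ α ∈ testForms E X, T.ev α = ∫ o, τ.evalField (Density.field 𝒦 α) o ∂σ := by
  have := FiniteDimensional.proper ℝ E
  choose s f hs hfm hfb hfp hfe using exists_local_density hT hT' 𝒦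
  have hsB : ∀ i, s i (𝒦.B i) ≠ ⊤ := fun i =>
    ((measure_mono ball_subset_closedBall).trans_lt
      (isCompact_closedBall (𝒦.c i) (𝒦.r i)).measure_lt_top).ne
  -- The weights `δ i` make the sum of the local measures finite. The density below carries `(δ
  -- i)⁻¹` in compensation, together with the factor `χ i` which glues the local formulas.
  obtain ⟨δ, hδ, hδs⟩ := ENNReal.exists_pos_tsum_mul_lt_of_countable one_ne_zero
    (fun i => s i (𝒦.B i)) hsB
  have hmk : ∀ i : ℕ, Measurable (Prod.mk i : E → ℕ × E) := fun i => measurable_prodMk_left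
  set ν : ℕ → Measure (ℕ × E) := fun i =>
    (((δ i : NNReal) : ENNReal) • (s i).restrict (𝒦.B i)).map (Prod.mk i) with hν
  have hσ : IsFiniteMeasure (Measure.sum ν) := ⟨by
    rw [Measure.sum_apply _ MeasurableSet.univ]
    refine lt_of_le_of_lt (ENNReal.tsum_le_tsum fun i => ?_) (hδs.trans ENNReal.one_lt_top)
    rw [hν]
    simp only
    rw [Measure.map_apply (hmk i) MeasurableSet.univ, preimage_univ, Measure.smul_apply,
      Measure.restrict_apply_univ, smul_eq_mul, mul_comm]⟩
  have hδ' : ∀ i, (0 : ℝ) < δ i := fun i => hδ i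
  let τ : Density 𝒦 :=
    { g := fun i p z => ((δ i : ℝ)⁻¹) *
        ((𝒦.B i).indicator (fun z => 𝒦.χ i ((𝒦.e i).symm z)) z * f i p z)
      meas := fun i p => (((measurable_indicator_chart 𝒦 i (𝒦.χ i).contMDiff.continuous)).mul
        (hfm i p)).const_mul _
      bdd := fun i => ⟨(δ i : ℝ)⁻¹, fun p z => by
        have h1 : |(𝒦.B i).indicator (fun z => 𝒦.χ i ((𝒦.e i).symm z)) z| ≤ 1 := by
          by_cases hz : z ∈ 𝒦.B i
          · rw [indicator_of_mem hz, abs_of_nonneg (𝒦.χ.nonneg i _)]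
            exact 𝒦.χ.le_one i _
          · rw [indicator_of_notMem hz]; simp
        have h2 : |f i p z| ≤ 1 := by
          rw [abs_of_nonneg (hfb i p z).1]; exact (hfb i p z).2
        rw [abs_mul, abs_mul, abs_of_pos (inv_pos.2 (hδ' i))]
        have h3 := mul_le_one₀ h1 (abs_nonneg _) h2
        exact mul_le_of_le_one_right (inv_pos.2 (hδ' i)).le h3⟩
      supp := fun i p z h => by
        have h1 : (𝒦.B i).indicator (fun z => 𝒦.χ i ((𝒦.e i).symm z)) z ≠ 0 := fun h0 => h (by
          rw [h0]; ring)
        have hz : z ∈ 𝒦.B i := by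
          by_contra h'
          exact h1 (indicator_of_notMem h' _)
        rw [indicator_of_mem hz] at h1
        exact ⟨hz, subset_tsupport _ h1⟩
      pos := fun i z ξ hξ => by
        have h1 : 0 ≤ (𝒦.B i).indicator (fun z => 𝒦.χ i ((𝒦.e i).symm z)) z :=
          indicator_nonneg (fun z _ => 𝒦.χ.nonneg i _) z
        have h2 := hfp i z ξ hξ
        rw [Complex.re_sum]
        simp only [Complex.re_ofReal_mul]
        have h3 : ∀ p, (δ i : ℝ)⁻¹ *
            ((𝒦.B i).indicator (fun z => 𝒦.χ i ((𝒦.e i).symm z)) z * f i p z) * (pcoef p ξ).re =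
            ((δ i : ℝ)⁻¹ * (𝒦.B i).indicator (fun z => 𝒦.χ i ((𝒦.e i).symm z)) z) *
              ((pcoef p ξ).re * f i p z) := fun p => by ring
        simp only [h3]
        rw [← Finset.mul_sum]
        exact mul_nonneg (mul_nonneg (inv_pos.2 (hδ' i)).le h1) h2 }
  refine ⟨Measure.sum ν, hσ, τ, fun α hα => ?_⟩
  have hint := τ.integrable_form hα (Measure.sum ν)
  have hterm : ∀ i, ∫ o, τ.evalField (Density.field 𝒦 α) o ∂(ν i) =
      T.ev (fun x => 𝒦.χ i x • α x) := by
    intro i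
    rw [hν]
    simp only
    rw [integral_map (hmk i).aemeasurable (τ.measurable_evalField_form hα).aestronglyMeasurable,
      integral_smul_measure, hfe i _ (𝒦.smul_mem i hα) (tsupport_smul_form_subset _ _),
      ← integral_smul]
    refine setIntegral_congr_fun isOpen_ball.measurableSet fun z hz => ?_
    simp only [Density.evalField, Density.val, τ]
    rw [Finset.smul_sum]
    refine Finset.sum_congr rfl fun p _ => ?_
    rw [indicator_of_mem hz]
    have h1 : TwoForm.inChart (fun x => 𝒦.χ i x • α x) (𝒦.e i) z =
        ((𝒦.χ i ((𝒦.e i).symm z) : ℝ) : ℂ) • Density.field 𝒦 α i z :=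
      Alt2.ext' fun v w => by
        rw [ContinuousAlternatingMap.smul_apply, Density.field, inChart_apply, inChart_apply,
          ContinuousAlternatingMap.smul_apply, Complex.real_smul, smul_eq_mul]
    rw [h1, pcoef_smul, ENNReal.coe_toReal, Complex.real_smul]
    have h2 : (((δ i : NNReal) : ℝ) : ℂ) ≠ 0 := Complex.ofReal_ne_zero.2 (hδ' i).ne'
    push_cast
    field_simp
  rw [integral_sum_measure hint]
  simp_rw [hterm]
  rw [𝒦.ev_sum T hα]
  symm
  refine tsum_eq_sum fun i hi => ?_
  have : (fun x => 𝒦.χ i x • α x : TwoForm E X) = fun _ => 0 := by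
    funext x
    refine Alt2.ext' fun v w => ?_
    by_contra h
    refine hi ((Finite.mem_toFinset _).2 ⟨x, subset_tsupport _ fun h0 => h ?_,
      subset_tsupport _ fun h0 => h ?_⟩)
    · rw [h0]; simp
    · rw [h0]; simp
  rw [this, T.ev_eq (α := fun _ => 0) (testForms E X).zero_mem]
  exact map_zero T.toFun

end GlobalRepresentation

/-! ### Integral estimates for positive closed currents -/

section Estimates

variable {E : Type*} [NormedAddCommGroup E] [NormedSpace ℂ E]
variable {X : Type*} [TopologicalSpace X] [ChartedSpace E X]

/-- The estimates of this part all have this form: a linear combination of explicit test forms is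
checked to be positive at each point, and `T` is applied to it. -/
theorem Current.IsPositive.sum_ev_nonneg {T : Current E X} (hT : T.IsPositive) {n : ℕ}
    (c : Fin n → ℝ) (α : Fin n → TwoForm E X) (hα : ∀ k, α k ∈ testForms E X)
    (hp : ∀ x, PosForm (∑ k, c k • α k x : Alt2 E)) : 0 ≤ ∑ k, c k * (T.ev (α k)).re := by
  have h := hT.ev_nonneg (Current.sum_mem Finset.univ (α := fun k x => c k • α k x)
    fun k _ => Current.real_smul_mem (hα k) (c k)) hp
  rw [T.ev_sum Finset.univ (α := fun k x => c k • α k x)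
    fun k _ => Current.real_smul_mem (hα k) (c k), Complex.re_sum] at h
  refine h.trans_eq (Finset.sum_congr rfl fun k _ => ?_)
  rw [T.ev_real_smul (hα k), Complex.re_ofReal_mul]

/-- A form which is smooth on `U` and supported in the support of a test function. -/
theorem IsRTest.form_mem {ψ : X → ℝ} (hψ : IsRTest E ψ) {U : Set X} (hU : IsOpen U)
    (hs : tsupport ψ ⊆ U) {α : TwoForm E X} (hα : SmoothFormOn α U)
    (h0 : ∀ x ∉ tsupport ψ, α x = 0) : α ∈ testForms E X := by
  have h : tsupport α ⊆ tsupport ψ := closure_minimal (fun x hx => by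
    by_contra h
    exact hx (h0 x h)) (isClosed_tsupport ψ)
  exact hα.mem hU (hψ.compact.of_isClosed_subset (isClosed_tsupport _) h) (h.trans hs)

theorem IsRTest.eventuallyEq {ψ : X → ℝ} {x : X} (hx : x ∉ tsupport ψ) :
    ψ =ᶠ[𝓝 x] fun _ => 0 := notMem_tsupport_iff_eventuallyEq.1 hx

theorem ddc_eq_zero {ψ : X → ℝ} {x : X} (hx : x ∉ tsupport ψ) : (ddc ψ x : Alt2 E) = 0 := by
  rw [ddc_congr (IsRTest.eventuallyEq hx), ddc_const]

theorem dif_eq_zero {ψ : X → ℝ} {x : X} (hx : x ∉ tsupport ψ) : dif E ψ x = 0 := by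
  rw [dif_congr (IsRTest.eventuallyEq hx), dif_const]

theorem gam_zero_left (m : E →L[ℝ] ℝ) : gam (0 : E →L[ℝ] ℝ) m = 0 :=
  Alt2.ext' fun v w => by simp [gam_apply]

theorem gamForm_eq_zero {ψ : X → ℝ} {x : X} (hx : x ∉ tsupport ψ) (f : X → ℝ) :
    gamForm E ψ f x = 0 := by
  rw [gamForm, dif_eq_zero hx, gam_zero_left]

theorem Alt2.zero_rsmul (ξ : Alt2 E) : (0 : ℝ) • ξ = 0 := zero_smul ℝ ξ

theorem Alt2.rsmul_zero (a : ℝ) : a • (0 : Alt2 E) = 0 := Alt2.ext' fun v w => by simp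

variable (E) in
-- As the exponential equals its first two derivatives, the square of the gradient comes with the
-- same weight as the Levi form. Information on `e^a` thus becomes information on `i∂a∧∂̄a`.
theorem gamForm_exp {a : X → ℝ} {x : X} (ha : SmoothAt E a x) :
    (ddc (fun y => Real.exp (a y)) x : Alt2 E) =
      Real.exp (a x) • ddc a x + Real.exp (a x) • gamForm E a a x := by
  rw [ddc_comp ha Real.contDiff_exp, Real.deriv_exp, Real.deriv_exp]
  rfl

theorem contMDiffOn_exp {a : X → ℝ} {U : Set X} (ha : ContMDiffOn 𝓘(ℝ, E) 𝓘(ℝ, ℝ) ∞ a U) :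
    ContMDiffOn 𝓘(ℝ, E) 𝓘(ℝ, ℝ) ∞ (fun y => Real.exp (a y)) U :=
  (Real.contDiff_exp.contMDiff (n := ∞)).comp_contMDiffOn ha

theorem IsSmoothPshOn.exp {a : X → ℝ} {U : Set X} (hU : IsOpen U) (ha : IsSmoothPshOn E a U) :
    IsSmoothPshOn E (fun y => Real.exp (a y)) U := by
  refine ⟨contMDiffOn_exp ha.smooth, fun x hx => ?_⟩
  have h : PosForm (ddc (fun y => Real.exp (a y)) x : Alt2 E) := by
    rw [gamForm_exp E (ContMDiffOn.smoothAt ha.smooth hU hx)]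
    exact (PosForm.smul (ha.nonneg x hx) (Real.exp_pos _).le).add
      ((posForm_gam _).smul (Real.exp_pos _).le)
  exact h

variable [IsManifold 𝓘(ℂ, E) ω X]

theorem IsRTest.smul_ddc_mem {ψ : X → ℝ} (hψ : IsRTest E ψ) {U : Set X} (hU : IsOpen U)
    (hs : tsupport ψ ⊆ U) {a : X → ℝ} (ha : ContMDiffOn 𝓘(ℝ, E) 𝓘(ℝ, ℝ) ∞ a U) :
    (fun x => ψ x • ddc a x : TwoForm E X) ∈ testForms E X :=
  hψ.smul_mem hU hs (smoothFormOn_ddc hU ha)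

theorem IsRTest.smul_gamForm_mem {ψ : X → ℝ} (hψ : IsRTest E ψ) {U : Set X} (hU : IsOpen U)
    (hs : tsupport ψ ⊆ U) {a : X → ℝ} (ha : ContMDiffOn 𝓘(ℝ, E) 𝓘(ℝ, ℝ) ∞ a U) :
    (fun x => ψ x • gamForm E a a x : TwoForm E X) ∈ testForms E X :=
  hψ.smul_mem hU hs (smoothFormOn_gamForm hU ha ha)

theorem IsRTest.gamForm_mem {ψ : X → ℝ} (hψ : IsRTest E ψ) :
    (gamForm E ψ ψ : TwoForm E X) ∈ testForms E X :=
  hψ.form_mem isOpen_univ (subset_univ _)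
    (smoothFormOn_gamForm isOpen_univ hψ.smooth.contMDiffOn hψ.smooth.contMDiffOn)
    fun _ hx => gamForm_eq_zero hx ψ

/-- Bound of `T ∧ i∂a∧∂̄a` in terms of `T ∧ i∂∂̄eᵃ`. -/
theorem ev_gamForm_le {T : Current E X} (hT : T.IsPositive) {U : Set X} (hU : IsOpen U)
    {θ : X → ℝ} (hθ : IsRTest E θ) (hθU : tsupport θ ⊆ U) (hθ0 : ∀ x, 0 ≤ θ x) {a : X → ℝ}
    (ha : IsSmoothPshOn E a U) {m : ℝ} (hm : ∀ x ∈ tsupport θ, m ≤ Real.exp (a x)) :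
    m * (T.ev (fun x => θ x • gamForm E a a x)).re ≤
      (T.ev (fun x => θ x • ddc (fun y => Real.exp (a y)) x)).re := by
  have h := hT.sum_ev_nonneg ![1, -m] ![fun x => θ x • ddc (fun y => Real.exp (a y)) x,
    fun x => θ x • gamForm E a a x] (by
      simp only [Fin.forall_fin_succ, Matrix.cons_val_zero, Matrix.cons_val_succ]
      exact ⟨hθ.smul_ddc_mem hU hθU (contMDiffOn_exp ha.smooth),
        hθ.smul_gamForm_mem hU hθU ha.smooth, fun k => k.elim0⟩) (fun x => by
      simp only [Fin.sum_univ_two, Matrix.cons_val_zero, Matrix.cons_val_one]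
      by_cases hx : x ∈ tsupport θ
      · rw [gamForm_exp E (ContMDiffOn.smoothAt ha.smooth hU (hθU hx))]
        have h1 : PosForm (ddc a x : Alt2 E) := ha.nonneg x (hθU hx)
        have h2 : PosForm (gamForm E a a x) := posForm_gam _
        convert (h1.smul (mul_nonneg (hθ0 x) (Real.exp_pos (a x)).le)).add
          (h2.smul (mul_nonneg (hθ0 x) (sub_nonneg.2 (hm x hx)))) using 1
        module
      · have : θ x = 0 := image_eq_zero_of_notMem_tsupport hx
        rw [this]
        convert posForm_zero (E := E) using 1
        rw [Alt2.zero_rsmul, Alt2.zero_rsmul, Alt2.rsmul_zero, Alt2.rsmul_zero, add_zero])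
  simp only [Fin.sum_univ_two, Matrix.cons_val_zero, Matrix.cons_val_one] at h
  linarith

/-- The estimate behind the continuity of `T ∧ i∂∂̄w` with respect to uniform convergence. -/
theorem ev_sq_ddc_le {T : Current E X} (hT : T.IsPositive)
    (hcl : ∀ φ, IsRTest E φ → (T.ev (ddc φ)).re = 0) {U : Set X} (hU : IsOpen U)
    {ψ : X → ℝ} (hψ : IsRTest E ψ) (hψU : tsupport ψ ⊆ U) {w z : X → ℝ}
    (hw : IsSmoothPshOn E w U) (hz : IsSmoothPshOn E z U) {A : ℝ} (hA : 0 ≤ A)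
    (hwz : ∀ x ∈ tsupport ψ, A * |w x - z x| ≤ 1) {C : ℝ}
    (hC : ∀ g : X → ℝ, ContMDiffOn 𝓘(ℝ, E) 𝓘(ℝ, ℝ) ∞ g U → (∀ x ∈ tsupport ψ, |g x| ≤ 2) →
      |(T.ev (fun x => g x • ddc (fun y => ψ y * ψ y) x)).re| ≤ C) :
    A * Real.exp (-1) * (T.ev (fun x => (ψ x * ψ x) • ddc w x)).re ≤
      A * Real.exp 1 * (T.ev (fun x => (ψ x * ψ x) • ddc z x)).re +
        (4 * Real.exp 1 * (T.ev (gamForm E ψ ψ)).re + C) := by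
  have hψ2 : IsRTest E (fun y => ψ y * ψ y) := by simpa [pow_two] using hψ.sq
  have hs2 : tsupport (fun y => ψ y * ψ y) ⊆ tsupport ψ := tsupport_mul_subset_left
  have hf : ContMDiffOn 𝓘(ℝ, E) 𝓘(ℝ, ℝ) ∞ (fun y => A * (w y + (-1) * z y)) U :=
    contMDiffOn_const.mul (hw.smooth.add (contMDiffOn_const.mul hz.smooth))
  -- Since `A |w - z| ≤ 1` on the support of `ψ`, the values of `G` there lie between `e⁻¹` and `e`.
  -- With `l = A d(w - z)`, the exponential contributes a term `G gam l l`, which will absorb the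
  -- cross term in `i∂∂̄(ψ²(G - 1))`.
  set G : X → ℝ := fun y => Real.exp (A * (w y + (-1) * z y)) with hG
  have hGs : ContMDiffOn 𝓘(ℝ, E) 𝓘(ℝ, ℝ) ∞ G U := contMDiffOn_exp hf
  have hG1 : ContMDiffOn 𝓘(ℝ, E) 𝓘(ℝ, ℝ) ∞ (fun y => G y + (-1)) U := hGs.add contMDiffOn_const
  set Φ : X → ℝ := fun y => (ψ y * ψ y) * (G y + (-1)) with hΦdef
  have hΦ : IsRTest E Φ := hψ2.mul hU (hs2.trans hψU) hG1
  have hb : ∀ x ∈ tsupport ψ, Real.exp (-1) ≤ G x ∧ G x ≤ Real.exp 1 := by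
    intro x hx
    have h0 : |A * (w x - z x)| ≤ 1 := by
      rw [abs_mul, abs_of_nonneg hA]; exact hwz x hx
    have h1 := abs_le.1 h0
    rw [hG]
    simp only [Real.exp_le_exp]
    constructor <;> linarith [h1.1, h1.2]
  have he1 : Real.exp (-1) ≤ 1 := Real.exp_le_one_iff.2 (by norm_num)
  have he3 : Real.exp 1 ≤ 3 := by linarith [Real.exp_one_lt_d9]
  have hCb := hC (fun y => G y + (-1)) hG1 fun x hx => by
    have := hb x hx
    rw [abs_le]
    constructor <;> linarith [Real.exp_pos (-1)]
  have hmem : (fun x => (G x + (-1)) • ddc (fun y => ψ y * ψ y) x : TwoForm E X) ∈ testForms E X :=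
    hψ.form_mem hU hψU ((smoothFormOn_of_mem hψ2.ddc_mem U).real_smul hG1) fun x hx => by
      rw [ddc_eq_zero fun h => hx (hs2 h), Alt2.rsmul_zero]
  -- At each point of the support the combination equals `G` times the square of `ψ l + 2 dψ`, in
  -- the sense of `gam`, plus nonnegative multiples of `gamForm E ψ ψ`, `i∂∂̄z` and `i∂∂̄w`. The
  -- contribution of `Φ` is zero by closedness.
  have h := hT.sum_ev_nonneg ![4 * Real.exp 1, -1, 1, A * Real.exp 1, -(A * Real.exp (-1))]
    ![gamForm E ψ ψ, fun x => (G x + (-1)) • ddc (fun y => ψ y * ψ y) x, ddc Φ,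
      fun x => (ψ x * ψ x) • ddc z x, fun x => (ψ x * ψ x) • ddc w x] (by
      simp only [Fin.forall_fin_succ, Matrix.cons_val_zero, Matrix.cons_val_succ]
      exact ⟨hψ.gamForm_mem, hmem, hΦ.ddc_mem, hψ2.smul_ddc_mem hU (hs2.trans hψU) hz.smooth,
        hψ2.smul_ddc_mem hU (hs2.trans hψU) hw.smooth, fun k => k.elim0⟩) (fun x => by
      simp only [Fin.sum_univ_five, Matrix.cons_val]
      by_cases hx : x ∈ tsupport ψ
      · have hxU := hψU hx
        have sw := ContMDiffOn.smoothAt hw.smooth hU hxU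
        have sz := ContMDiffOn.smoothAt hz.smooth hU hxU
        have sz' : SmoothAt E (fun y => (-1) * z y) x := contMDiffAt_const.mul sz
        have sf₀ : SmoothAt E (fun y => w y + (-1) * z y) x := sw.add sz'
        have sf := ContMDiffOn.smoothAt hf hU hxU
        have sG := ContMDiffOn.smoothAt hGs hU hxU
        have sψ : SmoothAt E ψ x := hψ.smooth x
        have e1 : (ddc Φ x : Alt2 E) = (ψ x * ψ x) • ddc (fun y => G y + (-1)) x +
            (G x + (-1)) • ddc (fun y => ψ y * ψ y) x +
            (2 : ℝ) • gam (dif E (fun y => ψ y * ψ y) x) (dif E (fun y => G y + (-1)) x) :=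
          ddc_mul (hψ2.smooth x) (ContMDiffOn.smoothAt hG1 hU hxU)
        have e2 : (ddc (fun y => G y + (-1)) x : Alt2 E) = ddc G x := by
          rw [ddc_add sG contMDiffAt_const, ddc_const, add_zero]
        have e3 : dif E (fun y => G y + (-1)) x = dif E G x := by
          rw [dif_add sG contMDiffAt_const, dif_const, add_zero]
        have e4 : dif E (fun y => ψ y * ψ y) x = (2 * ψ x) • dif E ψ x := by
          rw [dif_mul sψ sψ]; module
        have e5 : (ddc (fun y => A * (w y + (-1) * z y)) x : Alt2 E) =
            A • (ddc w x + (-1 : ℝ) • ddc z x) := by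
          rw [ddc_const_mul sf₀, ddc_add sw sz', ddc_const_mul sz]
        set l := dif E (fun y => A * (w y + (-1) * z y)) x with hl
        have e6 : (ddc G x : Alt2 E) = G x • (A • (ddc w x + (-1 : ℝ) • ddc z x)) + G x • gam l l := by
          rw [← e5]; exact gamForm_exp E sf
        have e7 : dif E G x = G x • l := by
          have := dif_comp sf Real.contDiff_exp
          rw [Real.deriv_exp] at this
          exact this
        rw [e1, e2, e3, e4, e6, e7]
        simp only [gam_smul_left, gam_smul_right]
        have p1 : PosForm (ddc w x : Alt2 E) := hw.nonneg x hxU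
        have p2 : PosForm (ddc z x : Alt2 E) := hz.nonneg x hxU
        have p3 := posForm_gam_sq (ψ x) 2 l (dif E ψ x)
        have p4 : PosForm (gamForm E ψ ψ x) := posForm_gam _
        have hb1 := (hb x hx).1
        have hb2 := (hb x hx).2
        have hGp : 0 ≤ G x := (Real.exp_pos _).le
        convert (((p3.smul hGp).add (p4.smul (a := 4 * (Real.exp 1 - G x)) (by linarith))).add
          (p2.smul (a := A * (Real.exp 1 - G x) * (ψ x * ψ x))
            (mul_nonneg (mul_nonneg hA (by linarith)) (mul_self_nonneg _)))).add
          (p1.smul (a := A * (G x - Real.exp (-1)) * (ψ x * ψ x))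
            (mul_nonneg (mul_nonneg hA (by linarith)) (mul_self_nonneg _))) using 1
        rw [gam_symm (dif E ψ x) l, gamForm]
        module
      · have h0 : ψ x = 0 := image_eq_zero_of_notMem_tsupport hx
        have h1 : (ddc Φ x : Alt2 E) = 0 :=
          ddc_eq_zero fun h => hx (hs2 (tsupport_mul_subset_left h))
        rw [h1, gamForm_eq_zero hx, ddc_eq_zero fun h => hx (hs2 h), h0]
        convert posForm_zero (E := E) using 1
        simp only [Alt2.rsmul_zero, mul_zero, Alt2.zero_rsmul, add_zero])
  simp only [Fin.sum_univ_five, Matrix.cons_val] at h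
  rw [hcl Φ hΦ] at h
  have := (abs_le.1 hCb).1
  linarith

/-- The estimate behind `T(h(u) i∂∂̄φ) = 0`. -/
theorem ev_comp_ddc_le {T : Current E X} (hT : T.IsPositive)
    (hcl : ∀ φ, IsRTest E φ → (T.ev (ddc φ)).re = 0) {U : Set X} (hU : IsOpen U)
    {θ φ : X → ℝ} (hθ : IsRTest E θ) (hθU : tsupport θ ⊆ U) (hθ0 : ∀ x, 0 ≤ θ x)
    (hφ : IsRTest E φ) (hφU : tsupport φ ⊆ U) (hθφ : ∀ x ∈ tsupport φ, θ x = 1)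
    {a : X → ℝ} (ha : IsSmoothPshOn E a U) {h : ℝ → ℝ} (hh : ContDiff ℝ ∞ h) {M N : ℝ}
    (hM : ∀ s, |deriv h s| ≤ M) (hM' : ∀ s, |deriv (deriv h) s| ≤ M) (hN : ∀ x, |φ x| ≤ N)
    {t : ℝ} (ht : 0 < t) :
    (T.ev (fun x => h (a x) • ddc φ x)).re ≤ N * M * (T.ev (fun x => θ x • ddc a x)).re +
      (N * M + M * t) * (T.ev (fun x => θ x • gamForm E a a x)).re +
        M * t⁻¹ * (T.ev (gamForm E φ φ)).re := by
  have hha : ContMDiffOn 𝓘(ℝ, E) 𝓘(ℝ, ℝ) ∞ (fun x => h (a x)) U :=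
    (hh.contMDiff (n := ∞)).comp_contMDiffOn ha.smooth
  set Φ : X → ℝ := fun y => φ y * h (a y) with hΦdef
  have hΦ : IsRTest E Φ := hφ.mul hU hφU hha
  have hmem : (fun x => h (a x) • ddc φ x : TwoForm E X) ∈ testForms E X :=
    hφ.form_mem hU hφU ((smoothFormOn_of_mem hφ.ddc_mem U).real_smul hha) fun x hx => by
      rw [ddc_eq_zero hx, Alt2.rsmul_zero]
  have hM0 : 0 ≤ M := (abs_nonneg _).trans (hM 0)
  -- `T` has zero real part on `i∂∂̄Φ`. In its expansion the cross term `2 h'(a) gam(da, dφ)` is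
  -- dominated by the weighted squares of `da ± t⁻¹ dφ`, at the cost of `M t` on the square of `da`
  -- and `M t⁻¹` on that of `dφ`; the other derivative terms are bounded by `N M`.
  have key := hT.sum_ev_nonneg ![-1, 1, N * M, N * M + M * t, M * t⁻¹]
    ![fun x => h (a x) • ddc φ x, ddc Φ, fun x => θ x • ddc a x, fun x => θ x • gamForm E a a x,
      gamForm E φ φ] (by
      simp only [Fin.forall_fin_succ, Matrix.cons_val_zero, Matrix.cons_val_succ]
      exact ⟨hmem, hΦ.ddc_mem, hθ.smul_ddc_mem hU hθU ha.smooth,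
        hθ.smul_gamForm_mem hU hθU ha.smooth, hφ.gamForm_mem, fun k => k.elim0⟩) (fun x => by
      simp only [Fin.sum_univ_five, Matrix.cons_val]
      have hN0 : 0 ≤ N := (abs_nonneg _).trans (hN x)
      have p2 : PosForm (gamForm E a a x) := posForm_gam _
      by_cases hx : x ∈ tsupport φ
      · have hxU := hφU hx
        have p1 : PosForm (ddc a x : Alt2 E) := ha.nonneg x hxU
        have sa := ContMDiffOn.smoothAt ha.smooth hU hxU
        have sφ : SmoothAt E φ x := hφ.smooth x
        have e1 : (ddc Φ x : Alt2 E) = φ x • ddc (fun y => h (a y)) x +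
            h (a x) • ddc φ x + (2 : ℝ) • gam (dif E φ x) (dif E (fun y => h (a y)) x) :=
          ddc_mul sφ (ContMDiffOn.smoothAt hha hU hxU)
        rw [e1, ddc_comp sa hh, dif_comp sa hh, hθφ x hx, gam_smul_right,
          gam_symm (dif E φ x) (dif E a x)]
        set d1 := deriv h (a x)
        set d2 := deriv (deriv h) (a x)
        have b1 : |φ x * d1| ≤ N * M := by
          rw [abs_mul]; exact mul_le_mul (hN x) (hM _) (abs_nonneg _) hN0
        have b2 : |φ x * d2| ≤ N * M := by
          rw [abs_mul]; exact mul_le_mul (hN x) (hM' _) (abs_nonneg _) hN0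
        have b3 := abs_le.1 (hM (a x))
        have q1 := (posForm_gam_sq 1 t⁻¹ (dif E a x) (dif E φ x)).smul
          (a := t * ((M + d1) / 2)) (mul_nonneg ht.le (by linarith [b3.1]))
        have q2 := (posForm_gam_sq 1 (-t⁻¹) (dif E a x) (dif E φ x)).smul
          (a := t * ((M - d1) / 2)) (mul_nonneg ht.le (by linarith [b3.2]))
        convert ((q1.add q2).add (p1.smul (a := N * M + φ x * d1) (by linarith [(abs_le.1 b1).1]))).add
          (p2.smul (a := N * M + φ x * d2) (by linarith [(abs_le.1 b2).1])) using 1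
        simp only [gamForm]
        match_scalars <;> field_simp <;> ring
      · have h1 : (ddc Φ x : Alt2 E) = 0 := ddc_eq_zero fun h => hx (tsupport_mul_subset_left h)
        rw [h1, ddc_eq_zero hx, gamForm_eq_zero hx]
        by_cases hxθ : x ∈ tsupport θ
        · have p1 : PosForm (ddc a x : Alt2 E) := ha.nonneg x (hθU hxθ)
          convert (p1.smul (mul_nonneg (mul_nonneg hN0 hM0) (hθ0 x))).add
            (p2.smul (mul_nonneg (add_nonneg (mul_nonneg hN0 hM0) (mul_nonneg hM0 ht.le)) (hθ0 x)))
            using 1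
          simp only [Alt2.rsmul_zero, zero_add, add_zero]
          module
        · have h0 : θ x = 0 := image_eq_zero_of_notMem_tsupport hxθ
          rw [h0]
          convert posForm_zero (E := E) using 1
          simp only [Alt2.rsmul_zero, Alt2.zero_rsmul, add_zero])
  simp only [Fin.sum_univ_five, Matrix.cons_val] at key
  rw [hcl Φ hΦ] at key
  linarith

end Estimates

/-! ### Sub-mean value inequalities and the Levi form -/

section Submean

/-- Jensen's inequality: integrate the tangent line bound `e^m (1 + F - m) ≤ e^F` over the circle,
with `m` the average of `F`. -/
theorem exp_le_circleAverage {F : ℂ → ℝ} (hF : ContinuousOn F (sphere 0 1)) :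
    Real.exp (Real.circleAverage F 0 1) ≤ Real.circleAverage (fun z => Real.exp (F z)) 0 1 := by
  set m := Real.circleAverage F 0 1 with hm
  have h1 : CircleIntegrable F 0 1 := hF.circleIntegrable zero_le_one
  have h2 : CircleIntegrable (fun z => Real.exp (F z)) 0 1 :=
    (Real.continuous_exp.comp_continuousOn hF).circleIntegrable zero_le_one
  have h3 : CircleIntegrable (fun _ => Real.exp m * (1 - m)) (0 : ℂ) 1 :=
    continuousOn_const.circleIntegrable zero_le_one
  have h4 : CircleIntegrable (fun z => Real.exp m • F z) 0 1 :=
    (hF.const_smul (Real.exp m)).circleIntegrable zero_le_one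
  have h5 : Real.circleAverage (fun z => Real.exp m * (1 - m) + Real.exp m • F z) 0 1 = Real.exp m := by
    rw [Real.circleAverage_fun_add h3 h4, Real.circleAverage_const, Real.circleAverage_fun_smul,
      ← hm, smul_eq_mul]
    ring
  rw [← h5]
  refine Real.circleAverage_mono (h3.add h4) h2 fun z _ => ?_
  have h6 := Real.add_one_le_exp (F z - m)
  rw [Real.exp_sub, le_div_iff₀ (Real.exp_pos m)] at h6
  rw [smul_eq_mul]
  linarith

variable {E : Type*} [NormedAddCommGroup E] [NormedSpace ℂ E]

/-- This allows the Levi condition on `T` to be used for `e^u` besides `u`, which is how `T ∧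
i∂u∧∂̄u = 0` is obtained. -/
theorem IsPshZero.exp {X : Type*} [TopologicalSpace X] [ChartedSpace E X] {u : X → ℝ}
    (hu : IsPshZero E u) : IsPshZero E fun x => Real.exp (u x) := by
  refine ⟨Real.continuous_exp.comp hu.continuous, fun f r hr hf => ?_⟩
  have h1 : ContinuousOn (fun z => u (f z)) (sphere (0 : ℂ) 1) :=
    hu.continuous.comp_continuousOn (hf.continuousOn.mono fun z hz => by
      rw [mem_sphere] at hz
      rw [mem_ball, hz]; exact hr)
  exact (Real.exp_le_exp.2 (hu.submean f r hr hf)).trans (exp_le_circleAverage h1)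

/-- The second order Taylor formula. -/
theorem taylor_two {f : E → ℝ} {z : E} (hf : ContDiffAt ℝ 2 f z) {ε : ℝ} (hε : 0 < ε) :
    ∃ δ > 0, ∀ h : E, ‖h‖ ≤ δ →
      |f (z + h) - f z - fderiv ℝ f z h - 1 / 2 * hess f z h h| ≤ ε * ‖h‖ ^ 2 := by
  have h1 := (hasFDerivAt_fderiv hf).isLittleO.def hε
  have h2 := eventually_differentiableAt hf
  obtain ⟨δ, hδ, hb⟩ := nhds_basis_closedBall.mem_iff.1 (h1.and h2)
  refine ⟨δ, hδ, fun h hh => ?_⟩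
  have hsym : IsSymmSndFDerivAt ℝ f z := hf.isSymmSndFDerivAt (by simp)
  set R : E → ℝ := fun y => f y - fderiv ℝ f z (y - z) - 1 / 2 * hess f z (y - z) (y - z) with hR
  have hball : closedBall z ‖h‖ ⊆ closedBall z δ := closedBall_subset_closedBall hh
  have hd : ∀ y ∈ closedBall z ‖h‖, HasFDerivWithinAt R
      (fderiv ℝ f y - fderiv ℝ f z - hess f z (y - z)) (closedBall z ‖h‖) y := by
    intro y hy
    have e1 : HasFDerivAt f (fderiv ℝ f y) y := (hb (hball hy)).2.hasFDerivAt
    have e0 : HasFDerivAt (fun y : E => y - z) (ContinuousLinearMap.id ℝ E) y :=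
      (hasFDerivAt_id y).sub_const z
    have e2 : HasFDerivAt (fun y : E => fderiv ℝ f z (y - z)) (fderiv ℝ f z) y := by
      have := (fderiv ℝ f z).hasFDerivAt.comp y e0
      rwa [ContinuousLinearMap.comp_id] at this
    have e3 : HasFDerivAt (fun y : E => hess f z (y - z) (y - z))
        ((2 : ℝ) • hess f z (y - z)) y := by
      have := ((hess f z).hasFDerivAt.comp y e0).clm_apply e0
      refine this.congr_fderiv ?_
      ext v
      simp only [add_apply, ContinuousLinearMap.comp_apply, ContinuousLinearMap.flip_apply,
        ContinuousLinearMap.id_apply, smul_apply, smul_eq_mul, Function.comp_apply]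
      rw [hsym v (y - z)]
      ring
    have e4 := (e1.sub e2).sub (e3.const_mul (1 / 2))
    refine (e4.congr_fderiv ?_).hasFDerivWithinAt
    rw [smul_smul]
    norm_num
  have hbd : ∀ y ∈ closedBall z ‖h‖, ‖fderiv ℝ f y - fderiv ℝ f z - hess f z (y - z)‖ ≤ ε * ‖h‖ := by
    intro y hy
    refine (hb (hball hy)).1.trans ?_
    rw [mem_closedBall, dist_eq_norm] at hy
    gcongr
  have h3 := (convex_closedBall z ‖h‖).norm_image_sub_le_of_norm_hasFDerivWithin_le hd hbd
    (mem_closedBall_self (norm_nonneg h)) (y := z + h) (by simp)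
  have h4 : R (z + h) - R z = f (z + h) - f z - fderiv ℝ f z h - 1 / 2 * hess f z h h := by
    simp only [hR, add_sub_cancel_left, sub_self, map_zero, mul_zero]
    ring
  rw [h4, add_sub_cancel_left, Real.norm_eq_abs] at h3
  calc _ ≤ ε * ‖h‖ * ‖h‖ := h3
    _ = ε * ‖h‖ ^ 2 := by ring

/-- Circle averages of quadratic polynomials. -/
theorem circleAverage_quadratic (a0 a1 a2 b1 b2 b3 : ℝ) :
    Real.circleAverage (fun ζ : ℂ => a0 + (a1 * ζ.re + a2 * ζ.im) +
      (b1 * (ζ.re * ζ.re) + b2 * (ζ.re * ζ.im) + b3 * (ζ.im * ζ.im))) 0 1 = a0 + (b1 + b3) / 2 := by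
  have hre : ∀ θ : ℝ, (circleMap 0 1 θ).re = Real.cos θ := fun θ => by
    simp [circleMap, Complex.exp_ofReal_mul_I_re]
  have him : ∀ θ : ℝ, (circleMap 0 1 θ).im = Real.sin θ := fun θ => by
    simp [circleMap, Complex.exp_ofReal_mul_I_im]
  have e : ∀ θ : ℝ, a0 + (a1 * Real.cos θ + a2 * Real.sin θ) +
      (b1 * (Real.cos θ * Real.cos θ) + b2 * (Real.cos θ * Real.sin θ) +
        b3 * (Real.sin θ * Real.sin θ)) = (a0 + (b1 + b3) / 2) + (a1 * Real.cos θ + a2 * Real.sin θ) +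
      ((b1 - b3) / 2 * Real.cos (2 * θ) + b2 / 2 * Real.sin (2 * θ)) := by
    intro θ
    rw [Real.cos_two_mul, Real.sin_two_mul]
    have := Real.sin_sq_add_cos_sq θ
    linear_combination b3 * this
  rw [Real.circleAverage_def]
  simp only [hre, him, e]
  have i1 : IntervalIntegrable (fun θ => (a0 + (b1 + b3) / 2) + (a1 * Real.cos θ + a2 * Real.sin θ))
      volume 0 (2 * Real.pi) := by
    apply Continuous.intervalIntegrable; fun_prop
  have i2 : IntervalIntegrable (fun θ => (b1 - b3) / 2 * Real.cos (2 * θ) + b2 / 2 * Real.sin (2 * θ))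
      volume 0 (2 * Real.pi) := by
    apply Continuous.intervalIntegrable; fun_prop
  have h4 : Real.sin (2 * (2 * Real.pi)) = 0 := by
    rw [Real.sin_two_mul, Real.sin_two_pi]; ring
  have h5 : Real.cos (2 * (2 * Real.pi)) = 1 := by
    rw [Real.cos_two_mul, Real.cos_two_pi]; norm_num
  have j1 : ∫ θ in (0 : ℝ)..2 * Real.pi, (a1 * Real.cos θ + a2 * Real.sin θ) = 0 := by
    rw [intervalIntegral.integral_add (by apply Continuous.intervalIntegrable; fun_prop)
      (by apply Continuous.intervalIntegrable; fun_prop)]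
    simp
  have j2 : ∫ θ in (0 : ℝ)..2 * Real.pi,
      ((b1 - b3) / 2 * Real.cos (2 * θ) + b2 / 2 * Real.sin (2 * θ)) = 0 := by
    rw [intervalIntegral.integral_add (by apply Continuous.intervalIntegrable; fun_prop)
      (by apply Continuous.intervalIntegrable; fun_prop), intervalIntegral.integral_const_mul,
      intervalIntegral.integral_const_mul,
      intervalIntegral.integral_comp_mul_left (fun x => Real.cos x) two_ne_zero,
      intervalIntegral.integral_comp_mul_left (fun x => Real.sin x) two_ne_zero, integral_cos,
      integral_sin, h4, h5]
    simp
  rw [intervalIntegral.integral_add i1 i2, j2, intervalIntegral.integral_add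
    (by apply Continuous.intervalIntegrable; fun_prop)
    (by apply Continuous.intervalIntegrable; fun_prop), j1, intervalIntegral.integral_const,
    smul_eq_mul, smul_eq_mul]
  have := Real.pi_pos
  field_simp
  ring

/-- The Levi form of a function with the sub-mean value property on small discs is nonnegative. -/
theorem posForm_iddbarFlat_of_submean {f : E → ℝ} {z : E} (hf : ContDiff ℝ 2 f) {δ : ℝ}
    (hδ : 0 < δ) (hsub : ∀ a : E, ‖a‖ ≤ δ →
      f z ≤ Real.circleAverage (fun ζ : ℂ => f (z + ζ • a)) 0 1) :
    PosForm (iddbarFlat (fun y => (f y : ℂ)) z) := by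
  have hpos : ∀ a : E, 0 ≤ hess f z a a + hess f z (Complex.I • a) (Complex.I • a) := by
    intro a
    set H := hess f z with hH
    -- Taylor's formula on a small disc of radius `s ‖a‖`: the circle average of the quadratic part
    -- is `s² / 4` times the quantity on the right, and the error is at most `ε s² ‖a‖²`. Dividing
    -- by `s² / 4` gives the constant `4`.
    have key : ∀ ε > 0, -(4 * ε * ‖a‖ ^ 2) ≤ H a a + H (Complex.I • a) (Complex.I • a) := by
      intro ε hε
      obtain ⟨η, hη, hη2⟩ := taylor_two (z := z) hf.contDiffAt hε
      obtain ⟨s, hs, hs1, hs2⟩ : ∃ s : ℝ, 0 < s ∧ s * ‖a‖ ≤ δ ∧ s * ‖a‖ ≤ η := by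
        refine ⟨min δ η / (‖a‖ + 1), by positivity, ?_, ?_⟩
        · refine le_trans ?_ (min_le_left δ η)
          rw [div_mul_eq_mul_div, div_le_iff₀ (by positivity)]
          nlinarith [lt_min hδ hη, norm_nonneg a]
        · refine le_trans ?_ (min_le_right δ η)
          rw [div_mul_eq_mul_div, div_le_iff₀ (by positivity)]
          nlinarith [lt_min hδ hη, norm_nonneg a]
      have hn : ‖s • a‖ = s * ‖a‖ := by rw [norm_smul, Real.norm_of_nonneg hs.le]
      have h1 := hsub (s • a) (by rw [hn]; exact hs1)
      have hq := circleAverage_quadratic (f z + ε * (s * ‖a‖) ^ 2) (s * fderiv ℝ f z a)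
        (s * fderiv ℝ f z (Complex.I • a)) (1 / 2 * s ^ 2 * H a a)
        (1 / 2 * s ^ 2 * (H a (Complex.I • a) + H (Complex.I • a) a))
        (1 / 2 * s ^ 2 * H (Complex.I • a) (Complex.I • a))
      have hmono : Real.circleAverage (fun ζ : ℂ => f (z + ζ • s • a)) 0 1 ≤
          (f z + ε * (s * ‖a‖) ^ 2) + ((1 / 2 * s ^ 2 * H a a) +
            (1 / 2 * s ^ 2 * H (Complex.I • a) (Complex.I • a))) / 2 := by
        rw [← hq]
        refine Real.circleAverage_mono ?_ ?_ fun ζ hζ => ?_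
        · refine ContinuousOn.circleIntegrable zero_le_one (Continuous.continuousOn ?_)
          exact hf.continuous.comp (by fun_prop)
        · refine ContinuousOn.circleIntegrable zero_le_one (Continuous.continuousOn ?_)
          fun_prop
        · have hζ1 : ‖ζ‖ = 1 := by simpa using hζ
          have hn2 : ‖ζ • s • a‖ = s * ‖a‖ := by rw [norm_smul, hζ1, one_mul, hn]
          have h2 := (abs_le.1 (hη2 (ζ • s • a) (by rw [hn2]; exact hs2))).2
          rw [hn2] at h2
          have hdec : ζ • s • a = (s * ζ.re) • a + (s * ζ.im) • (Complex.I • a) := by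
            have : ζ • s • a = ((ζ.re : ℂ) + ζ.im * Complex.I) • s • a := by rw [Complex.re_add_im]
            rw [this, add_smul, mul_smul, Complex.coe_smul, Complex.coe_smul, smul_smul,
              smul_comm Complex.I s a, smul_smul]
            rw [mul_comm, mul_comm ζ.im]
          rw [hdec] at h2 ⊢
          simp only [map_add, map_smul, add_apply, smul_apply, smul_eq_mul] at h2
          rw [← hH] at h2
          linarith
      have h3 := h1.trans hmono
      have hs2 : 0 < s ^ 2 := by positivity
      have h4 : 0 ≤ s ^ 2 * (4 * ε * ‖a‖ ^ 2 + (H a a + H (Complex.I • a) (Complex.I • a))) := by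
        nlinarith
      have h5 := nonneg_of_mul_nonneg_right h4 hs2
      linarith
    by_contra hneg
    push Not at hneg
    set d := H a a + H (Complex.I • a) (Complex.I • a) with hd
    -- For this value of `ε` the left side `4 ε ‖a‖²` is at most `-d / 2`, which is incompatible
    -- with `d < 0`.
    have h6 := key (-d / (8 * (‖a‖ ^ 2 + 1))) (div_pos (by linarith) (by positivity))
    have h7 : 4 * (-d / (8 * (‖a‖ ^ 2 + 1))) * ‖a‖ ^ 2 = -d / 2 * (‖a‖ ^ 2 / (‖a‖ ^ 2 + 1)) := by
      field_simp; ring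
    have h8 : ‖a‖ ^ 2 / (‖a‖ ^ 2 + 1) ≤ 1 := by
      rw [div_le_one (by positivity)]; linarith
    rw [h7] at h6
    nlinarith
  have hap := iddbarFlat_ofReal (z := z) hf.contDiffAt
  refine ⟨fun v w => ?_, fun v => ?_⟩
  · rw [hap, hap, I_smul_I_smul, I_smul_I_smul]
    congr 1
    simp only [map_neg, neg_apply]
    ring
  · rw [hap, I_smul_I_smul]
    refine ⟨?_, Complex.ofReal_im _⟩
    rw [Complex.ofReal_re, map_neg]
    have := hpos v
    linarith

end Submean

/-! ### Regularization by convolution in a vector space -/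

section Convolution

open ContinuousLinearMap Convolution

variable {E : Type*} [NormedAddCommGroup E] [NormedSpace ℂ E] [FiniteDimensional ℂ E]
  [MeasurableSpace E] [BorelSpace E]

/-- Convolution preserves the sub-mean value property. -/
theorem submean_convolution (φ : ContDiffBump (0 : E)) {g : E → ℝ} (hg : Continuous g)
    (hgc : HasCompactSupport g) {y a : E}
    (h : ∀ t ∈ ball (0 : E) φ.rOut, g (y - t) ≤
      Real.circleAverage (fun ζ : ℂ => g (y - t + ζ • a)) 0 1) :
    (φ.normed Measure.addHaar ⋆[lsmul ℝ ℝ, Measure.addHaar] g) y ≤ Real.circleAverage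
      (fun ζ : ℂ => (φ.normed Measure.addHaar ⋆[lsmul ℝ ℝ, Measure.addHaar] g) (y + ζ • a)) 0 1 := by
  have := FiniteDimensional.proper ℝ E
  obtain ⟨M, hM⟩ := hgc.exists_bound_of_continuous hg
  set ρ := φ.normed Measure.addHaar with hρ
  have hρc : Continuous ρ := φ.continuous_normed
  have hρi : Integrable ρ Measure.addHaar := φ.integrable_normed
  simp only [convolution_def, lsmul_apply, smul_eq_mul, Real.circleAverage_def]
  -- Fubini exchanges the convolution with the circle average. The sub-mean value property of the
  -- translates of `g` is then integrated against the nonnegative kernel.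
  have hint : Integrable (Function.uncurry fun (θ : ℝ) (t : E) =>
      ρ t * g (y + circleMap 0 1 θ • a - t))
      ((volume.restrict (uIoc 0 (2 * Real.pi))).prod Measure.addHaar) := by
    have hc : Continuous (Function.uncurry fun (θ : ℝ) (t : E) =>
        ρ t * g (y + circleMap 0 1 θ • a - t)) := by
      refine (hρc.comp continuous_snd).mul (hg.comp ?_)
      exact (continuous_const.add (((continuous_circleMap 0 1).comp continuous_fst).smul
        continuous_const)).sub continuous_snd
    have hfin : IsFiniteMeasure (volume.restrict (uIoc 0 (2 * Real.pi))) :=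
      ⟨by rw [Measure.restrict_apply_univ, uIoc]; exact measure_Ioc_lt_top⟩
    have hb : Integrable (fun p : ℝ × E => M * ρ p.2)
        ((volume.restrict (uIoc 0 (2 * Real.pi))).prod Measure.addHaar) :=
      (hρi.comp_snd _).const_mul M
    refine hb.mono' hc.aestronglyMeasurable (Eventually.of_forall fun p => ?_)
    have h1 : 0 ≤ ρ p.2 := φ.nonneg_normed _
    simp only [Function.uncurry]
    rw [norm_mul, Real.norm_of_nonneg h1, mul_comm]
    gcongr
    exact hM _
  rw [intervalIntegral_integral_swap hint, ← integral_const_mul]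
  have hgi : ∀ t, ρ t * g (y - t) ≤ (2 * Real.pi)⁻¹ *
      ∫ θ in (0 : ℝ)..2 * Real.pi, ρ t * g (y + circleMap 0 1 θ • a - t) := by
    intro t
    rw [intervalIntegral.integral_const_mul]
    by_cases ht : t ∈ ball (0 : E) φ.rOut
    · have h1 := h t ht
      rw [Real.circleAverage_def, smul_eq_mul] at h1
      have h2 := mul_le_mul_of_nonneg_left h1 (φ.nonneg_normed (μ := Measure.addHaar) t)
      refine h2.trans_eq ?_
      rw [← hρ]
      have : ∀ θ : ℝ, y - t + circleMap 0 1 θ • a = y + circleMap 0 1 θ • a - t := fun θ => by abel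
      simp only [this]
      ring
    · have : ρ t = 0 := by
        by_contra h'
        have : t ∈ Function.support ρ := h'
        rw [hρ, φ.support_normed_eq] at this
        exact ht this
      rw [this]; simp
  refine integral_mono ?_ ?_ hgi
  · exact ((hρc.mul (hg.comp (continuous_const.sub continuous_id))).integrable_of_hasCompactSupport
      φ.hasCompactSupport_normed.mul_right)
  · have := hint.integral_prod_right
    simp only [Function.uncurry] at this
    refine (this.const_mul (2 * Real.pi)⁻¹).congr (Eventually.of_forall fun t => ?_)
    simp only
    rw [intervalIntegral.integral_of_le Real.two_pi_pos.le, uIoc_of_le Real.two_pi_pos.le]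

/-- Regularization of functions with the sub-mean value property on small discs. -/
theorem exists_smooth_approx {g : E → ℝ} (hg : Continuous g) (hgc : HasCompactSupport g)
    {V : Set E} {δ : ℝ} (hδ : 0 < δ)
    (h : ∀ y ∈ V, ∀ t a : E, ‖t‖ ≤ δ → ‖a‖ ≤ δ →
      g (y - t) ≤ Real.circleAverage (fun ζ : ℂ => g (y - t + ζ • a)) 0 1) :
    ∃ z : ℕ → E → ℝ, (∀ n, ContDiff ℝ ∞ (z n)) ∧ TendstoUniformly z g atTop ∧
      (∀ n, ∀ y ∈ V, PosForm (iddbarFlat (fun x => (z n x : ℂ)) y)) ∧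
      (ContDiff ℝ 1 g → ∀ y, Tendsto (fun n => fderiv ℝ (z n) y) atTop (𝓝 (fderiv ℝ g y))) := by
  have := FiniteDimensional.proper ℝ E
  let φ : ℕ → ContDiffBump (0 : E) := fun n =>
    ⟨δ / (n + 2), δ / (n + 1), by positivity, by
      apply div_lt_div_of_pos_left hδ (by positivity); linarith⟩
  have hφ0 : Tendsto (fun n => (φ n).rOut) atTop (𝓝 0) := by
    have := (tendsto_one_div_add_atTop_nhds_zero_nat (𝕜 := ℝ)).const_mul δ
    rw [mul_zero] at this
    refine this.congr fun n => ?_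
    simp only [φ]; ring
  have hφδ : ∀ n, (φ n).rOut ≤ δ := fun n => by
    simp only [φ]
    exact div_le_self hδ.le (by linarith [(Nat.cast_nonneg n : (0 : ℝ) ≤ n)])
  set z : ℕ → E → ℝ := fun n =>
    ((φ n).normed Measure.addHaar ⋆[lsmul ℝ ℝ, Measure.addHaar] g) with hz
  have hzs : ∀ n, ContDiff ℝ ∞ (z n) := fun n =>
    (φ n).hasCompactSupport_normed.contDiff_convolution_left _ (φ n).contDiff_normed
      hg.locallyIntegrable
  refine ⟨z, hzs, ?_, fun n y hy => ?_, fun hg1 y => ?_⟩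
  · rw [Metric.tendstoUniformly_iff]
    intro ε hε
    have huc := hg.uniformContinuous_of_tendsto_cocompact (x := 0) (hgc.is_zero_at_infty)
    obtain ⟨η, hη, hηε⟩ := Metric.uniformContinuous_iff.1 huc (ε / 2) (by linarith)
    have h1 : ∀ᶠ n in atTop, (φ n).rOut < η := hφ0.eventually (gt_mem_nhds hη)
    filter_upwards [h1] with n hn x
    rw [dist_comm]
    refine lt_of_le_of_lt ((φ n).dist_normed_convolution_le hg.aestronglyMeasurable
      (ε := ε / 2) fun y hy => ?_) (by linarith)
    exact (hηε ((mem_ball.1 hy).trans hn)).le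
  · refine posForm_iddbarFlat_of_submean ((hzs n).of_le two_le_infty) hδ fun a ha => ?_
    refine submean_convolution (φ n) hg hgc fun t ht => h y hy t a ?_ ha
    exact (mem_ball_zero_iff.1 ht).le.trans (hφδ n)
  -- For `g` of class `C¹` the derivative can be moved onto `g`, so the gradients are themselves
  -- convolutions and converge.
  · have h1 : ∀ n, fderiv ℝ (z n) y =
        ((φ n).normed Measure.addHaar ⋆[lsmul ℝ ℝ, Measure.addHaar] fderiv ℝ g) y := by
      intro n
      have := (hgc.hasFDerivAt_convolution_right (lsmul ℝ ℝ)
        ((φ n).continuous_normed (μ := Measure.addHaar)).locallyIntegrable hg1 y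
        (μ := Measure.addHaar)).fderiv
      rw [hz, this, convolution_def, convolution_def]
      rfl
    simp only [h1]
    exact ContDiffBump.convolution_tendsto_right_of_continuous hφ0
      (hg1.continuous_fderiv one_ne_zero) y

end Convolution

/-! ### Regularization on coordinate patches -/

section Regularization

variable {E : Type*} [NormedAddCommGroup E] [NormedSpace ℂ E]
variable {X : Type*} [TopologicalSpace X] [ChartedSpace E X]

namespace Cover

/-- The domain where functions are regularized. -/
def U (𝒦 : Cover E X) (i : ℕ) : Set X :=
  (𝒦.e i).source ∩ 𝒦.e i ⁻¹' ball (𝒦.c i) (5 / 2 * 𝒦.r i)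

/-- The open set which contains the support of the function `χ i`. -/
def W (𝒦 : Cover E X) (i : ℕ) : Set X := (𝒦.e i).source ∩ 𝒦.e i ⁻¹' 𝒦.B i

variable (𝒦 : Cover E X) (i : ℕ)

theorem isOpen_U : IsOpen (𝒦.U i) := (𝒦.e i).isOpen_inter_preimage isOpen_ball

theorem isOpen_W : IsOpen (𝒦.W i) := (𝒦.e i).isOpen_inter_preimage isOpen_ball

theorem W_subset_U : 𝒦.W i ⊆ 𝒦.U i := inter_subset_inter_right _
  (preimage_mono (ball_subset_ball (by linarith [𝒦.r_pos i])))

theorem tsupport_subset_W : tsupport (𝒦.χ i) ⊆ 𝒦.W i := 𝒦.tsupport_subset i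

/-- `W` and `U` are balls of radii `r` and `5 r / 2` in the chart; a bump function with radii `r`
and `2 r` fits between them. -/
theorem exists_cutoff [FiniteDimensional ℂ E] [T2Space X] [IsManifold 𝓘(ℂ, E) ω X] :
    ∃ θ : X → ℝ, IsRTest E θ ∧ tsupport θ ⊆ 𝒦.U i ∧ (∀ x, 0 ≤ θ x ∧ θ x ≤ 1) ∧
      ∀ x ∈ 𝒦.W i, θ x = 1 := by
  have hr := 𝒦.r_pos i
  let η : ContDiffBump (𝒦.c i) := ⟨𝒦.r i, 2 * 𝒦.r i, by linarith, by linarith⟩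
  have hs : tsupport η ⊆ (𝒦.e i).target := by
    rw [η.tsupport_eq]
    exact 𝒦.closedBall_subset_target i (by simp only [η]; linarith)
  refine ⟨lift (𝒦.e i) η, isRTest_lift (chart_mem_atlas E _) η.contDiff η.hasCompactSupport hs,
    (tsupport_lift η.hasCompactSupport hs).2.trans ?_, fun x => ?_, fun x hx => ?_⟩
  · rintro _ ⟨z, hz, rfl⟩
    refine ⟨(𝒦.e i).map_target (hs hz), ?_⟩
    rw [mem_preimage, (𝒦.e i).right_inv (hs hz)]
    rw [η.tsupport_eq] at hz
    exact closedBall_subset_ball (by simp only [η]; linarith) hz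
  · by_cases hx : x ∈ (𝒦.e i).source
    · rw [lift_of_mem hx]; exact ⟨η.nonneg, η.le_one⟩
    · rw [lift_of_notMem hx]; norm_num
  · rw [lift_of_mem hx.1]
    exact η.one_of_mem_closedBall (ball_subset_closedBall hx.2)

end Cover

theorem contDiff_mul_of_tsupport {n : WithTop ℕ∞} {η f : E → ℝ} (hη : ContDiff ℝ n η) {s : Set E}
    (hs : IsOpen s) (hηs : tsupport η ⊆ s) (hf : ContDiffOn ℝ n f s) :
    ContDiff ℝ n (fun y => η y * f y) := by
  refine contDiff_iff_contDiffAt.2 fun y => ?_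
  by_cases hy : y ∈ s
  · exact hη.contDiffAt.mul (hf.contDiffAt (hs.mem_nhds hy))
  · have h0 : η =ᶠ[𝓝 y] fun _ => 0 := notMem_tsupport_iff_eventuallyEq.1 fun h => hy (hηs h)
    refine (contDiffAt_const (c := (0 : ℝ))).congr_of_eventuallyEq ?_
    filter_upwards [h0] with x hx
    simp [hx]

theorem contDiffOn_one_comp_symm [IsManifold 𝓘(ℂ, E) ω X] {v : X → ℝ}
    (hv : ContMDiff 𝓘(ℝ, E) 𝓘(ℝ, ℝ) 1 v) {e : OpenPartialHomeomorph X E} (he : e ∈ atlas E X) :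
    ContDiffOn ℝ 1 (v ∘ e.symm) e.target := by
  have := isManifold_real E X
  have : IsManifold 𝓘(ℝ, E) 1 X := .of_le (n := ∞) (by simp)
  rw [← contMDiffOn_iff_contDiffOn]
  exact hv.comp_contMDiffOn (contMDiffOn_symm_of_mem_maximalAtlas
    (IsManifold.subset_maximalAtlas he))

theorem iddbar_inChart_comp [IsManifold 𝓘(ℂ, E) ω X] {e : OpenPartialHomeomorph X E}
    (he : e ∈ atlas E X) {g : E → ℝ} (hg : ContDiff ℝ ∞ g) {z : E} (hz : z ∈ e.target) :
    TwoForm.inChart (ddc fun x => g (e x)) e z = iddbarFlat (fun y => (g y : ℂ)) z := by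
  have h : ContMDiffOn 𝓘(ℝ, E) 𝓘(ℝ, ℝ) ∞ (fun x => g (e x)) e.source := by
    simpa using contMDiffOn_comp_chart (X := X) he (V := univ) hg.contDiffOn
  have h1 := iddbar_inChart e.open_source (contMDiffOn_ofReal h) he hz (e.map_target hz)
  refine h1.trans (iddbarFlat_congr ?_)
  filter_upwards [e.open_target.mem_nhds hz] with y hy
  simp [e.right_inv hy]

/-- Continuous plurisubharmonic functions are locally uniform limits of smooth ones. -/
theorem exists_regularization [FiniteDimensional ℂ E] [IsManifold 𝓘(ℂ, E) ω X]
    (𝒦 : Cover E X) (i : ℕ) {v : X → ℝ} (hv : IsPshZero E v) :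
    ∃ z : ℕ → X → ℝ, (∀ n, IsSmoothPshOn E (z n) (𝒦.U i)) ∧
      TendstoUniformlyOn z v atTop (𝒦.U i) ∧
      (ContMDiff 𝓘(ℝ, E) 𝓘(ℝ, ℝ) 1 v → ∀ y ∈ 𝒦.B i, Tendsto
        (fun n => fderiv ℝ (z n ∘ (𝒦.e i).symm) y) atTop (𝓝 (fderiv ℝ (v ∘ (𝒦.e i).symm) y))) := by
  borelize E
  set e := 𝒦.e i with he_def
  have he : e ∈ atlas E X := chart_mem_atlas E _
  have hr := 𝒦.r_pos i
  let η : ContDiffBump (𝒦.c i) := ⟨11 / 4 * 𝒦.r i, 3 * 𝒦.r i, by linarith, by linarith⟩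
  have hηs : tsupport η ⊆ e.target := by
    rw [η.tsupport_eq]; exact 𝒦.closedBall_subset i
  have hcont : ContinuousOn (v ∘ e.symm) e.target :=
    hv.continuous.comp_continuousOn e.continuousOn_symm
  set g : E → ℝ := fun y => η y * (v ∘ e.symm) y with hg
  have hgc : Continuous g := contDiff_zero.1 (contDiff_mul_of_tsupport (η.contDiff (n := 0))
    e.open_target hηs (contDiffOn_zero.2 hcont))
  have hgs : HasCompactSupport g := η.hasCompactSupport.mul_right
  have hgv : ∀ y ∈ closedBall (𝒦.c i) (11 / 4 * 𝒦.r i), g y = v (e.symm y) := by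
    intro y hy
    have : η y = 1 := η.one_of_mem_closedBall hy
    rw [hg]; simp [this]
  have htar : closedBall (𝒦.c i) (11 / 4 * 𝒦.r i) ⊆ e.target :=
    𝒦.closedBall_subset_target i (by linarith)
  have hIM : IsManifold 𝓘(ℂ, E) 1 X := .of_le (n := ω) le_top
  -- Discs are taken with parameter in `|ζ| < 2`, to be holomorphic beyond the closed unit disc. A
  -- translation by `r / 16` and such a disc with `‖a‖ ≤ r / 16` move a point of the ball of radius
  -- `5 r / 2` by at most `3 r / 16`, hence within the ball of radius `11 r / 4` where `g` agrees
  -- with `v`.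
  obtain ⟨z, hz1, hz2, hz3, hz4⟩ := exists_smooth_approx hgc hgs
    (V := ball (𝒦.c i) (5 / 2 * 𝒦.r i)) (δ := 𝒦.r i / 16) (by linarith) (by
      intro y hy t a ht ha
      have hmem : ∀ ζ : ℂ, ‖ζ‖ ≤ 2 → y - t + ζ • a ∈ closedBall (𝒦.c i) (11 / 4 * 𝒦.r i) := by
        intro ζ hζ
        rw [mem_closedBall, dist_eq_norm]
        rw [mem_ball, dist_eq_norm] at hy
        have h1 : ‖ζ • a‖ ≤ 2 * (𝒦.r i / 16) := by
          rw [norm_smul]; gcongr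
        have h2 : y - t + ζ • a - 𝒦.c i = (y - 𝒦.c i) - t + ζ • a := by abel
        rw [h2]
        have h3 := norm_add_le ((y - 𝒦.c i) - t) (ζ • a)
        have h4 := norm_sub_le (y - 𝒦.c i) t
        linarith
      have hd : MDifferentiableOn 𝓘(ℂ, ℂ) 𝓘(ℂ, E) (fun ζ : ℂ => e.symm (y - t + ζ • a))
          (ball 0 2) := by
        have h1 : MDifferentiableOn 𝓘(ℂ, E) 𝓘(ℂ, E) e.symm e.target := mdifferentiableOn_atlas_symm he
        have h2 : Differentiable ℂ (fun ζ : ℂ => y - t + ζ • a) := by fun_prop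
        exact h1.comp h2.mdifferentiable.mdifferentiableOn fun ζ hζ => htar (hmem ζ (by
          rw [mem_ball_zero_iff] at hζ; exact hζ.le))
      have hs := hv.submean _ 2 (by norm_num) hd
      rw [zero_smul, add_zero] at hs
      have h0 := hmem 0 (by simp)
      rw [zero_smul, add_zero] at h0
      rw [hgv _ h0]
      refine hs.trans_eq (Real.circleAverage_congr_sphere fun ζ hζ => ?_)
      refine (hgv _ (hmem ζ ?_)).symm
      rw [abs_one, mem_sphere_zero_iff_norm] at hζ
      rw [hζ]; norm_num)
  refine ⟨fun n x => z n (e x), fun n => ⟨?_, fun x hx => ?_⟩, ?_, fun hv1 y hy => ?_⟩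
  · have h1 := contMDiffOn_comp_chart (X := X) he (V := univ) (hz1 n).contDiffOn
    exact h1.mono fun x hx => ⟨hx.1, trivial⟩
  · have h1 : PosForm (TwoForm.inChart (ddc fun x => z n (e x)) e (e x)) := by
      rw [iddbar_inChart_comp he (hz1 n) (e.map_source hx.1)]
      exact hz3 n _ hx.2
    exact posForm_of_inChart he hx.1 h1
  · rw [Metric.tendstoUniformlyOn_iff]
    intro ε hε
    filter_upwards [Metric.tendstoUniformly_iff.1 hz2 ε hε] with n hn x hx
    have h1 := hn (e x)
    rwa [hgv _ (ball_subset_closedBall (ball_subset_ball (by linarith) hx.2)),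
      e.left_inv hx.1] at h1
  · have hg1 : ContDiff ℝ 1 g := contDiff_mul_of_tsupport η.contDiff e.open_target hηs
      (contDiffOn_one_comp_symm hv1 he)
    have hyt : y ∈ e.target := 𝒦.B_subset_target i hy
    have h1 : fderiv ℝ g y = fderiv ℝ (v ∘ e.symm) y := by
      refine Filter.EventuallyEq.fderiv_eq ?_
      filter_upwards [isOpen_ball.mem_nhds hy] with x hx
      exact hgv x (ball_subset_closedBall (ball_subset_ball (by linarith) hx))
    have h2 : ∀ n, fderiv ℝ ((fun x => z n (e x)) ∘ e.symm) y = fderiv ℝ (z n) y := by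
      intro n
      refine Filter.EventuallyEq.fderiv_eq ?_
      filter_upwards [e.open_target.mem_nhds hyt] with x hx
      simp [e.right_inv hx]
    rw [← h1]
    simp only [h2]
    exact hz4 hg1 y

theorem exists_isRTest_one [FiniteDimensional ℂ E] [T2Space X] [SecondCountableTopology X]
    [IsManifold 𝓘(ℂ, E) ω X] {K U : Set X} (hK : IsCompact K) (hU : IsOpen U) (hKU : K ⊆ U) :
    ∃ ψ : X → ℝ, IsRTest E ψ ∧ tsupport ψ ⊆ U ∧ (∀ x, 0 ≤ ψ x ∧ ψ x ≤ 1) ∧ ∀ x ∈ K, ψ x = 1 := by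
  have := isManifold_real E X
  have : LocallyCompactSpace X := ChartedSpace.locallyCompactSpace E X
  obtain ⟨L, hL, hKL, hLU⟩ := exists_compact_between hK hU hKU
  obtain ⟨ψ, h1, h2, h3, h4⟩ := exists_contMDiff_support_eq_eq_one_iff (n := ⊤) 𝓘(ℝ, E)
    isOpen_interior hK.isClosed hKL
  have hs : tsupport ψ ⊆ L := closure_minimal (h3.subset.trans interior_subset) hL.isClosed
  exact ⟨ψ, ⟨h1, hL.of_isClosed_subset (isClosed_tsupport _) hs⟩, hs.trans hLU,
    fun x => h2 ⟨x, rfl⟩, fun x hx => (h4 x).1 hx⟩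

end Regularization

/-! ### Separability of the space of test forms -/

section Density

variable {E : Type*} [NormedAddCommGroup E] [NormedSpace ℂ E] [FiniteDimensional ℂ E]
variable {X : Type*} [TopologicalSpace X] [ChartedSpace E X] [T2Space X] [SecondCountableTopology X]
variable [MeasurableSpace E] [BorelSpace E]

/-- Test forms are determined by countably many of them. -/
theorem exists_countable_dense_forms (𝒦 : Cover E X) (S : Set (TwoForm E X))
    (hS : S ⊆ testForms E X) : ∃ D ⊆ S, D.Countable ∧
      ∀ (τ : Density 𝒦) (σ : Measure (ℕ × E)) [IsFiniteMeasure σ],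
        (∀ α ∈ D, ∫ o, τ.evalField (Density.field 𝒦 α) o ∂σ = 0) →
          ∀ α ∈ S, ∫ o, τ.evalField (Density.field 𝒦 α) o ∂σ = 0 := by
  have := FiniteDimensional.proper ℝ E
  have : LocallyCompactSpace X := ChartedSpace.locallyCompactSpace E X
  let K := CompactExhaustion.choice X
  have hcl : ∀ i, closedBall (𝒦.c i) (𝒦.r i) ⊆ (𝒦.e i).target := fun i =>
    𝒦.closedBall_subset_target i (by linarith [𝒦.r_pos i])
  have hcomp : ∀ i, CompactSpace (closedBall (𝒦.c i) (𝒦.r i)) := fun i =>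
    isCompact_iff_compactSpace.1 (isCompact_closedBall _ _)
  have key : ∀ n, ∃ D ⊆ {α ∈ S | tsupport α ⊆ K n}, D.Countable ∧
      ∀ (τ : Density 𝒦) (σ : Measure (ℕ × E)) [IsFiniteMeasure σ],
        (∀ α ∈ D, ∫ o, τ.evalField (Density.field 𝒦 α) o ∂σ = 0) →
          ∀ α ∈ {α ∈ S | tsupport α ⊆ K n},
            ∫ o, τ.evalField (Density.field 𝒦 α) o ∂σ = 0 := by
    intro n
    set A : Set (TwoForm E X) := {α ∈ S | tsupport α ⊆ K n} with hA
    let Φ : A → ∀ i, C(closedBall (𝒦.c i) (𝒦.r i), Alt2 E) := fun α i =>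
      ⟨fun z => Density.field 𝒦 α.1 i z.1,
        ((Density.continuousOn_field (hS α.2.1) i).mono (hcl i)).domRestrict⟩
    -- The topology is that of uniform convergence on the coordinate balls. It is induced from a
    -- countable product of spaces `C(K, Alt2 E)` with `K` compact, hence second countable, and
    -- every functional given by a density is continuous for it. So the countable set can be chosen
    -- before `τ` and `σ`.
    let _ : TopologicalSpace A := TopologicalSpace.induced Φ inferInstance
    have : SecondCountableTopology A :=
      TopologicalSpace.secondCountableTopology_induced A _ Φ
    obtain ⟨D, hD, hDd⟩ := TopologicalSpace.exists_countable_dense A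
    refine ⟨Subtype.val '' D, ?_, hD.image _, fun τ σ _ h α hα => ?_⟩
    · rintro _ ⟨α, _, rfl⟩
      exact α.2
    have hc : Continuous fun α : A => ∫ o, τ.evalField (Density.field 𝒦 α.1) o ∂σ := by
      refine continuous_iff_continuousAt.2 fun β => ?_
      refine τ.tendsto_integral (fun α => hS α.2.1) (hS β.2.1) (K.isCompact n) (fun α => α.2.2)
        β.2.2 fun i => ?_
      have h1 : Tendsto (fun α => Φ α i) (𝓝 β) (𝓝 (Φ β i)) :=
        ((continuous_apply i).comp continuous_induced_dom).tendsto β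
      rw [ContinuousMap.tendsto_iff_tendstoUniformly] at h1
      exact tendstoUniformlyOn_iff_tendstoUniformly_comp_coe.2 h1
    have hz : IsClosed {α : A | ∫ o, τ.evalField (Density.field 𝒦 α.1) o ∂σ = 0} :=
      isClosed_eq hc continuous_const
    have : (⟨α, hα⟩ : A) ∈ {α : A | ∫ o, τ.evalField (Density.field 𝒦 α.1) o ∂σ = 0} :=
      closure_minimal (fun β hβ => h β.1 ⟨β, hβ, rfl⟩) hz (hDd _)
    exact this
  choose D hDs hDc hD using key
  refine ⟨⋃ n, D n, iUnion_subset fun n α hα => (hDs n hα).1, countable_iUnion hDc,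
    fun τ σ _ h α hα => ?_⟩
  obtain ⟨n, hn⟩ := K.exists_superset_of_isCompact (hS hα).2.isCompact
  exact hD n τ σ (fun β hβ => h β (mem_iUnion.2 ⟨n, hβ⟩)) α ⟨hα, hn⟩

end Density

/-! ### Levi currents stay closed after multiplication by functions of `u` -/

section Levi

variable {E : Type*} [NormedAddCommGroup E] [NormedSpace ℂ E]
variable {X : Type*} [TopologicalSpace X] [ChartedSpace E X] [IsManifold 𝓘(ℂ, E) ω X]

theorem Current.ev_smulDdbarForm (T : Current E X) {θ : X → ℝ} (hθ : IsRTest E θ) {U : Set X}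
    (hU : IsOpen U) (hθU : tsupport θ ⊆ U) {a : X → ℝ} (ha : IsSmoothPshOn E a U)
    (h : tsupport (fun x => (θ x : ℂ)) ⊆ U) :
    T (smulDdbarForm (fun x => (θ x : ℂ)) a hU ha hθ.ofReal h) =
      T.ev (fun x => θ x • ddc a x) := by
  rw [T.ev_eq (hθ.smul_ddc_mem hU hθU ha.smooth)]
  congr 1

theorem tsupport_ofReal (θ : X → ℝ) : tsupport (fun x => (θ x : ℂ)) = tsupport θ := by
  have : Function.support (fun x => (θ x : ℂ)) = Function.support θ := by
    ext x; simp
  rw [tsupport, this, tsupport]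

theorem Current.IsWedgeDdbar.tendsto_ev {T : Current E X} {v : X → ℝ} (h : T.IsWedgeDdbar v 0)
    {U : Set X} (hU : IsOpen U) {a : ℕ → X → ℝ} (ha : ∀ n, IsSmoothPshOn E (a n) U)
    (hav : TendstoLocallyUniformlyOn a v atTop U) {θ : X → ℝ} (hθ : IsRTest E θ)
    (hθU : tsupport θ ⊆ U) :
    Tendsto (fun n => (T.ev (fun x => θ x • ddc (a n) x)).re) atTop (𝓝 0) := by
  have h' : tsupport (fun x => (θ x : ℂ)) ⊆ U := by rwa [tsupport_ofReal]
  have h1 := h U hU a ha hav _ hθ.ofReal h'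
  have h2 : Tendsto (fun n => T.ev (fun x => θ x • ddc (a n) x)) atTop (𝓝 0) :=
    h1.congr fun n => T.ev_smulDdbarForm hθ hU hθU (ha n) h'
  have h3 := (Complex.continuous_re.tendsto 0).comp h2
  rwa [Complex.zero_re] at h3

theorem Cover.exists_bound [FiniteDimensional ℂ E] (𝒦 : Cover E X) (i : ℕ) {u : X → ℝ}
    (hu : Continuous u) : ∃ C, ∀ x ∈ 𝒦.U i, |u x| ≤ C := by
  have := FiniteDimensional.proper ℝ E
  have h1 : closedBall (𝒦.c i) (5 / 2 * 𝒦.r i) ⊆ (𝒦.e i).target :=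
    𝒦.closedBall_subset_target i (by linarith [𝒦.r_pos i])
  obtain ⟨C, hC⟩ := (isCompact_closedBall (𝒦.c i) (5 / 2 * 𝒦.r i)).exists_bound_of_continuousOn
    (hu.comp_continuousOn ((𝒦.e i).continuousOn_symm.mono h1))
  refine ⟨C, fun x hx => ?_⟩
  have := hC _ (ball_subset_closedBall hx.2)
  rwa [Function.comp_apply, (𝒦.e i).left_inv hx.1] at this

/-- Regularizations `a n` of `u` for which `T ∧ i∂∂̄(a n)` and `T ∧ i∂(a n)∧∂̄(a n)` tend to
zero. -/
theorem Current.IsLevi.exists_regularization [FiniteDimensional ℂ E]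
    {T : Current E X} (hT : T.IsLevi) (𝒦 : Cover E X) (i : ℕ) {u : X → ℝ} (hu : IsPshZero E u)
    {θ : X → ℝ} (hθ : IsRTest E θ) (hθU : tsupport θ ⊆ 𝒦.U i) (hθ0 : ∀ x, 0 ≤ θ x) :
    ∃ a : ℕ → X → ℝ, (∀ n, IsSmoothPshOn E (a n) (𝒦.U i)) ∧
      TendstoUniformlyOn a u atTop (𝒦.U i) ∧
      Tendsto (fun n => (T.ev (fun x => θ x • ddc (a n) x)).re) atTop (𝓝 0) ∧
      Tendsto (fun n => (T.ev (fun x => θ x • gamForm E (a n) (a n) x)).re) atTop (𝓝 0) ∧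
      (ContMDiff 𝓘(ℝ, E) 𝓘(ℝ, ℝ) 1 u → ∀ y ∈ 𝒦.B i, Tendsto
        (fun n => fderiv ℝ (a n ∘ (𝒦.e i).symm) y) atTop (𝓝 (fderiv ℝ (u ∘ (𝒦.e i).symm) y))) := by
  obtain ⟨a, ha1, ha2, ha3⟩ := LeviCurrents.exists_regularization 𝒦 i hu
  have hU := 𝒦.isOpen_U i
  obtain ⟨C, hC⟩ := 𝒦.exists_bound i hu.continuous
  have hbd : ∀ᶠ n in atTop, ∀ x ∈ 𝒦.U i, a n x ∈ Icc (-(C + 1)) (C + 1) := by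
    filter_upwards [Metric.tendstoUniformlyOn_iff.1 ha2 1 one_pos] with n hn x hx
    have h1 := hn x hx
    rw [Real.dist_eq] at h1
    have h2 := abs_le.1 (hC x hx)
    have h3 := abs_lt.1 h1
    constructor <;> linarith [h2.1, h2.2, h3.1, h3.2]
  have hexp : TendstoUniformlyOn (fun n x => Real.exp (a n x)) (fun x => Real.exp (u x)) atTop
      (𝒦.U i) := by
    refine UniformContinuousOn.comp_tendstoUniformlyOn_eventually (g := Real.exp)
      (s := Icc (-(C + 1)) (C + 1)) hbd (fun x hx => ?_)
      (isCompact_Icc.uniformContinuousOn_of_continuous Real.continuous_exp.continuousOn) ha2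
    have h2 := abs_le.1 (hC x hx)
    constructor <;> linarith [h2.1, h2.2]
  have hw1 := (hT.wedge_eq_zero u hu).tendsto_ev hU ha1 ha2.tendstoLocallyUniformlyOn hθ hθU
  -- The Levi condition for `e^u`, with the approximations `e^{a n}`. As the `a n` are eventually
  -- bounded below on `U`, it controls `i∂(a n)∧∂̄(a n)` by `ev_gamForm_le`.
  have hw2 := (hT.wedge_eq_zero _ hu.exp).tendsto_ev hU (fun n => (ha1 n).exp hU)
    hexp.tendstoLocallyUniformlyOn hθ hθU
  refine ⟨a, ha1, ha2, hw1, ?_, ha3⟩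
  have hm : 0 < Real.exp (-(C + 1)) := Real.exp_pos _
  have hw3 := hw2.const_mul (Real.exp (-(C + 1)))⁻¹
  rw [mul_zero] at hw3
  refine tendsto_of_tendsto_of_tendsto_of_le_of_le' tendsto_const_nhds hw3
    (Eventually.of_forall fun n => ?_) ?_
  · refine hT.pos.ev_nonneg (hθ.smul_gamForm_mem hU hθU (ha1 n).smooth) fun x => ?_
    exact (posForm_gam _).smul (hθ0 x)
  · filter_upwards [hbd] with n hn
    have h1 := ev_gamForm_le hT.pos hU hθ hθU hθ0 (ha1 n) (m := Real.exp (-(C + 1)))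
      fun x hx => Real.exp_le_exp.2 (hn x (hθU hx)).1
    rw [inv_mul_eq_div, le_div_iff₀ hm]
    linarith

theorem Current.IsLevi.ev_ddc {T : Current E X} (hT : T.IsLevi) {φ : X → ℝ} (hφ : IsRTest E φ) :
    T.ev (ddc φ) = 0 := by
  rw [T.ev_eq hφ.ddc_mem]
  exact hT.ddbar_closed _ hφ.ofReal

theorem smoothAt_sum {κ : Type*} (s : Finset κ) {f : κ → X → ℝ} {x : X}
    (hf : ∀ k ∈ s, SmoothAt E (f k) x) : SmoothAt E (fun y => ∑ k ∈ s, f k y) x := by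
  classical
  induction s using Finset.induction_on with
  | empty => simpa using contMDiffAt_const
  | insert a s ha ih =>
    simp only [Finset.sum_insert ha]
    exact (hf a (Finset.mem_insert_self a s)).add
      (ih fun k hk => hf k (Finset.mem_insert_of_mem hk))

theorem ddc_sum {κ : Type*} (s : Finset κ) {f : κ → X → ℝ} {x : X}
    (hf : ∀ k ∈ s, SmoothAt E (f k) x) :
    (ddc (fun y => ∑ k ∈ s, f k y) x : Alt2 E) = ∑ k ∈ s, ddc (f k) x := by
  classical
  induction s using Finset.induction_on with
  | empty => simpa using ddc_const 0 x
  | insert a s ha ih =>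
    simp only [Finset.sum_insert ha]
    rw [← ih fun k hk => hf k (Finset.mem_insert_of_mem hk)]
    exact ddc_add (hf a (Finset.mem_insert_self a s))
      (smoothAt_sum s fun k hk => hf k (Finset.mem_insert_of_mem hk))

/-- Decomposition of a test function along a cover. -/
theorem Cover.isRTest_mul (𝒦 : Cover E X) (i : ℕ) {φ : X → ℝ} (hφ : IsRTest E φ) :
    IsRTest E (fun x => φ x * 𝒦.χ i x) ∧ tsupport (fun x => φ x * 𝒦.χ i x) ⊆ 𝒦.W i :=
  ⟨hφ.mul isOpen_univ (subset_univ _) (𝒦.χ i).contMDiff.contMDiffOn,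
    (tsupport_mul_subset_right (f := φ) (g := 𝒦.χ i)).trans (𝒦.tsupport_subset_W i)⟩

theorem Cover.eq_sum (𝒦 : Cover E X) {K : Set X} (hK : IsCompact K) {F : Type*} [AddCommGroup F]
    [Module ℝ F] {φ : X → F} (hφK : ∀ x ∉ K, φ x = 0) (x : X) :
    φ x = ∑ i ∈ (𝒦.finite_meeting hK).toFinset, 𝒦.χ i x • φ x := by
  rw [← Finset.sum_smul]
  by_cases hx : x ∈ K
  · have h1 := 𝒦.χ.sum_eq_one (mem_univ x)
    rw [finsum_eq_sum_of_support_subset (s := (𝒦.finite_meeting hK).toFinset)] at h1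
    · rw [h1, one_smul]
    · intro i hi
      rw [Finite.coe_toFinset]
      exact ⟨x, subset_tsupport _ hi, hx⟩
  · rw [hφK x hx, smul_zero]

theorem PosForm.pcoef_im_of_real [FiniteDimensional ℂ E] {ξ : Alt2 E}
    (h : ∀ v w, (ξ ![v, w]).im = 0) (p : PIdx E) :
    (pcoef p ξ).im = 0 := by
  obtain ⟨⟨j, k⟩, q⟩ := p
  have h1 : (pr11 ξ ![bas E j, bas E k]).im = 0 := by
    rw [pr11_apply, Complex.mul_im, Complex.add_im, h, h]
    norm_num
  rw [pcoef, Complex.mul_im, h1]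
  have : (![-1 / 2, 1 / 2, 1 / 2] q : ℂ).im = 0 := by
    fin_cases q <;> norm_num
  rw [this]
  simp

theorem Density.evalField_ddc_im [FiniteDimensional ℂ E] [MeasurableSpace E] {𝒦 : Cover E X}
    (τ : Density 𝒦) {φ : X → ℝ} (hφ : IsRTest E φ) (o : ℕ × E) :
    (τ.evalField (Density.field 𝒦 (ddc φ)) o).im = 0 := by
  rw [evalField, val, Complex.im_sum]
  refine Finset.sum_eq_zero fun p _ => ?_
  rw [Complex.im_ofReal_mul, PosForm.pcoef_im_of_real (fun v w => ?_), mul_zero]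
  rw [field, inChart_apply, ddc_apply (hφ.smooth _)]
  exact Complex.ofReal_im _

variable [FiniteDimensional ℂ E] [MeasurableSpace E] [BorelSpace E]

theorem Density.evalField_real_smul {𝒦 : Cover E X} (τ : Density 𝒦) (g : X → ℝ) (α : TwoForm E X)
    (o : ℕ × E) : τ.evalField (Density.field 𝒦 (fun x => g x • α x)) o =
      g ((𝒦.e o.1).symm o.2) * τ.evalField (Density.field 𝒦 α) o := by
  have : Density.field 𝒦 (fun x => g x • α x) o.1 o.2 =
      g ((𝒦.e o.1).symm o.2) • Density.field 𝒦 α o.1 o.2 :=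
    Alt2.ext' fun v w => by
      rw [ContinuousAlternatingMap.smul_apply, field, field, inChart_apply, inChart_apply,
        ContinuousAlternatingMap.smul_apply]
  rw [evalField, this, val_real_smul, evalField]

/-- The value of a function at a point of a chart. -/
def Cover.pull (𝒦 : Cover E X) (u : X → ℝ) (o : ℕ × E) : ℝ :=
  (𝒦.B o.1).indicator (fun z => u ((𝒦.e o.1).symm z)) o.2

theorem Cover.measurable_pull [T2Space X] (𝒦 : Cover E X) {u : X → ℝ} (hu : Continuous u) :
    Measurable (𝒦.pull u) :=
  measurable_from_prod_countable_right fun i => measurable_indicator_chart 𝒦 i hu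

theorem Density.evalField_eq_zero {𝒦 : Cover E X} (τ : Density 𝒦) {o : ℕ × E} (ho : o.2 ∉ 𝒦.B o.1)
    (F : ℕ → E → Alt2 E) : τ.evalField F o = 0 :=
  τ.val_eq_zero (fun h => ho h.1) _

variable [T2Space X]

/-- Replace `u` by its regularizations `a n` and apply `ev_comp_ddc_le`. For fixed `t` the terms
with `i∂∂̄(a n)` and `i∂(a n)∧∂̄(a n)` tend to zero with `n`; the remaining bound `M t⁻¹ T(i∂φ∧∂̄φ)`
then tends to zero as `t → ∞`. The order of the limits matters, since the middle coefficient grows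
with `t`. -/
theorem Density.integral_comp_mul_le {T : Current E X} (hT : T.IsLevi) {𝒦 : Cover E X}
    (τ : Density 𝒦) {σ : Measure (ℕ × E)} [IsFiniteMeasure σ]
    (hτ : ∀ α ∈ testForms E X, T.ev α = ∫ o, τ.evalField (Density.field 𝒦 α) o ∂σ)
    {u : X → ℝ} (hu : IsPshZero E u) {h : ℝ → ℝ} (hh : ContDiff ℝ ∞ h) (hhc : HasCompactSupport h)
    (i : ℕ) {φ : X → ℝ} (hφ : IsRTest E φ) (hφW : tsupport φ ⊆ 𝒦.W i) :
    (∫ o, (h (𝒦.pull u o) : ℂ) * τ.evalField (Density.field 𝒦 (ddc φ)) o ∂σ).re ≤ 0 := by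
  obtain ⟨θ, hθ, hθU, hθ01, hθ1⟩ := 𝒦.exists_cutoff i
  have hU := 𝒦.isOpen_U i
  obtain ⟨a, ha, hau, hw1, hw2, -⟩ := hT.exists_regularization 𝒦 i hu hθ hθU fun x => (hθ01 x).1
  have hφU : tsupport φ ⊆ 𝒦.U i := hφW.trans (𝒦.W_subset_U i)
  have hd1 : ContDiff ℝ ∞ (deriv h) := by
    have := (contDiff_infty_iff_deriv (f := h)).1 hh
    exact this.2
  obtain ⟨M₀, hM₀⟩ := hhc.exists_bound_of_continuous hh.continuous
  obtain ⟨M₁, hM₁⟩ := hhc.deriv.exists_bound_of_continuous hd1.continuous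
  obtain ⟨M₂, hM₂⟩ := hhc.deriv.deriv.exists_bound_of_continuous
    (hd1.continuous_deriv (by simp))
  obtain ⟨N, hN⟩ := hφ.compact.exists_bound_of_continuous hφ.smooth.continuous
  set M := max M₁ M₂
  have hha : ∀ n, ContMDiffOn 𝓘(ℝ, E) 𝓘(ℝ, ℝ) ∞ (fun x => h (a n x)) (𝒦.U i) := fun n =>
    (hh.contMDiff (n := ∞)).comp_contMDiffOn (ha n).smooth
  have hmem : ∀ n, (fun x => h (a n x) • ddc φ x : TwoForm E X) ∈ testForms E X := fun n =>
    hφ.form_mem hU hφU ((smoothFormOn_of_mem hφ.ddc_mem (𝒦.U i)).real_smul (hha n)) fun x hx => by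
      rw [ddc_eq_zero hx, Alt2.rsmul_zero]
  have hint := τ.integrable_form hφ.ddc_mem σ
  have hlim : Tendsto (fun n => (T.ev (fun x => h (a n x) • ddc φ x)).re) atTop
      (𝓝 (∫ o, (h (𝒦.pull u o) : ℂ) * τ.evalField (Density.field 𝒦 (ddc φ)) o ∂σ).re) := by
    refine (Complex.continuous_re.tendsto _).comp ?_
    simp only [fun n => hτ _ (hmem n)]
    refine tendsto_integral_of_dominated_convergence
      (fun o => M₀ * ‖τ.evalField (Density.field 𝒦 (ddc φ)) o‖)
      (fun n => (τ.measurable_evalField_form (hmem n)).aestronglyMeasurable)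
      (hint.norm.const_mul M₀) (fun n => Eventually.of_forall fun o => ?_)
      (Eventually.of_forall fun o => ?_)
    · rw [τ.evalField_real_smul, norm_mul, Complex.norm_real]
      gcongr
      exact hM₀ _
    · simp only [τ.evalField_real_smul]
      by_cases ho : o.2 ∈ 𝒦.B o.1
      · by_cases hx : (𝒦.e o.1).symm o.2 ∈ tsupport φ
        · have h1 : 𝒦.pull u o = u ((𝒦.e o.1).symm o.2) := indicator_of_mem ho _
          rw [h1]
          refine Tendsto.mul_const _ ?_
          have h2 := hau.tendsto_at (hφU hx)
          exact (Complex.continuous_ofReal.tendsto _).comp ((hh.continuous.tendsto _).comp h2)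
        · have h0 : τ.evalField (Density.field 𝒦 (ddc φ)) o = 0 := by
            rw [evalField, field_eq_zero (ddc_eq_zero hx), val_zero]
          simp only [h0, mul_zero]
          exact tendsto_const_nhds
      · simp only [τ.evalField_eq_zero ho, mul_zero]
        exact tendsto_const_nhds
  have hbound : ∀ t : ℝ, 0 < t →
      (∫ o, (h (𝒦.pull u o) : ℂ) * τ.evalField (Density.field 𝒦 (ddc φ)) o ∂σ).re ≤
        M * t⁻¹ * (T.ev (gamForm E φ φ)).re := by
    intro t ht
    have h1 := ((hw1.const_mul (N * M)).add (hw2.const_mul (N * M + M * t))).add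
      (tendsto_const_nhds (x := M * t⁻¹ * (T.ev (gamForm E φ φ)).re))
    rw [mul_zero, mul_zero, add_zero, zero_add] at h1
    refine le_of_tendsto_of_tendsto' hlim h1 fun n => ?_
    refine ev_comp_ddc_le hT.pos (fun φ hφ => by rw [hT.ev_ddc hφ, Complex.zero_re]) hU hθ hθU
      (fun x => (hθ01 x).1) hφ hφU (fun x hx => hθ1 x (hφW hx)) (ha n) hh
      (fun s => (hM₁ s).trans (le_max_left _ _)) (fun s => (hM₂ s).trans (le_max_right _ _)) hN ht
  have h2 : Tendsto (fun t : ℝ => M * t⁻¹ * (T.ev (gamForm E φ φ)).re) atTop (𝓝 0) := by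
    have := (tendsto_inv_atTop_zero (𝕜 := ℝ)).const_mul M |>.mul_const (T.ev (gamForm E φ φ)).re
    simpa using this
  exact ge_of_tendsto h2 ((eventually_gt_atTop 0).mono hbound)

/-- `T` remains closed when it is multiplied by functions of `u`. -/
theorem Density.integral_comp_mul_eq_zero {T : Current E X} (hT : T.IsLevi) {𝒦 : Cover E X}
    (τ : Density 𝒦) {σ : Measure (ℕ × E)} [IsFiniteMeasure σ]
    (hτ : ∀ α ∈ testForms E X, T.ev α = ∫ o, τ.evalField (Density.field 𝒦 α) o ∂σ)
    {u : X → ℝ} (hu : IsPshZero E u) {h : ℝ → ℝ} (hh : ContDiff ℝ ∞ h) (hhc : HasCompactSupport h)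
    {φ : X → ℝ} (hφ : IsRTest E φ) :
    ∫ o, (h (𝒦.pull u o) : ℂ) * τ.evalField (Density.field 𝒦 (ddc φ)) o ∂σ = 0 := by
  obtain ⟨M₀, hM₀⟩ := hhc.exists_bound_of_continuous hh.continuous
  have hint : ∀ {φ : X → ℝ}, IsRTest E φ → Integrable
      (fun o => (h (𝒦.pull u o) : ℂ) * τ.evalField (Density.field 𝒦 (ddc φ)) o) σ := by
    intro φ hφ
    refine (τ.integrable_form hφ.ddc_mem σ).bdd_mul (c := M₀) ?_ (Eventually.of_forall fun o => ?_)
    · exact (Complex.measurable_ofReal.comp (hh.continuous.measurable.comp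
        (𝒦.measurable_pull hu.continuous))).aestronglyMeasurable
    · rw [Complex.norm_real]; exact hM₀ _
  have hloc : ∀ i, ∫ o, (h (𝒦.pull u o) : ℂ) *
      τ.evalField (Density.field 𝒦 (ddc fun x => φ x * 𝒦.χ i x)) o ∂σ = 0 := by
    intro i
    obtain ⟨h1, h2⟩ := 𝒦.isRTest_mul i hφ
    refine Complex.ext ?_ ?_
    -- The same inequality applied to `-h` gives the opposite sign.
    · refine le_antisymm (τ.integral_comp_mul_le hT hτ hu hh hhc i h1 h2) ?_
      have h3 := τ.integral_comp_mul_le hT hτ hu hh.neg hhc.neg i h1 h2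
      simp only [Complex.ofReal_neg, neg_mul] at h3
      rw [integral_neg, Complex.neg_re] at h3
      rw [Complex.zero_re]
      linarith
    · rw [← RCLike.im_eq_complex_im, ← integral_im (hint h1), map_zero]
      refine integral_eq_zero_of_ae (Eventually.of_forall fun o => ?_)
      simp only [RCLike.im_eq_complex_im, Complex.im_ofReal_mul, τ.evalField_ddc_im h1, mul_zero,
        Pi.zero_apply]
  have hsum : ∀ o, τ.evalField (Density.field 𝒦 (ddc φ)) o =
      ∑ i ∈ (𝒦.finite_meeting hφ.compact.isCompact).toFinset,
        τ.evalField (Density.field 𝒦 (ddc fun x => φ x * 𝒦.χ i x)) o := by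
    intro o
    have h1 : φ = fun x => ∑ i ∈ (𝒦.finite_meeting hφ.compact.isCompact).toFinset,
        φ x * 𝒦.χ i x := by
      funext x
      have := 𝒦.eq_sum hφ.compact.isCompact (φ := φ)
        (fun x hx => image_eq_zero_of_notMem_tsupport hx) x
      simpa only [smul_eq_mul, mul_comm] using this
    have h2 : (ddc φ ((𝒦.e o.1).symm o.2) : Alt2 E) =
        ∑ i ∈ (𝒦.finite_meeting hφ.compact.isCompact).toFinset,
          ddc (fun x => φ x * 𝒦.χ i x) ((𝒦.e o.1).symm o.2) := by
      conv_lhs => rw [h1]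
      exact ddc_sum _ fun i _ => (𝒦.isRTest_mul i hφ).1.smooth _
    have h3 : Density.field 𝒦 (ddc φ) o.1 o.2 =
        ∑ i ∈ (𝒦.finite_meeting hφ.compact.isCompact).toFinset,
          Density.field 𝒦 (ddc fun x => φ x * 𝒦.χ i x) o.1 o.2 := by
      refine Alt2.ext' fun v w => ?_
      rw [field, inChart_apply, h2, ContinuousAlternatingMap.sum_apply,
        ContinuousAlternatingMap.sum_apply]
      refine Finset.sum_congr rfl fun i _ => ?_
      rw [field, inChart_apply]
    have h4 : ∀ (s : Finset ℕ) (ξ : ℕ → Alt2 E), τ.val o (∑ i ∈ s, ξ i) = ∑ i ∈ s, τ.val o (ξ i) := by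
      intro s ξ
      classical
      induction s using Finset.induction_on with
      | empty => simp [τ.val_zero]
      | insert a s ha ih => rw [Finset.sum_insert ha, Finset.sum_insert ha, τ.val_add, ih]
    rw [evalField, h3, h4]
    rfl
  simp only [hsum, Finset.mul_sum]
  rw [integral_finsetSum _ fun i _ => hint (𝒦.isRTest_mul i hφ).1]
  exact Finset.sum_eq_zero fun i _ => hloc i

end Levi

/-! ### The vanishing of `T ∧ i∂∂̄v` from a single approximation -/

section Wedge

variable {E : Type*} [NormedAddCommGroup E] [NormedSpace ℂ E]
variable {X : Type*} [TopologicalSpace X] [ChartedSpace E X]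

/-- The function `v` has uniform smooth plurisubharmonic approximations `z` on `U` with
small mass `T(θ i∂∂̄z)`. -/
def Current.Annihilates (T : Current E X) (θ : X → ℝ) (U : Set X) (v : X → ℝ) : Prop :=
  ∀ ε > 0, ∃ z : X → ℝ, IsSmoothPshOn E z U ∧ (∀ x ∈ U, |z x - v x| < ε) ∧
    (T.ev (fun x => θ x • ddc z x)).re < ε

/-- The property is closed under uniform limits on `U`, so it needs to be known only for a dense set
of functions. -/
theorem Current.Annihilates.of_approx {T : Current E X} {θ : X → ℝ} {U : Set X} {v : X → ℝ}
    (h : ∀ ε > 0, ∃ v', T.Annihilates θ U v' ∧ ∀ x ∈ U, |v' x - v x| < ε) :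
    T.Annihilates θ U v := by
  intro ε hε
  obtain ⟨v', h1, h2⟩ := h (ε / 2) (by positivity)
  obtain ⟨z, h3, h4, h5⟩ := h1 (ε / 2) (by positivity)
  refine ⟨z, h3, fun x hx => ?_, by linarith⟩
  calc |z x - v x| = |(z x - v' x) + (v' x - v x)| := by ring_nf
    _ ≤ |z x - v' x| + |v' x - v x| := abs_add_le _ _
    _ < ε := by linarith [h4 x hx, h2 x hx]

theorem IsSmoothPshOn.mono {w : X → ℝ} {U V : Set X} (h : IsSmoothPshOn E w U) (hV : V ⊆ U) :
    IsSmoothPshOn E w V :=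
  ⟨h.smooth.mono hV, fun x hx => h.nonneg x (hV hx)⟩

variable [IsManifold 𝓘(ℂ, E) ω X]

/-- Currents for which the masses of `g i∂∂̄ψ` are controlled by the bounds of `g`. -/
def Current.IsOrderZero (T : Current E X) : Prop :=
  ∀ ψ : X → ℝ, IsRTest E ψ → ∃ C, ∀ (U : Set X) (g : X → ℝ), IsOpen U → tsupport ψ ⊆ U →
    ContMDiffOn 𝓘(ℝ, E) 𝓘(ℝ, ℝ) ∞ g U → (∀ x ∈ tsupport ψ, |g x| ≤ 2) →
      |(T.ev (fun x => g x • ddc (fun y => ψ y * ψ y) x)).re| ≤ C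

theorem Density.current_isOrderZero [FiniteDimensional ℂ E] [MeasurableSpace E] [BorelSpace E]
    {𝒦 : Cover E X} (τ : Density 𝒦) (σ : Measure (ℕ × E)) [IsFiniteMeasure σ] :
    (τ.current σ).IsOrderZero := by
  intro ψ hψ
  have hψ2 : IsRTest E (fun y => ψ y * ψ y) := by simpa [pow_two] using hψ.sq
  have hs2 : tsupport (fun y => ψ y * ψ y) ⊆ tsupport ψ := tsupport_mul_subset_left
  have hint := τ.integrable_form hψ2.ddc_mem σ
  refine ⟨∫ o, 2 * ‖τ.evalField (field 𝒦 (ddc fun y => ψ y * ψ y)) o‖ ∂σ,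
    fun U g hU hψU hg hg2 => ?_⟩
  have hmem : (fun x => g x • ddc (fun y => ψ y * ψ y) x : TwoForm E X) ∈ testForms E X :=
    hψ2.form_mem hU (hs2.trans hψU) ((smoothFormOn_of_mem hψ2.ddc_mem U).real_smul hg)
      fun x hx => by rw [ddc_eq_zero hx, Alt2.rsmul_zero]
  rw [τ.current_ev σ hmem]
  refine (Complex.abs_re_le_norm _).trans (norm_integral_le_of_norm_le (hint.norm.const_mul 2)
    (Eventually.of_forall fun o => ?_))
  rw [τ.evalField_real_smul, norm_mul, Complex.norm_real]
  by_cases hx : (𝒦.e o.1).symm o.2 ∈ tsupport ψ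
  · gcongr
    exact hg2 _ hx
  · have h0 : τ.evalField (field 𝒦 (ddc fun y => ψ y * ψ y)) o = 0 := by
      rw [evalField, field_eq_zero (ddc_eq_zero fun h => hx (hs2 h)), val_zero]
    simp [h0]

/-- Compare `w j` with one approximation `z` of `v` of small mass by means of `ev_sq_ddc_le`. After
division by `A`, the mass of `w j` is at most a constant times that of `z`, plus an error of order
`1 / A`. -/
theorem Current.Annihilates.tendsto_sq [FiniteDimensional ℂ E] {T : Current E X}
    (hT : T.IsPositive) (hcl : ∀ φ, IsRTest E φ → (T.ev (ddc φ)).re = 0) (h0 : T.IsOrderZero)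
    {θ : X → ℝ} {V : Set X} {v : X → ℝ} (hV : IsOpen V) (hθ : IsRTest E θ) (hθV : tsupport θ ⊆ V)
    (hθ0 : ∀ x, 0 ≤ θ x) (hv : T.Annihilates θ V v)
    {U : Set X} (hU : IsOpen U) (hUV : U ⊆ V) {ψ : X → ℝ} (hψ : IsRTest E ψ) (hψU : tsupport ψ ⊆ U)
    (hψ01 : ∀ x, 0 ≤ ψ x ∧ ψ x ≤ 1) (hψθ : ∀ x ∈ tsupport ψ, θ x = 1) {w : ℕ → X → ℝ}
    (hw : ∀ j, IsSmoothPshOn E (w j) U) (hwv : TendstoLocallyUniformlyOn w v atTop U) :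
    Tendsto (fun j => (T.ev (fun x => (ψ x * ψ x) • ddc (w j) x)).re) atTop (𝓝 0) := by
  obtain ⟨C, hC⟩ := h0 ψ hψ
  have hψ2 : IsRTest E (fun y => ψ y * ψ y) := by simpa [pow_two] using hψ.sq
  have hs2 : tsupport (fun y => ψ y * ψ y) ⊆ tsupport ψ := tsupport_mul_subset_left
  have hnn : ∀ j, 0 ≤ (T.ev (fun x => (ψ x * ψ x) • ddc (w j) x)).re := by
    intro j
    refine hT.ev_nonneg (hψ2.smul_ddc_mem hU (hs2.trans hψU) (hw j).smooth) fun x => ?_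
    by_cases hx : x ∈ U
    · exact PosForm.smul ((hw j).nonneg x hx) (mul_self_nonneg _)
    · have : ψ x = 0 := image_eq_zero_of_notMem_tsupport fun h => hx (hψU h)
      rw [this, mul_zero, Alt2.zero_rsmul]
      exact posForm_zero
  have hunif : TendstoUniformlyOn w v atTop (tsupport ψ) :=
    (tendstoLocallyUniformlyOn_iff_tendstoUniformlyOn_of_compact hψ.compact.isCompact).1
      (hwv.mono hψU)
  set G := 4 * Real.exp 1 * (T.ev (gamForm E ψ ψ)).re + C with hG
  have he := Real.exp_pos 1
  rw [Metric.tendsto_nhds]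
  intro η hη
  -- `A` is so large that the error satisfies `e G < A η / 2`. Then `ε` is so small that the mass of
  -- `z` contributes less than `η / 2`, and that `A |w j - z| ≤ 1` as soon as `w j` is close to `v`.
  set A := 2 * Real.exp 1 * (|G| + 1) / η with hA
  have hA0 : 0 < A := by positivity
  set ε := min (η / (2 * Real.exp 1 * Real.exp 1)) (1 / (2 * A)) with hε
  have hε0 : 0 < ε := by positivity
  obtain ⟨z, hz1, hz2, hz3⟩ := hv ε hε0
  filter_upwards [Metric.tendstoUniformlyOn_iff.1 hunif (1 / (2 * A)) (by positivity)] with j hj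
  rw [Real.dist_eq, sub_zero, abs_of_nonneg (hnn j)]
  have h1 := ev_sq_ddc_le hT hcl hU hψ hψU (hw j) (hz1.mono hUV) hA0.le (fun x hx => ?_)
    (C := C) (fun g hg hg2 => hC U g hU hψU hg hg2)
  · have h2 : (T.ev (fun x => (ψ x * ψ x) • ddc z x)).re < ε := by
      refine lt_of_le_of_lt (hT.ev_mono (hψ2.smul_ddc_mem hU (hs2.trans hψU)
        (hz1.smooth.mono hUV)) (hθ.smul_ddc_mem hV hθV hz1.smooth) fun x => ?_) hz3
      by_cases hxV : x ∈ V
      · have h3 : θ x • ddc z x + (-1 : ℝ) • (ψ x * ψ x) • ddc z x =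
            ((θ x - ψ x * ψ x) • ddc z x : Alt2 E) := by module
        rw [h3]
        refine PosForm.smul (hz1.nonneg x hxV) ?_
        by_cases hx : x ∈ tsupport ψ
        · rw [hψθ x hx]
          nlinarith [hψ01 x]
        · rw [image_eq_zero_of_notMem_tsupport hx, mul_zero, sub_zero]
          exact hθ0 x
      · have h4 : θ x = 0 := image_eq_zero_of_notMem_tsupport fun h => hxV (hθV h)
        have h5 : ψ x = 0 := image_eq_zero_of_notMem_tsupport fun h => hxV (hUV (hψU h))
        rw [h4, h5, mul_zero, Alt2.zero_rsmul, Alt2.rsmul_zero, add_zero]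
        exact posForm_zero
    rw [← hG] at h1
    set Tw := (T.ev (fun x => (ψ x * ψ x) • ddc (w j) x)).re
    set Tz := (T.ev (fun x => (ψ x * ψ x) • ddc z x)).re
    have h6 : Real.exp (-1) * Real.exp 1 = 1 := by rw [← Real.exp_add]; simp
    have h7 : A * Tw ≤ A * (Real.exp 1 * Real.exp 1 * Tz) + Real.exp 1 * G := by
      have := mul_le_mul_of_nonneg_left h1 he.le
      calc A * Tw = (Real.exp (-1) * Real.exp 1) * (A * Tw) := by rw [h6, one_mul]
        _ = Real.exp 1 * (A * Real.exp (-1) * Tw) := by ring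
        _ ≤ _ := this
        _ = _ := by ring
    have h8 : Real.exp 1 * Real.exp 1 * Tz < η / 2 := by
      have : ε ≤ η / (2 * Real.exp 1 * Real.exp 1) := min_le_left _ _
      calc Real.exp 1 * Real.exp 1 * Tz < Real.exp 1 * Real.exp 1 *
            (η / (2 * Real.exp 1 * Real.exp 1)) := by
              gcongr
              linarith
        _ = η / 2 := by field_simp
    have h9 : Real.exp 1 * G < A * (η / 2) := by
      have : A * (η / 2) = Real.exp 1 * (|G| + 1) := by rw [hA]; field_simp
      rw [this]
      gcongr
      linarith [le_abs_self G]
    have h10 : A * Tw < A * η := by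
      calc A * Tw ≤ _ := h7
        _ < A * (η / 2) + A * (η / 2) := by gcongr
        _ = A * η := by ring
    exact lt_of_mul_lt_mul_left h10 hA0.le
  · have h2 := hj x hx
    have h3 := hz2 x (hUV (hψU hx))
    rw [Real.dist_eq] at h2
    have h4 : ε ≤ 1 / (2 * A) := min_le_right _ _
    have h5 : |w j x - z x| ≤ 1 / A := by
      calc |w j x - z x| = |-(v x - w j x) + -(z x - v x)| := by ring_nf
        _ ≤ |v x - w j x| + |z x - v x| := by
          refine (abs_add_le _ _).trans ?_
          rw [abs_neg, abs_neg]
        _ ≤ 1 / (2 * A) + 1 / (2 * A) := by linarith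
        _ = 1 / A := by field_simp; norm_num
    calc A * |w j x - z x| ≤ A * (1 / A) := by gcongr
      _ = 1 := by field_simp

/-- Both `b + g` and `b - g` are nonnegative, which bounds the real part. The imaginary part
vanishes because `T` is real on the positive forms with coefficients `b + g` and `b`. -/
theorem Current.IsPositive.norm_ev_le {T : Current E X} (hT : T.IsPositive) {U : Set X}
    (hU : IsOpen U) {w : X → ℝ} (hw : IsSmoothPshOn E w U) {g b : X → ℝ} (hg : IsRTest E g)
    (hb : IsRTest E b) (hgU : tsupport g ⊆ U) (hbU : tsupport b ⊆ U)
    (hgb : ∀ x, |g x| ≤ b x) :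
    ‖T.ev (fun x => g x • ddc w x)‖ ≤ (T.ev (fun x => b x • ddc w x)).re := by
  have hgm := hg.smul_ddc_mem hU hgU hw.smooth
  have hbm := hb.smul_ddc_mem hU hbU hw.smooth
  have hpos : ∀ s : ℝ, |s| ≤ 1 → ∀ x, PosForm (b x • ddc w x + s • g x • ddc w x : Alt2 E) := by
    intro s hs x
    by_cases hx : x ∈ U
    · have h3 : b x • ddc w x + s • g x • ddc w x = ((b x + s * g x) • ddc w x : Alt2 E) := by
        module
      rw [h3]
      refine PosForm.smul (hw.nonneg x hx) ?_
      have h1 : |s * g x| ≤ 1 * b x := by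
        rw [abs_mul]
        exact mul_le_mul hs (hgb x) (abs_nonneg _) zero_le_one
      linarith [neg_abs_le (s * g x)]
    · have h4 : b x = 0 := image_eq_zero_of_notMem_tsupport fun h => hx (hbU h)
      have h5 : g x = 0 := image_eq_zero_of_notMem_tsupport fun h => hx (hgU h)
      rw [h4, h5, Alt2.zero_rsmul, Alt2.rsmul_zero, add_zero]
      exact posForm_zero
  have him : (T.ev (fun x => g x • ddc w x)).im = 0 := by
    have h1 := hT.ev_im (Current.add_mem hbm (Current.real_smul_mem hgm 1)) (hpos 1 (by simp))
    have h2 := hT.ev_im (Current.add_mem hbm (Current.real_smul_mem hgm 0)) (hpos 0 (by simp))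
    rw [T.ev_add hbm (Current.real_smul_mem hgm _), T.ev_real_smul hgm, Complex.add_im,
      Complex.im_ofReal_mul] at h1 h2
    linarith
  have hre : ∀ s : ℝ, |s| ≤ 1 → 0 ≤ (T.ev (fun x => b x • ddc w x)).re +
      s * (T.ev (fun x => g x • ddc w x)).re := by
    intro s hs
    have h1 := hT.ev_nonneg (Current.add_mem hbm (Current.real_smul_mem hgm s)) (hpos s hs)
    rwa [T.ev_add hbm (Current.real_smul_mem hgm _), T.ev_real_smul hgm, Complex.add_re,
      Complex.re_ofReal_mul] at h1
  have h1 := hre 1 (by simp)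
  have h2 := hre (-1) (by simp)
  have h3 : T.ev (fun x => g x • ddc w x) = ((T.ev (fun x => g x • ddc w x)).re : ℂ) :=
    Complex.ext rfl (by simpa using him)
  rw [h3, Complex.norm_real, Real.norm_eq_abs, abs_le]
  constructor <;> linarith

/-- A test function `g` is dominated by `N ψ²`, where `ψ` equals one on its support and `N` bounds
`g`; so the case of squares suffices. -/
theorem Current.Annihilates.tendsto_ev [FiniteDimensional ℂ E] [T2Space X]
    [SecondCountableTopology X] {T : Current E X} (hT : T.IsPositive)
    (hcl : ∀ φ, IsRTest E φ → (T.ev (ddc φ)).re = 0) (h0 : T.IsOrderZero)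
    {θ : X → ℝ} {V W : Set X} {v : X → ℝ} (hV : IsOpen V) (hθ : IsRTest E θ)
    (hθV : tsupport θ ⊆ V) (hθ0 : ∀ x, 0 ≤ θ x) (hv : T.Annihilates θ V v)
    (hW : IsOpen W) (hWV : W ⊆ V) (hθW : ∀ x ∈ W, θ x = 1)
    {U : Set X} (hU : IsOpen U) {g : X → ℝ} (hg : IsRTest E g) (hgU : tsupport g ⊆ U)
    (hgW : tsupport g ⊆ W) {w : ℕ → X → ℝ} (hw : ∀ j, IsSmoothPshOn E (w j) U)
    (hwv : TendstoLocallyUniformlyOn w v atTop U) :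
    Tendsto (fun j => T.ev (fun x => g x • ddc (w j) x)) atTop (𝓝 0) := by
  have hO := hU.inter hW
  obtain ⟨ψ, hψ1, hψ2, hψ3, hψ4⟩ := exists_isRTest_one (E := E) hg.compact.isCompact hO
    (subset_inter hgU hgW)
  obtain ⟨N, hN⟩ := hg.compact.exists_bound_of_continuous hg.smooth.continuous
  have hψs : IsRTest E (fun y => ψ y * ψ y) := by simpa [pow_two] using hψ1.sq
  have hs2 : tsupport (fun y => ψ y * ψ y) ⊆ tsupport ψ := tsupport_mul_subset_left
  have hwO : ∀ j, IsSmoothPshOn E (w j) (U ∩ W) := fun j => (hw j).mono inter_subset_left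
  have h1 := (hv.tendsto_sq hT hcl h0 hV hθ hθV hθ0 hO (inter_subset_right.trans hWV) hψ1 hψ2 hψ3
    (fun x hx => hθW x (hψ2 hx).2) hwO (hwv.mono inter_subset_left)).const_mul N
  rw [mul_zero] at h1
  refine squeeze_zero_norm (fun j => ?_) h1
  have h2 := hT.norm_ev_le hO (hwO j) hg (hψs.const_mul N) (subset_inter hgU hgW)
    ((tsupport_mul_subset_right.trans hs2).trans hψ2) fun x => ?_
  · refine h2.trans (le_of_eq ?_)
    rw [← Complex.re_ofReal_mul, ← T.ev_real_smul (hψs.smul_ddc_mem hO (hs2.trans hψ2)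
      (hwO j).smooth)]
    simp only [mul_smul]
  · by_cases hx : x ∈ tsupport g
    · rw [hψ4 x hx, mul_one, mul_one]
      exact hN x
    · rw [image_eq_zero_of_notMem_tsupport hx, abs_zero]
      exact mul_nonneg ((norm_nonneg _).trans (hN x)) (mul_self_nonneg _)

/-- The statement is local: split `φ` into real and imaginary parts and along the partition of
unity, and treat each piece on its own patch. -/
theorem Current.isWedgeDdbar_of_annihilates [FiniteDimensional ℂ E] [T2Space X]
    [SecondCountableTopology X] {T : Current E X} (hT : T.IsPositive)
    (hcl : ∀ φ, IsRTest E φ → (T.ev (ddc φ)).re = 0) (h0 : T.IsOrderZero) (𝒦 : Cover E X)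
    {θ : ℕ → X → ℝ} (hθ : ∀ i, IsRTest E (θ i)) (hθU : ∀ i, tsupport (θ i) ⊆ 𝒦.U i)
    (hθ0 : ∀ i x, 0 ≤ θ i x) (hθ1 : ∀ i, ∀ x ∈ 𝒦.W i, θ i x = 1) {v : X → ℝ}
    (hv : ∀ i, T.Annihilates (θ i) (𝒦.U i) v) : T.IsWedgeDdbar v 0 := by
  intro U hU w hw hwv φ hφ hφU
  set I := (𝒦.finite_meeting hφ.compact.isCompact).toFinset
  have hloc : ∀ g : X → ℝ, IsRTest E g → tsupport g ⊆ U → ∀ i,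
      (∀ j, (fun x => (g x * 𝒦.χ i x) • ddc (w j) x : TwoForm E X) ∈ testForms E X) ∧
      Tendsto (fun j => T.ev (fun x => (g x * 𝒦.χ i x) • ddc (w j) x)) atTop (𝓝 0) := by
    intro g hg hgU i
    obtain ⟨h1, h2⟩ := 𝒦.isRTest_mul i hg
    have h3 : tsupport (fun x => g x * 𝒦.χ i x) ⊆ U :=
      (tsupport_mul_subset_left (f := g) (g := 𝒦.χ i)).trans hgU
    exact ⟨fun j => h1.smul_ddc_mem hU h3 (hw j).smooth,
      (hv i).tendsto_ev hT hcl h0 (𝒦.isOpen_U i) (hθ i) (hθU i) (hθ0 i) (𝒦.isOpen_W i)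
        (𝒦.W_subset_U i) (hθ1 i) hU h1 h3 h2 hw hwv⟩
  have hre : tsupport (fun x => (φ x).re) ⊆ U := Subset.trans (closure_mono
    fun x (hx : (φ x).re ≠ 0) (h : φ x = 0) => hx (by rw [h]; rfl)) hφU
  have him : tsupport (fun x => (φ x).im) ⊆ U := Subset.trans (closure_mono
    fun x (hx : (φ x).im ≠ 0) (h : φ x = 0) => hx (by rw [h]; rfl)) hφU
  have key : ∀ j, T (smulDdbarForm φ (w j) hU (hw j) hφ hφU) =
      ∑ i ∈ I, (T.ev (fun x => ((φ x).re * 𝒦.χ i x) • ddc (w j) x) +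
        Complex.I * T.ev (fun x => ((φ x).im * 𝒦.χ i x) • ddc (w j) x)) := by
    intro j
    have m1 := fun i => (hloc _ hφ.re hre i).1 j
    have m2 := fun i => (testForms E X).smul_mem Complex.I ((hloc _ hφ.im him i).1 j)
    have e1 : ∀ i, T.ev (fun x => ((φ x).re * 𝒦.χ i x) • ddc (w j) x) +
        Complex.I * T.ev (fun x => ((φ x).im * 𝒦.χ i x) • ddc (w j) x) =
        T.ev (fun x => ((φ x).re * 𝒦.χ i x) • ddc (w j) x +
          Complex.I • ((φ x).im * 𝒦.χ i x) • ddc (w j) x) := by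
      intro i
      rw [← T.ev_smul ((hloc _ hφ.im him i).1 j)]
      exact (T.ev_add (m1 i) (m2 i)).symm
    simp only [e1]
    have m3 : ∀ i ∈ I, (fun x => ((φ x).re * 𝒦.χ i x) • ddc (w j) x +
        Complex.I • ((φ x).im * 𝒦.χ i x) • ddc (w j) x : TwoForm E X) ∈ testForms E X :=
      fun i _ => Current.add_mem (m1 i) (m2 i)
    rw [← T.ev_sum I m3, T.ev_eq (Current.sum_mem I m3)]
    congr 1
    refine Subtype.ext (funext fun x => ?_)
    have h1 := 𝒦.eq_sum hφ.compact.isCompact (φ := φ)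
      (fun x hx => image_eq_zero_of_notMem_tsupport hx) x
    change φ x • (ddc (w j) x : Alt2 E) = _
    have e2 : ∀ i, (((φ x).re * 𝒦.χ i x) • ddc (w j) x +
          Complex.I • ((φ x).im * 𝒦.χ i x) • ddc (w j) x : Alt2 E) =
        (𝒦.χ i x • φ x) • ddc (w j) x := by
      intro i
      refine Alt2.ext' fun v w' => ?_
      simp only [ContinuousAlternatingMap.add_apply, ContinuousAlternatingMap.smul_apply,
        Complex.real_smul, smul_eq_mul, Complex.ofReal_mul]
      conv_rhs => rw [← Complex.re_add_im (φ x)]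
      ring
    simp only [e2]
    rw [← Finset.sum_smul, ← h1]
  simp only [key]
  have h2 : Tendsto (fun j => ∑ i ∈ I, (T.ev (fun x => ((φ x).re * 𝒦.χ i x) • ddc (w j) x) +
        Complex.I * T.ev (fun x => ((φ x).im * 𝒦.χ i x) • ddc (w j) x))) atTop
      (𝓝 (∑ _i ∈ I, ((0 : ℂ) + Complex.I * 0))) :=
    tendsto_finsetSum I fun i _ => (hloc _ hφ.re hre i).2.add
      ((hloc _ hφ.im him i).2.const_mul Complex.I)
  simpa using h2

end Wedge

open MeasureTheory Metric ProbabilityTheory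

/-! ### Disintegration of a measure along a function -/

section Disintegration

/-- Fatou's lemma: the integral of the lower limit is at most the limit of the integrals, which is
zero, so the lower limit vanishes almost everywhere. This transfers limits for `T` to almost every
fiber. -/
theorem ae_frequently_lt {Ω : Type*} [MeasurableSpace Ω] {σ : Measure Ω} {g : ℕ → Ω → ℝ}
    (h0 : ∀ n, ∀ᵐ o ∂σ, 0 ≤ g n o) (hgm : ∀ n, Measurable (g n))
    (hg : ∀ n, Integrable (g n) σ)
    (hlim : Tendsto (fun n => ∫ o, g n o ∂σ) atTop (𝓝 0)) :
    ∀ᵐ o ∂σ, ∀ ε > 0, ∃ᶠ n in atTop, g n o < ε := by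
  have h1 : ∀ n, ∫⁻ o, ENNReal.ofReal (g n o) ∂σ = ENNReal.ofReal (∫ o, g n o ∂σ) := fun n =>
    (ofReal_integral_eq_lintegral_ofReal (hg n) (h0 n)).symm
  have h2 : Tendsto (fun n => ∫⁻ o, ENNReal.ofReal (g n o) ∂σ) atTop (𝓝 0) := by
    simp only [h1]
    simpa using ENNReal.tendsto_ofReal hlim
  have hm : ∀ n, Measurable fun o => ENNReal.ofReal (g n o) := fun n => (hgm n).ennreal_ofReal
  have h3 : ∫⁻ o, liminf (fun n => ENNReal.ofReal (g n o)) atTop ∂σ = 0 := by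
    have := lintegral_liminf_le (μ := σ) (u := atTop) hm
    rw [h2.liminf_eq] at this
    exact le_antisymm this zero_le
  rw [lintegral_eq_zero_iff (Measurable.liminf hm)] at h3
  filter_upwards [h3, ae_all_iff.2 h0] with o ho ho0 ε hε
  have h4 : liminf (fun n => ENNReal.ofReal (g n o)) atTop < ENNReal.ofReal ε := by
    rw [ho]; simpa using hε
  exact (frequently_lt_of_liminf_lt (by isBoundedDefault) h4).mono fun n hn =>
    (ENNReal.ofReal_lt_ofReal_iff hε).1 hn

variable {Ω : Type*} [MeasurableSpace Ω] [StandardBorelSpace Ω] [Nonempty Ω]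

/-- The joint law of a function and of the identity. -/
def graphMeasure (σ : Measure Ω) (p : Ω → ℝ) : Measure (ℝ × Ω) := σ.map fun o => (p o, o)

instance (σ : Measure Ω) [IsFiniteMeasure σ] (p : Ω → ℝ) : IsFiniteMeasure (graphMeasure σ p) := by
  unfold graphMeasure; infer_instance

/-- The conditional measures of `σ` on the fibers of `p`. -/
def fiberKernel (σ : Measure Ω) [IsFiniteMeasure σ] (p : Ω → ℝ) : Kernel ℝ Ω :=
  (graphMeasure σ p).condKernel

instance (σ : Measure Ω) [IsFiniteMeasure σ] (p : Ω → ℝ) : IsMarkovKernel (fiberKernel σ p) := by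
  unfold fiberKernel; infer_instance

variable {σ : Measure Ω} [IsFiniteMeasure σ] {p : Ω → ℝ}

theorem fst_graphMeasure (hp : Measurable p) : (graphMeasure σ p).fst = σ.map p := by
  rw [Measure.fst, graphMeasure, Measure.map_map measurable_fst (by fun_prop)]
  rfl

theorem snd_graphMeasure (hp : Measurable p) : (graphMeasure σ p).map Prod.snd = σ := by
  rw [graphMeasure, Measure.map_map measurable_snd (by fun_prop)]
  exact Measure.map_id

theorem compProd_fiberKernel (hp : Measurable p) :
    (σ.map p).compProd (fiberKernel σ p) = graphMeasure σ p := by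
  rw [← fst_graphMeasure hp]
  exact (graphMeasure σ p).disintegrate (graphMeasure σ p).condKernel

theorem ae_fiberKernel (hp : Measurable p) {P : Ω → Prop} (h : ∀ᵐ o ∂σ, P o) :
    ∀ᵐ c ∂σ.map p, ∀ᵐ o ∂fiberKernel σ p c, P o := by
  have h1 : ∀ᵐ o ∂(graphMeasure σ p).map Prod.snd, P o := by rwa [snd_graphMeasure hp]
  have h2 := ae_of_ae_map measurable_snd.aemeasurable h1
  rw [← compProd_fiberKernel hp] at h2
  exact Measure.ae_ae_of_ae_compProd h2

/-- The joint law is carried by the graph of `p`, so almost every conditional measure is carried by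
the corresponding fiber. -/
theorem ae_fiberKernel_eq (hp : Measurable p) :
    ∀ᵐ c ∂σ.map p, ∀ᵐ o ∂fiberKernel σ p c, p o = c := by
  have h2 : ∀ᵐ x ∂graphMeasure σ p, p x.2 = x.1 := by
    have hm : MeasurableSet {x : ℝ × Ω | p x.2 = x.1} :=
      measurableSet_eq_fun (hp.comp measurable_snd) measurable_fst
    have hpm : AEMeasurable (fun o => (p o, o)) σ := by fun_prop
    exact (ae_map_iff hpm hm).2 (Eventually.of_forall fun o => rfl)
  rw [← compProd_fiberKernel hp] at h2
  exact Measure.ae_ae_of_ae_compProd h2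

variable {F : Type*} [NormedAddCommGroup F] [NormedSpace ℝ F]

theorem stronglyMeasurable_fiberKernel {f : Ω → F} (hf : StronglyMeasurable f) :
    StronglyMeasurable fun c => ∫ o, f o ∂fiberKernel σ p c := hf.integral_kernel

theorem integrable_fiberKernel {f : Ω → F} (hf : StronglyMeasurable f)
    {M : ℝ} (hM : ∀ o, ‖f o‖ ≤ M) :
    Integrable (fun c => ∫ o, f o ∂fiberKernel σ p c) (σ.map p) := by
  refine Integrable.of_bound (stronglyMeasurable_fiberKernel hf).aestronglyMeasurable M
    (Eventually.of_forall fun c => ?_)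
  simpa using norm_integral_le_of_norm_le_const (μ := fiberKernel σ p c) (Eventually.of_forall hM)

/-- Fubini for the composed kernel, transported back through the graph: a weight `h(c)` on the base
becomes the weight `h ∘ p` upstairs. This relates the fiber currents to `T` multiplied by functions
of `u`. -/
theorem integral_smul_fiberKernel (hp : Measurable p) {f : Ω → F} (hf : StronglyMeasurable f)
    {M : ℝ} (hM : ∀ o, ‖f o‖ ≤ M) {h : ℝ → ℝ} (hh : Measurable h) {N : ℝ} (hN : ∀ c, ‖h c‖ ≤ N) :
    ∫ c, h c • ∫ o, f o ∂fiberKernel σ p c ∂σ.map p = ∫ o, h (p o) • f o ∂σ := by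
  have h1 : StronglyMeasurable fun x : ℝ × Ω => h x.1 • f x.2 :=
    (hh.comp measurable_fst).stronglyMeasurable.smul (hf.comp_measurable measurable_snd)
  have hN0 : 0 ≤ N := (norm_nonneg _).trans (hN 0)
  have h2 : Integrable (fun x : ℝ × Ω => h x.1 • f x.2)
      ((σ.map p).compProd (fiberKernel σ p)) := by
    refine Integrable.of_bound h1.aestronglyMeasurable (N * M) (Eventually.of_forall fun x => ?_)
    rw [norm_smul]
    exact mul_le_mul (hN _) (hM _) (norm_nonneg _) hN0
  have h3 := Measure.integral_compProd h2
  rw [compProd_fiberKernel hp, graphMeasure, integral_map (by fun_prop)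
    h1.aestronglyMeasurable] at h3
  rw [h3]
  refine integral_congr_ae (Eventually.of_forall fun c => ?_)
  exact (integral_smul _ _).symm

theorem integral_fiberKernel (hp : Measurable p) {f : Ω → F} (hf : StronglyMeasurable f)
    {M : ℝ} (hM : ∀ o, ‖f o‖ ≤ M) :
    ∫ c, ∫ o, f o ∂fiberKernel σ p c ∂σ.map p = ∫ o, f o ∂σ := by
  simpa using integral_smul_fiberKernel hp hf hM (h := fun _ => 1) measurable_const (N := 1)
    (by simp)

end Disintegration

/-! ### The fiber currents are Levi currents -/

section Fibers

variable {E : Type*} [NormedAddCommGroup E] [NormedSpace ℂ E]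
variable {X : Type*} [TopologicalSpace X] [ChartedSpace E X]

theorem isPshZero_const (a : ℝ) : IsPshZero E (fun _ : X => a) :=
  ⟨continuous_const, fun f r _ _ => by rw [Real.circleAverage_const]⟩

/-- Countably many functions approximate all continuous plurisubharmonic functions on the
domains of a cover. -/
theorem exists_dense_pshZero [FiniteDimensional ℂ E] [T2Space X] [SecondCountableTopology X]
    (𝒦 : Cover E X) : ∃ v : ℕ → X → ℝ, (∀ k, IsPshZero E (v k)) ∧
      ∀ u : X → ℝ, IsPshZero E u → ∀ i, ∀ ε > 0, ∃ k, ∀ x ∈ 𝒦.U i, |v k x - u x| < ε := by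
  have := FiniteDimensional.proper ℝ E
  have : LocallyCompactSpace X := ChartedSpace.locallyCompactSpace E X
  let P := {v : C(X, ℝ) // IsPshZero E v}
  have : Nonempty P := ⟨⟨ContinuousMap.const X 0, isPshZero_const 0⟩⟩
  have : SecondCountableTopology C(X, ℝ) := inferInstance
  have : SecondCountableTopology P :=
    TopologicalSpace.Subtype.secondCountableTopology {v : C(X, ℝ) | IsPshZero E v}
  let d : ℕ → P := TopologicalSpace.denseSeq P
  have hd : DenseRange d := TopologicalSpace.denseRange_denseSeq P
  refine ⟨fun k => (d k).1, fun k => (d k).2, fun u hu i ε hε => ?_⟩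
  let u' : P := ⟨⟨u, hu.continuous⟩, hu⟩
  have h1 : closedBall (𝒦.c i) (5 / 2 * 𝒦.r i) ⊆ (𝒦.e i).target :=
    𝒦.closedBall_subset_target i (by linarith [𝒦.r_pos i])
  have hK : IsCompact ((𝒦.e i).symm '' closedBall (𝒦.c i) (5 / 2 * 𝒦.r i)) :=
    (isCompact_closedBall _ _).image_of_continuousOn ((𝒦.e i).continuousOn_symm.mono h1)
  have h2 : ∀ᶠ g : P in 𝓝 u', ∀ x ∈ (𝒦.e i).symm '' closedBall (𝒦.c i) (5 / 2 * 𝒦.r i),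
      dist (u x) (g.1 x) < ε := by
    have h3 := (ContinuousMap.tendsto_iff_forall_isCompact_tendstoUniformlyOn (f := u'.1)
      (F := fun g : P => g.1) (p := 𝓝 u')).1 (continuous_subtype_val.tendsto u') _ hK
    exact Metric.tendstoUniformlyOn_iff.1 h3 ε hε
  obtain ⟨g, hg, ⟨k, rfl⟩⟩ := (mem_closure_iff_nhds.1 (hd u') _ h2)
  refine ⟨k, fun x hx => ?_⟩
  have h4 := hg x ⟨𝒦.e i x, ball_subset_closedBall hx.2, (𝒦.e i).left_inv hx.1⟩
  rwa [dist_comm, Real.dist_eq] at h4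

variable [IsManifold 𝓘(ℂ, E) ω X]
variable [FiniteDimensional ℂ E] [MeasurableSpace E] [BorelSpace E] [T2Space X]
  [SecondCountableTopology X]

instance standardBorelSpace_prod_of_finiteDimensional : StandardBorelSpace (ℕ × E) := by
  have := FiniteDimensional.proper ℝ E
  infer_instance

namespace Density

variable {T : Current E X} {𝒦 : Cover E X} (τ : Density 𝒦) {σ : Measure (ℕ × E)}
  [IsFiniteMeasure σ]

/-- The current carried by the level set `{u = c}` in the disintegration of `τ σ` along `u`. -/
abbrev fiberCurrent (σ : Measure (ℕ × E)) [IsFiniteMeasure σ] (u : X → ℝ) (c : ℝ) :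
    Current E X :=
  τ.current (fiberKernel σ (𝒦.pull u) c)

theorem fiberCurrent_ev (u : X → ℝ) (c : ℝ) {α : TwoForm E X} (hα : α ∈ testForms E X) :
    (τ.fiberCurrent σ u c).ev α =
      ∫ o, τ.evalField (field 𝒦 α) o ∂fiberKernel σ (𝒦.pull u) c :=
  τ.current_ev _ hα

theorem integrable_fiberCurrent (u : X → ℝ) {α : TwoForm E X} (hα : α ∈ testForms E X) :
    Integrable (fun c => (τ.fiberCurrent σ u c).ev α) (σ.map (𝒦.pull u)) := by
  obtain ⟨M, hM⟩ := τ.exists_bound_form hα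
  simp only [fun c => τ.fiberCurrent_ev (σ := σ) u c hα]
  exact integrable_fiberKernel (τ.measurable_evalField_form hα).stronglyMeasurable hM

theorem measurable_fiberCurrent (u : X → ℝ) {α : TwoForm E X} (hα : α ∈ testForms E X) :
    Measurable fun c => (τ.fiberCurrent σ u c).ev α := by
  simp only [fun c => τ.fiberCurrent_ev (σ := σ) u c hα]
  exact (stronglyMeasurable_fiberKernel
    (τ.measurable_evalField_form hα).stronglyMeasurable).measurable

theorem integral_fiberCurrent
    (hτ : ∀ α ∈ testForms E X, T.ev α = ∫ o, τ.evalField (Density.field 𝒦 α) o ∂σ) {u : X → ℝ}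
    (hu : Continuous u) {α : TwoForm E X} (hα : α ∈ testForms E X) :
    ∫ c, (τ.fiberCurrent σ u c).ev α ∂σ.map (𝒦.pull u) = T.ev α := by
  obtain ⟨M, hM⟩ := τ.exists_bound_form hα
  simp only [fun c => τ.fiberCurrent_ev (σ := σ) u c hα]
  rw [hτ α hα]
  exact integral_fiberKernel (𝒦.measurable_pull hu)
    (τ.measurable_evalField_form hα).stronglyMeasurable hM

/-- The fiber measure lives where `u = c`, and a form supported off this set vanishes at those
points. -/
theorem fiberCurrent_support {u : X → ℝ} (hu : Continuous u) {c : ℝ}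
    (hc : ∀ᵐ o ∂fiberKernel σ (𝒦.pull u) c, 𝒦.pull u o = c) :
    (τ.fiberCurrent σ u c).support ⊆ {x | u x = c} := by
  intro x hx
  by_contra hne
  obtain ⟨α, h1, h2⟩ := hx {y | u y ≠ c} (isOpen_ne_fun hu continuous_const) hne
  refine h2 ?_
  rw [current_apply]
  refine integral_eq_zero_of_ae ?_
  filter_upwards [hc] with o ho
  by_cases hB : o.2 ∈ 𝒦.B o.1
  · have h3 : u ((𝒦.e o.1).symm o.2) = c := by
      rw [← ho]; exact (indicator_of_mem hB fun z => u ((𝒦.e o.1).symm z)).symm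
    have h4 : α.1 ((𝒦.e o.1).symm o.2) = 0 :=
      image_eq_zero_of_notMem_tsupport (f := (α : TwoForm E X)) fun h => h1 h h3
    rw [evalField, field_eq_zero h4, val_zero]
    rfl
  · exact τ.evalField_eq_zero hB _

/-- For a fixed `φ`, the function `c ↦ T_c(i∂∂̄φ)` has zero integral against every smooth compactly
supported `h(c)`, because `T(h(u) i∂∂̄φ) = 0`; so it vanishes almost everywhere. A countable family
of forms `i∂∂̄φ` determining all the others yields one null set. -/
theorem ae_fiberCurrent_closed (hT : T.IsLevi)
    (hτ : ∀ α ∈ testForms E X, T.ev α = ∫ o, τ.evalField (Density.field 𝒦 α) o ∂σ)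
    {u : X → ℝ} (hu : IsPshZero E u) :
    ∀ᵐ c ∂σ.map (𝒦.pull u), ∀ φ : X → ℝ, IsRTest E φ →
      (τ.fiberCurrent σ u c).ev (ddc φ) = 0 := by
  obtain ⟨D, hDS, hD, h⟩ := exists_countable_dense_forms 𝒦
    {α : TwoForm E X | ∃ φ, IsRTest E φ ∧ α = ddc φ} (by rintro _ ⟨φ, hφ, rfl⟩; exact hφ.ddc_mem)
  have h1 : ∀ α ∈ D, ∀ᵐ c ∂σ.map (𝒦.pull u), (τ.fiberCurrent σ u c).ev α = 0 := by
    intro α hα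
    obtain ⟨φ, hφ, rfl⟩ := hDS hα
    obtain ⟨M, hM⟩ := τ.exists_bound_form hφ.ddc_mem
    refine ae_eq_zero_of_integral_contDiff_smul_eq_zero
      (τ.integrable_fiberCurrent u hφ.ddc_mem).locallyIntegrable fun g hg hgc => ?_
    obtain ⟨N, hN⟩ := hgc.exists_bound_of_continuous hg.continuous
    simp only [fun c => τ.fiberCurrent_ev (σ := σ) u c hφ.ddc_mem]
    rw [integral_smul_fiberKernel (𝒦.measurable_pull hu.continuous)
      (τ.measurable_evalField_form hφ.ddc_mem).stronglyMeasurable hM hg.continuous.measurable hN]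
    simp only [Complex.real_smul]
    exact τ.integral_comp_mul_eq_zero hT hτ hu hg hgc hφ
  filter_upwards [(ae_ball_iff hD).2 h1] with c hc φ hφ
  rw [fiberCurrent_ev _ _ _ hφ.ddc_mem]
  refine h τ _ (fun α hα => ?_) _ ⟨φ, hφ, rfl⟩
  rw [← hc α hα, fiberCurrent_ev]
  obtain ⟨φ, hφ, rfl⟩ := hDS hα
  exact hφ.ddc_mem

/-- The masses of `θ i∂∂̄(a n)` for the fiber currents are nonnegative, and integrate to the mass
for `T`, which tends to zero. By Fatou almost every fiber has small mass for infinitely many `n`,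
hence for some `a n` uniformly close to `v`. -/
theorem ae_fiberCurrent_annihilates (hT : T.IsLevi)
    (hτ : ∀ α ∈ testForms E X, T.ev α = ∫ o, τ.evalField (Density.field 𝒦 α) o ∂σ)
    {u : X → ℝ} (hu : Continuous u) {v : X → ℝ} (hv : IsPshZero E v) (i : ℕ) {θ : X → ℝ}
    (hθ : IsRTest E θ) (hθU : tsupport θ ⊆ 𝒦.U i) (hθ0 : ∀ x, 0 ≤ θ x) :
    ∀ᵐ c ∂σ.map (𝒦.pull u), (τ.fiberCurrent σ u c).Annihilates θ (𝒦.U i) v := by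
  obtain ⟨a, ha, hav, hw, -, -⟩ := hT.exists_regularization 𝒦 i hv hθ hθU hθ0
  have hU := 𝒦.isOpen_U i
  have hmem := fun n => hθ.smul_ddc_mem hU hθU (ha n).smooth
  have hint := fun n => τ.integrable_fiberCurrent (σ := σ) u (hmem n)
  have h1 := ae_frequently_lt (σ := σ.map (𝒦.pull u))
    (g := fun n c => ((τ.fiberCurrent σ u c).ev (fun x => θ x • ddc (a n) x)).re)
    (fun n => Eventually.of_forall fun c => ?_)
    (fun n => Complex.measurable_re.comp (τ.measurable_fiberCurrent u (hmem n)))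
    (fun n => (hint n).re) ?_
  · filter_upwards [h1] with c hc ε hε
    have h2 := Metric.tendstoUniformlyOn_iff.1 hav ε hε
    obtain ⟨n, hn1, hn2⟩ := ((hc ε hε).and_eventually h2).exists
    refine ⟨a n, ha n, fun x hx => ?_, hn1⟩
    have := hn2 x hx
    rwa [dist_comm, Real.dist_eq] at this
  · refine (τ.current_isPositive _).ev_nonneg (hmem n) fun x => ?_
    by_cases hx : x ∈ 𝒦.U i
    · exact PosForm.smul ((ha n).nonneg x hx) (hθ0 x)
    · have h4 : θ x = 0 := image_eq_zero_of_notMem_tsupport fun h => hx (hθU h)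
      rw [h4, Alt2.zero_rsmul]
      exact posForm_zero
  · refine hw.congr fun n => ?_
    rw [← τ.integral_fiberCurrent hτ hu (hmem n)]
    exact (integral_re (hint n)).symm

theorem current_closed {T : Current E X} (h : ∀ φ : X → ℝ, IsRTest E φ → T.ev (ddc φ) = 0)
    (φ : X → ℂ) (hφ : IsTestFunction E φ) : T (ddbarForm φ hφ) = 0 := by
  have h1 := h _ hφ.re
  have h2 := h _ hφ.im
  have h3 := T.ev_add hφ.re.ddc_mem ((testForms E X).smul_mem Complex.I hφ.im.ddc_mem)
  have h4 := T.ev_smul hφ.im.ddc_mem Complex.I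
  have h5 : T.ev (Complex.I • ddc fun x => (φ x).im) = 0 := by
    rw [h2, mul_zero] at h4
    exact h4
  rw [h1, h5, add_zero] at h3
  rw [← h3, T.ev_eq (Current.add_mem hφ.re.ddc_mem
    ((testForms E X).smul_mem Complex.I hφ.im.ddc_mem))]
  congr 1
  exact Subtype.ext (funext fun x => iddbar_re_im hφ.smooth.contMDiffAt)

/-- Almost all the fiber currents are Levi currents, or zero. -/
theorem ae_fiberCurrent_isLevi (hT : T.IsLevi)
    (hτ : ∀ α ∈ testForms E X, T.ev α = ∫ o, τ.evalField (Density.field 𝒦 α) o ∂σ)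
    {u : X → ℝ} (hu : IsPshZero E u) :
    ∀ᵐ c ∂σ.map (𝒦.pull u), τ.fiberCurrent σ u c ≠ 0 → (τ.fiberCurrent σ u c).IsLevi := by
  choose θ hθ hθU hθ01 hθ1 using fun i => 𝒦.exists_cutoff i
  obtain ⟨v, hv, hvd⟩ := exists_dense_pshZero 𝒦
  have h1 : ∀ᵐ c ∂σ.map (𝒦.pull u), ∀ k i,
      (τ.fiberCurrent σ u c).Annihilates (θ i) (𝒦.U i) (v k) :=
    ae_all_iff.2 fun k => ae_all_iff.2 fun i =>
      τ.ae_fiberCurrent_annihilates hT hτ hu.continuous (hv k) i (hθ i) (hθU i)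
        fun x => (hθ01 i x).1
  filter_upwards [h1, τ.ae_fiberCurrent_closed hT hτ hu] with c hc1 hc2 hc0
  refine ⟨hc0, τ.current_isBidimOneOne _, τ.current_isPositive _, current_closed hc2,
    fun w hw => ?_⟩
  refine Current.isWedgeDdbar_of_annihilates (τ.current_isPositive _)
    (fun φ hφ => by rw [hc2 φ hφ, Complex.zero_re]) (τ.current_isOrderZero _) 𝒦 hθ hθU
    (fun i x => (hθ01 i x).1) hθ1 fun i => ?_
  -- The exceptional null set comes from the countably many `v k`; an arbitrary `w` is reached by
  -- uniform approximation on each patch.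
  refine Current.Annihilates.of_approx fun ε hε => ?_
  obtain ⟨k, hk⟩ := hvd w hw i ε hε
  exact ⟨v k, hc1 k i, hk⟩

end Density

end Fibers

/-! ### Tangency of the density to the level sets -/

section Tangential

variable {E : Type*} [NormedAddCommGroup E] [NormedSpace ℂ E]
variable {X : Type*} [TopologicalSpace X] [ChartedSpace E X] [IsManifold 𝓘(ℂ, E) ω X]

theorem mfderiv_symmD {e : OpenPartialHomeomorph X E} (he : e ∈ atlas E X) {z : E}
    (hz : z ∈ e.target) {a : X → ℝ} (ha : MDifferentiableAt 𝓘(ℝ, E) 𝓘(ℝ, ℝ) a (e.symm z)) (v : E) :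
    (mfderiv 𝓘(ℝ, E) 𝓘(ℝ, ℝ) a (e.symm z) : E →L[ℝ] ℝ) (symmD e z v) =
      fderiv ℝ (a ∘ e.symm) z v := by
  have := isManifold_real E X
  have : IsManifold 𝓘(ℝ, E) 1 X := .of_le (n := ∞) (by simp)
  have h1 := mdifferentiableAt_atlas_symm (I := 𝓘(ℝ, E)) he hz
  have h2 := mfderiv_comp z ha h1
  rw [mfderiv_eq_fderiv] at h2
  rw [h2]
  rfl

theorem mfderiv_eq_dif {a : X → ℝ} {x : X} (ha : MDifferentiableAt 𝓘(ℝ, E) 𝓘(ℝ, ℝ) a x) :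
    mfderiv 𝓘(ℝ, E) 𝓘(ℝ, ℝ) a x = dif E a x := by
  obtain ⟨L, hL⟩ : ∃ L : E →L[ℝ] ℝ, L = mfderiv 𝓘(ℝ, E) 𝓘(ℝ, ℝ) a x := ⟨_, rfl⟩
  have h2 : HasFDerivWithinAt (a ∘ (chartAt E x).symm) L (range 𝓘(ℝ, E)) (chartAt E x x) :=
    hL ▸ ha.hasMFDerivAt.2
  rw [ModelWithCorners.range_eq_univ, hasFDerivWithinAt_univ] at h2
  rw [← hL]
  exact h2.fderiv.symm

theorem gamForm_inChart {e : OpenPartialHomeomorph X E} (he : e ∈ atlas E X) {z : E}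
    (hz : z ∈ e.target) {a : X → ℝ} (ha : MDifferentiableAt 𝓘(ℝ, E) 𝓘(ℝ, ℝ) a (e.symm z)) :
    (gamForm E a a).inChart e z =
      gam (fderiv ℝ (a ∘ e.symm) z) (fderiv ℝ (a ∘ e.symm) z) := by
  have h1 : (dif E a (e.symm z)).comp (symmD e z) = fderiv ℝ (a ∘ e.symm) z := by
    ext v
    rw [← mfderiv_symmD he hz ha, mfderiv_eq_dif ha]
    rfl
  rw [← h1, ← gam_comp _ _ (symmD_I he hz)]
  rfl

namespace Density

variable [FiniteDimensional ℂ E] [MeasurableSpace E]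
variable {𝒦 : Cover E X} (τ : Density 𝒦)

theorem continuous_val (o : ℕ × E) : Continuous (τ.val o) :=
  continuous_finsetSum _ fun p _ => continuous_const.mul (continuous_pcoef p)

/-- The kernel of a positive functional on `(1,1)`-forms. -/
theorem val_gam_eq_zero {o : ℕ × E} {l : E →L[ℝ] ℝ} (h : τ.val o (gam l l) = 0)
    (m : E →L[ℝ] ℝ) : τ.val o (gam l m) = 0 := by
  -- Positivity on the square of `a l + m` leaves an affine function of `a` which is bounded below,
  -- so its slope is zero.
  have h1 : ∀ a : ℝ, 0 ≤ 2 * a * (τ.val o (gam l m)).re + (τ.val o (gam m m)).re := by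
    intro a
    have h2 := τ.val_nonneg o (posForm_gam_sq a 1 l m)
    rw [val_add, val_add, val_real_smul, val_real_smul, val_real_smul, h, mul_zero, zero_add,
      Complex.add_re, Complex.re_ofReal_mul, Complex.re_ofReal_mul] at h2
    linarith
  have h3 : (τ.val o (gam l m)).im = 0 := by
    have h4 := congrArg (fun ξ => (τ.val o ξ).im) (gam_polar l m)
    simp only [val_sub, val_real_smul, Complex.sub_im, Complex.im_ofReal_mul,
      τ.val_im o (posForm_gam _)] at h4
    linarith
  refine Complex.ext ?_ h3
  rw [Complex.zero_re]
  by_contra h4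
  have h5 := h1 (-((τ.val o (gam m m)).re + 1) / (2 * (τ.val o (gam l m)).re))
  have h6 : 2 * (-((τ.val o (gam m m)).re + 1) / (2 * (τ.val o (gam l m)).re)) *
      (τ.val o (gam l m)).re = -((τ.val o (gam m m)).re + 1) := by field_simp
  rw [h6] at h5
  linarith

/-- A positive functional on `(1,1)`-forms which is tangent to the hyperplane `l = 0` only
depends on the restrictions of the forms to this hyperplane. -/
theorem val_eq_val_comp {o : ℕ × E} {l : E →L[ℝ] ℝ} (h : τ.val o (gam l l) = 0) (n : E)
    (ξ : Alt2 E) : τ.val o ξ =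
      τ.val o (ξ.compContinuousLinearMap (ContinuousLinearMap.id ℝ E - l.smulRight n)) := by
  set P := ContinuousLinearMap.id ℝ E - l.smulRight n with hP
  set m₁ : E →L[ℝ] ℝ := (Complex.reCLM.comp (ξ.contract n)).comp mulI with hm₁
  set m₂ : E →L[ℝ] ℝ := (Complex.imCLM.comp (ξ.contract n)).comp mulI with hm₂
  have hPv : ∀ v, P v = v + (-l v) • n := fun v => by
    simp [hP, sub_eq_add_neg]
  -- The difference `ξ - P^*ξ` is the wedge product of `l` with the contraction of `ξ` by `n`. Its
  -- `(1,1)`-part is `2 gam` of `l` with that contraction composed with `i`, taken separately on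
  -- real and imaginary parts.
  have key : pr11 (ξ - (ξ.compContinuousLinearMap P +
      ((2 : ℝ) • gam l m₁ + Complex.I • (2 : ℝ) • gam l m₂))) = 0 := by
    refine Alt2.ext' fun v w => ?_
    have hc : ∀ v w, ξ ![P v, P w] = ξ ![v, w] + l w * ξ ![n, v] - l v * ξ ![n, w] := by
      intro v w
      rw [hPv, hPv, ξ.add_left, ξ.add_right, ξ.add_right, ξ.smul_left, ξ.smul_right, ξ.smul_left,
        ξ.smul_right, ξ.self, ξ.swap n v]
      simp only [Complex.real_smul, mul_zero]
      push_cast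
      ring
    have hm : ∀ v, ((m₁ v : ℝ) : ℂ) + Complex.I * ((m₂ v : ℝ) : ℂ) = ξ ![n, Complex.I • v] := by
      intro v
      simp only [hm₁, hm₂, ContinuousLinearMap.comp_apply, mulI_apply, Alt2.contract_apply,
        Complex.reCLM_apply, Complex.imCLM_apply]
      rw [mul_comm]
      exact Complex.re_add_im _
    have hg : ∀ v w, ((2 : ℝ) • gam l m₁ + Complex.I • (2 : ℝ) • gam l m₂ : Alt2 E) ![v, w] =
        1 / 2 * (l (Complex.I • v) * ξ ![n, Complex.I • w] - ξ ![n, v] * l w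
          + l v * ξ ![n, w] - ξ ![n, Complex.I • v] * l (Complex.I • w)) := by
      intro v w
      have hI : ∀ v, ξ ![n, v] = -(((m₁ (Complex.I • v) : ℝ) : ℂ) +
          Complex.I * ((m₂ (Complex.I • v) : ℝ) : ℂ)) := fun v => by
        rw [hm, I_smul_I_smul, ξ.neg_right, neg_neg]
      rw [← hm v, ← hm w, hI v, hI w]
      simp only [ContinuousAlternatingMap.add_apply, ContinuousAlternatingMap.smul_apply,
        gam_apply, Complex.real_smul, smul_eq_mul]
      push_cast
      ring
    rw [pr11_apply]
    have he : ∀ (A B : Alt2 E) (v w : E), (ξ - (A + B)) ![v, w] =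
        ξ ![v, w] - (A ![v, w] + B ![v, w]) := fun _ _ _ _ => rfl
    rw [he, he, comp_pair, comp_pair, hc, hc, hg, hg]
    simp only [I_smul_I_smul, ξ.neg_right, map_neg]
    change _ = (0 : ℂ)
    push_cast
    ring
  have h1 := τ.val_of_pr11 o key
  rw [val_sub, val_add, val_add, val_smul, val_real_smul, val_real_smul, τ.val_gam_eq_zero h,
    τ.val_gam_eq_zero h, mul_zero, mul_zero, add_zero, add_zero] at h1
  exact sub_eq_zero.1 h1

variable [BorelSpace E] [T2Space X]

/-- The integrals of `i∂(a n)∧∂̄(a n)` tend to zero, so by Fatou their densities are frequently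
small at almost every point. As `u` is `C¹`, the gradients of the `a n` converge to that of `u`, so
these densities converge to the nonnegative value on the square of `du`, which must be zero. -/
theorem ae_val_gam_eq_zero {T : Current E X} (hT : T.IsLevi) {σ : Measure (ℕ × E)}
    [IsFiniteMeasure σ]
    (hτ : ∀ α ∈ testForms E X, T.ev α = ∫ o, τ.evalField (Density.field 𝒦 α) o ∂σ)
    {u : X → ℝ} (hu : IsPshZero E u) (hu1 : ContMDiff 𝓘(ℝ, E) 𝓘(ℝ, ℝ) 1 u) :
    ∀ᵐ o ∂σ, τ.val o (gam (fderiv ℝ (u ∘ (𝒦.e o.1).symm) o.2)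
      (fderiv ℝ (u ∘ (𝒦.e o.1).symm) o.2)) = 0 := by
  have hi : ∀ i, ∀ᵐ o ∂σ, o.1 = i → τ.val o (gam (fderiv ℝ (u ∘ (𝒦.e o.1).symm) o.2)
      (fderiv ℝ (u ∘ (𝒦.e o.1).symm) o.2)) = 0 := by
    intro i
    obtain ⟨θ, hθ, hθU, hθ01, hθ1⟩ := 𝒦.exists_cutoff i
    obtain ⟨a, ha, -, -, hw, hd⟩ := hT.exists_regularization 𝒦 i hu hθ hθU fun x => (hθ01 x).1
    have hU := 𝒦.isOpen_U i
    have hmem := fun n => hθ.smul_gamForm_mem hU hθU (ha n).smooth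
    have hpos : ∀ n x, PosForm (θ x • gamForm E (a n) (a n) x) := fun n x =>
      (posForm_gam _).smul (hθ01 x).1
    have hint := fun n => τ.integrable_form (hmem n) σ
    have h1 := ae_frequently_lt (σ := σ)
      (g := fun n o => (τ.evalField (field 𝒦 fun x => θ x • gamForm E (a n) (a n) x) o).re)
      (fun n => Eventually.of_forall fun o => (τ.evalField_form_nonneg (hpos n) o).1)
      (fun n => Complex.measurable_re.comp (τ.measurable_evalField_form (hmem n)))
      (fun n => (hint n).re) ?_
    · filter_upwards [h1] with o ho hoi
      by_cases hz : o.2 ∈ 𝒦.B o.1 ∧ (𝒦.e o.1).symm o.2 ∈ tsupport (𝒦.χ o.1)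
      swap
      · exact τ.val_eq_zero hz _
      set l := fderiv ℝ (u ∘ (𝒦.e o.1).symm) o.2
      have hzt := 𝒦.B_subset_target _ hz.1
      have hW : (𝒦.e o.1).symm o.2 ∈ 𝒦.W i := hoi ▸ 𝒦.tsupport_subset_W o.1 hz.2
      have h2 : ∀ n, τ.evalField (field 𝒦 fun x => θ x • gamForm E (a n) (a n) x) o =
          τ.val o (gam (fderiv ℝ (a n ∘ (𝒦.e o.1).symm) o.2)
            (fderiv ℝ (a n ∘ (𝒦.e o.1).symm) o.2)) := by
        intro n
        rw [τ.evalField_real_smul, hθ1 _ hW, Complex.ofReal_one, one_mul, evalField, field,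
          gamForm_inChart (chart_mem_atlas E _) hzt]
        exact (ContMDiffOn.smoothAt (ha n).smooth hU (𝒦.W_subset_U i hW)).mdifferentiableAt
          (by simp)
      have h3 : Tendsto (fun n => (τ.val o (gam (fderiv ℝ (a n ∘ (𝒦.e o.1).symm) o.2)
          (fderiv ℝ (a n ∘ (𝒦.e o.1).symm) o.2))).re) atTop (𝓝 (τ.val o (gam l l)).re) := by
        have h4 : Tendsto (fun n => fderiv ℝ (a n ∘ (𝒦.e o.1).symm) o.2) atTop (𝓝 l) := by
          subst hoi
          exact hd hu1 _ hz.1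
        have h5 : ∀ v, Tendsto (fun n => fderiv ℝ (a n ∘ (𝒦.e o.1).symm) o.2 v) atTop
            (𝓝 (l v)) := fun v => ((ContinuousLinearMap.apply ℝ ℝ v).continuous.tendsto l).comp h4
        refine (Complex.continuous_re.tendsto _).comp (((τ.continuous_val o).tendsto _).comp
          (tendsto_alt2 fun v w => ?_))
        simp only [gam_apply]
        refine (Complex.continuous_ofReal.tendsto _).comp (Tendsto.const_mul _ ?_)
        exact ((((h5 _).mul (h5 _)).add ((h5 _).mul (h5 _))).sub ((h5 _).mul (h5 _))).sub
          ((h5 _).mul (h5 _))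
      have h6 : (τ.val o (gam l l)).re ≤ 0 := by
        refine le_of_forall_pos_le_add fun ε hε => ?_
        rw [zero_add]
        refine le_of_not_gt fun hlt => ?_
        obtain ⟨n, hn1, hn2⟩ := ((ho ε hε).and_eventually (h3.eventually_const_lt hlt)).exists
        rw [h2 n] at hn1
        exact lt_asymm hn1 hn2
      exact Complex.ext (le_antisymm h6 (τ.val_nonneg o (posForm_gam l)))
        (τ.val_im o (posForm_gam l))
    · refine hw.congr fun n => ?_
      rw [hτ _ (hmem n)]
      exact (integral_re (hint n)).symm
  filter_upwards [ae_all_iff.2 hi] with o ho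
  exact ho _ rfl

end Density

end Tangential

/-! ### Currents on a regular level set -/

section Level

variable {E : Type*} [NormedAddCommGroup E] [NormedSpace ℂ E] [FiniteDimensional ℂ E]

/-- A vector on which the nonzero functional `l` takes the value `1`. -/
def levelNormal (l : E →L[ℝ] ℝ) : E :=
  (∑ j, l (bas E j) ^ 2)⁻¹ • ∑ j, l (bas E j) • bas E j

/-- A projection to the kernel of `l`. -/
def levelProj (l : E →L[ℝ] ℝ) : E →L[ℝ] E :=
  ContinuousLinearMap.id ℝ E - l.smulRight (levelNormal l)

theorem sum_sq_ne_zero {l : E →L[ℝ] ℝ} (hl : l ≠ 0) : ∑ j, l (bas E j) ^ 2 ≠ 0 := by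
  intro h
  rw [Finset.sum_eq_zero_iff_of_nonneg fun _ _ => sq_nonneg _] at h
  refine hl (ContinuousLinearMap.coe_injective ((bas E).ext fun j => ?_))
  simpa using h j (Finset.mem_univ j)

theorem apply_levelProj {l : E →L[ℝ] ℝ} (hl : l ≠ 0) (v : E) : l (levelProj l v) = 0 := by
  have h1 : l (levelNormal l) = 1 := by
    rw [levelNormal, map_smul, map_sum]
    simp only [map_smul, smul_eq_mul, ← pow_two]
    exact inv_mul_cancel₀ (sum_sq_ne_zero hl)
  simp [levelProj, h1]

theorem continuousOn_levelProj (v : E) :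
    ContinuousOn (fun l : E →L[ℝ] ℝ => levelProj l v) {l | l ≠ 0} := by
  have h : (fun l : E →L[ℝ] ℝ => levelProj l v) = fun l =>
      v - l v • (∑ j, l (bas E j) ^ 2)⁻¹ • ∑ j, l (bas E j) • bas E j := rfl
  rw [h]
  have h1 : ContinuousOn (fun l : E →L[ℝ] ℝ => (∑ j, l (bas E j) ^ 2)⁻¹) {l | l ≠ 0} :=
    ContinuousOn.inv₀ (by fun_prop) fun l hl => sum_sq_ne_zero hl
  have h2 : ContinuousOn (fun l : E →L[ℝ] ℝ => ∑ j, l (bas E j) • bas E j) {l | l ≠ 0} := by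
    fun_prop
  have h3 : ContinuousOn (fun l : E →L[ℝ] ℝ => l v) {l | l ≠ 0} := by fun_prop
  exact continuousOn_const.sub (h3.smul (h1.smul h2))

variable {X : Type*} [TopologicalSpace X] [ChartedSpace E X] [IsManifold 𝓘(ℂ, E) ω X]
variable {u : X → ℝ} {c : ℝ}

theorem IsRegularValue.fderiv_ne_zero (hc : IsRegularValue E u c)
    (hu : ContMDiff 𝓘(ℝ, E) 𝓘(ℝ, ℝ) 1 u) {e : OpenPartialHomeomorph X E} (he : e ∈ atlas E X)
    {z : E} (hz : z ∈ e.target) (hzc : u (e.symm z) = c) : fderiv ℝ (u ∘ e.symm) z ≠ 0 := by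
  intro h
  obtain ⟨v, hv⟩ := hc _ hzc (1 : ℝ)
  obtain ⟨w, rfl⟩ := symmD_surj he hz v
  have h1 := mfderiv_symmD he hz ((hu (e.symm z)).mdifferentiableAt one_ne_zero) w
  rw [h, hv] at h1
  exact (one_ne_zero : (1 : ℝ) ≠ 0) h1

/-- The part of the level set in the domain of a chart. -/
def levelChart (u : X → ℝ) (c : ℝ) (e : OpenPartialHomeomorph X E) : Set E :=
  {z | z ∈ e.target ∧ u (e.symm z) = c}

theorem levelProj_mem (hc : IsRegularValue E u c) (hu : ContMDiff 𝓘(ℝ, E) 𝓘(ℝ, ℝ) 1 u)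
    {e : OpenPartialHomeomorph X E} (he : e ∈ atlas E X) {z : E} (hz : z ∈ levelChart u c e)
    (v : E) : symmD e z (levelProj (fderiv ℝ (u ∘ e.symm) z) v) ∈ levelTangent E u (e.symm z) := by
  have h1 := mfderiv_symmD he hz.1 ((hu (e.symm z)).mdifferentiableAt one_ne_zero)
    (levelProj (fderiv ℝ (u ∘ e.symm) z) v)
  rw [apply_levelProj (hc.fderiv_ne_zero hu he hz.1 hz.2)] at h1
  exact h1

/-- The point `z` of the level set with the projections of the vectors `v` and `w`. -/
def levelPoint (hc : IsRegularValue E u c) (hu : ContMDiff 𝓘(ℝ, E) 𝓘(ℝ, ℝ) 1 u)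
    {e : OpenPartialHomeomorph X E} (he : e ∈ atlas E X) (z : levelChart u c e) (v w : E) :
    LevelPairs u c e :=
  ⟨(z.1, levelProj (fderiv ℝ (u ∘ e.symm) z) v, levelProj (fderiv ℝ (u ∘ e.symm) z) w),
    z.2.1, z.2.2, levelProj_mem hc hu he z.2 v, levelProj_mem hc hu he z.2 w⟩

theorem continuousOn_levelProj_fderiv (hc : IsRegularValue E u c)
    (hu : ContMDiff 𝓘(ℝ, E) 𝓘(ℝ, ℝ) 1 u) {e : OpenPartialHomeomorph X E} (he : e ∈ atlas E X)
    (v : E) :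
    ContinuousOn (fun z => levelProj (fderiv ℝ (u ∘ e.symm) z) v) (levelChart u c e) := by
  have h1 : ContinuousOn (fderiv ℝ (u ∘ e.symm)) (levelChart u c e) :=
    ((contDiffOn_one_comp_symm hu he).continuousOn_fderiv_of_isOpen e.open_target le_rfl).mono
      fun z hz => hz.1
  exact (continuousOn_levelProj v).comp h1 fun z hz => hc.fderiv_ne_zero hu he hz.1 hz.2

theorem continuous_levelPoint (hc : IsRegularValue E u c) (hu : ContMDiff 𝓘(ℝ, E) 𝓘(ℝ, ℝ) 1 u)
    {e : OpenPartialHomeomorph X E} (he : e ∈ atlas E X) (v w : E) :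
    Continuous fun z => levelPoint hc hu he z v w := by
  refine Continuous.subtype_mk (continuous_subtype_val.prodMk (Continuous.prodMk ?_ ?_)) _
  · exact continuousOn_iff_continuous_domRestrict.1 (continuousOn_levelProj_fderiv hc hu he v)
  · exact continuousOn_iff_continuous_domRestrict.1 (continuousOn_levelProj_fderiv hc hu he w)

open Classical in
/-- The field of forms on `X` given by a form on a level set, by means of projections to the
tangent spaces of the level set. -/
def levelField (𝒦 : Cover E X) (hc : IsRegularValue E u c) (hu : ContMDiff 𝓘(ℝ, E) 𝓘(ℝ, ℝ) 1 u)
    (β : LevelTwoForm E u c) (i : ℕ) (z : E) : Alt2 E :=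
  if h : z ∈ levelChart u c (𝒦.e i) then
    (β ⟨(𝒦.e i).symm z, h.2⟩).compContinuousLinearMap
      (((symmD (𝒦.e i) z).comp (levelProj (fderiv ℝ (u ∘ (𝒦.e i).symm) z))).codRestrict
        (levelTangent E u ((𝒦.e i).symm z)) fun v =>
          levelProj_mem hc hu (chart_mem_atlas E _) h v)
  else 0

variable {𝒦 : Cover E X} (hc : IsRegularValue E u c) (hu : ContMDiff 𝓘(ℝ, E) 𝓘(ℝ, ℝ) 1 u)

theorem levelField_apply (β : LevelTwoForm E u c) {i : ℕ} {z : E}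
    (h : z ∈ levelChart u c (𝒦.e i)) (v w : E) :
    levelField 𝒦 hc hu β i z ![v, w] =
      β.inChart (𝒦.e i) (levelPoint hc hu (chart_mem_atlas E _) ⟨z, h⟩ v w) := by
  rw [levelField, dif_pos h, ContinuousAlternatingMap.compContinuousLinearMap_apply]
  refine congrArg _ (funext fun k => ?_)
  fin_cases k <;> rfl

theorem levelField_of_notMem (β : LevelTwoForm E u c) {i : ℕ} {z : E}
    (h : z ∉ levelChart u c (𝒦.e i)) : levelField 𝒦 hc hu β i z = 0 := dif_neg h

theorem levelField_add (β γ : LevelTwoForm E u c) (i : ℕ) (z : E) :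
    levelField 𝒦 hc hu (β + γ) i z = levelField 𝒦 hc hu β i z + levelField 𝒦 hc hu γ i z := by
  by_cases h : z ∈ levelChart u c (𝒦.e i)
  · refine Alt2.ext' fun v w => ?_
    rw [ContinuousAlternatingMap.add_apply]
    simp only [levelField_apply hc hu _ h]
    rfl
  · simp only [levelField_of_notMem hc hu _ h, add_zero]

theorem levelField_smul (a : ℂ) (β : LevelTwoForm E u c) (i : ℕ) (z : E) :
    levelField 𝒦 hc hu (a • β) i z = a • levelField 𝒦 hc hu β i z := by
  by_cases h : z ∈ levelChart u c (𝒦.e i)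
  · refine Alt2.ext' fun v w => ?_
    rw [ContinuousAlternatingMap.smul_apply]
    simp only [levelField_apply hc hu _ h]
    rfl
  · simp only [levelField_of_notMem hc hu _ h]
    exact Alt2.ext' fun v w => by simp

/-- The field attached to `j^*α` is the pull-back of `α` by the projection to the tangent space. By
`Density.val_eq_val_comp` a tangential functional takes the same value on it as on `α`. -/
theorem levelField_restrict (α : TwoForm E X) {i : ℕ} {z : E}
    (h : z ∈ levelChart u c (𝒦.e i)) : levelField 𝒦 hc hu (α.restrict u c) i z =
      (Density.field 𝒦 α i z).compContinuousLinearMap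
        (levelProj (fderiv ℝ (u ∘ (𝒦.e i).symm) z)) := by
  refine Alt2.ext' fun v w => ?_
  rw [levelField_apply hc hu _ h, comp_pair, Density.field, inChart_apply]
  refine congrArg (α ((𝒦.e i).symm z)) (funext fun k => ?_)
  fin_cases k <;> rfl

theorem continuousOn_levelField {β : LevelTwoForm E u c} (hβ : β ∈ levelForms E u c) (i : ℕ)
    (v w : E) :
    ContinuousOn (fun z => levelField 𝒦 hc hu β i z ![v, w]) (levelChart u c (𝒦.e i)) := by
  rw [continuousOn_iff_continuous_domRestrict]
  refine ((hβ.1 _ (chart_mem_atlas E (𝒦.p i))).comp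
    (continuous_levelPoint hc hu (chart_mem_atlas E _) v w)).congr fun z => ?_
  exact (levelField_apply hc hu β z.2 v w).symm

theorem levelField_eq_zero {β : LevelTwoForm E u c} {K : Set {x : X // u x = c}}
    (hK : β.support ⊆ K) {i : ℕ} {z : E} (hz : (𝒦.e i).symm z ∉ Subtype.val '' K) :
    levelField 𝒦 hc hu β i z = 0 := by
  by_cases h : z ∈ levelChart u c (𝒦.e i)
  · have h0 : β ⟨(𝒦.e i).symm z, h.2⟩ = 0 := by
      by_contra h'
      exact hz ⟨_, hK (subset_closure h'), rfl⟩
    rw [levelField, dif_pos h, h0]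
    rfl
  · exact levelField_of_notMem hc hu β h

/-- A compact part of the level set. -/
def levelCore (𝒦 : Cover E X) (u : X → ℝ) (c : ℝ) (i : ℕ) : Set E :=
  closedBall (𝒦.c i) (𝒦.r i) ∩ (u ∘ (𝒦.e i).symm) ⁻¹' {c}

theorem levelCore_subset (i : ℕ) : levelCore 𝒦 u c i ⊆ levelChart u c (𝒦.e i) := fun _ hz =>
  ⟨𝒦.closedBall_subset_target i (by linarith [𝒦.r_pos i]) hz.1, hz.2⟩

theorem isCompact_levelCore (huc : Continuous u) (i : ℕ) : IsCompact (levelCore 𝒦 u c i) := by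
  have := FiniteDimensional.proper ℝ E
  have h1 : closedBall (𝒦.c i) (𝒦.r i) ⊆ (𝒦.e i).target :=
    𝒦.closedBall_subset_target i (by linarith [𝒦.r_pos i])
  exact (isCompact_closedBall _ _).of_isClosed_subset
    ((huc.comp_continuousOn ((𝒦.e i).continuousOn_symm.mono h1)).preimage_isClosed_of_isClosed
      isClosed_closedBall isClosed_singleton) inter_subset_left

theorem mem_levelCore {i : ℕ} {z : E} (hz : z ∈ 𝒦.B i) (h : z ∈ levelChart u c (𝒦.e i)) :
    z ∈ levelCore 𝒦 u c i := ⟨ball_subset_closedBall hz, h.2⟩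

theorem exists_bound_nrm_levelField {β : LevelTwoForm E u c} (hβ : β ∈ levelForms E u c) (i : ℕ) :
    ∃ M, ∀ z ∈ 𝒦.B i, nrm (levelField 𝒦 hc hu β i z) ≤ M := by
  have h1 : ContinuousOn (fun z => nrm (levelField 𝒦 hc hu β i z)) (levelCore 𝒦 u c i) := by
    have h := fun v w => (continuousOn_levelField hc hu hβ (𝒦 := 𝒦) i v w).mono
      (levelCore_subset i)
    unfold nrm
    exact continuousOn_finsetSum _ fun j _ => continuousOn_finsetSum _ fun k _ =>
      (h _ _).norm.add (h _ _).norm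
  obtain ⟨M, hM⟩ := (isCompact_levelCore (𝒦 := 𝒦) (c := c) hu.continuous i).exists_bound_of_continuousOn h1
  refine ⟨max M 0, fun z hz => ?_⟩
  by_cases h : z ∈ levelChart u c (𝒦.e i)
  · exact ((le_abs_self _).trans (hM z (mem_levelCore hz h))).trans (le_max_left _ _)
  · rw [levelField_of_notMem hc hu β h]
    refine le_trans (le_of_eq ?_) (le_max_right _ _)
    simp [nrm]

/-- `nrm` involves only finitely many pairs of vectors, and on a compact piece of the level set
their projections are bounded. -/
theorem tendsto_nrm_levelField {β : ℕ → levelForms E u c}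
    (h : ∀ e ∈ atlas E X, ∀ L ⊆ e.target, IsCompact L →
      TendstoUniformlyOn (fun j => LevelTwoForm.inChart (β j).1 e) 0 atTop
        {p | p.1.1 ∈ L ∧ ‖p.1.2.1‖ ≤ 1 ∧ ‖p.1.2.2‖ ≤ 1}) (i : ℕ) {δ : ℝ} (hδ : 0 < δ) :
    ∀ᶠ j in atTop, ∀ z ∈ 𝒦.B i, nrm (levelField 𝒦 hc hu (β j).1 i z) ≤ δ := by
  have hK := isCompact_levelCore (𝒦 := 𝒦) (c := c) hu.continuous i
  have he : 𝒦.e i ∈ atlas E X := chart_mem_atlas E _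
  have key : ∀ v w : E, ∀ ε > 0, ∀ᶠ j in atTop, ∀ z ∈ 𝒦.B i,
      ‖levelField 𝒦 hc hu (β j).1 i z ![v, w]‖ ≤ ε := by
    intro v w ε hε
    have hb := fun v => hK.exists_bound_of_continuousOn
      ((continuousOn_levelProj_fderiv hc hu he v).mono (levelCore_subset i))
    obtain ⟨M₁, hM₁⟩ := hb v
    obtain ⟨M₂, hM₂⟩ := hb w
    -- The hypothesis concerns vectors of norm at most one. Dividing `v` and `w` by `R` brings their
    -- projections there, and bilinearity costs a factor `R²`.
    set R := max (max M₁ M₂) 1 with hR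
    have hR1 : 1 ≤ R := le_max_right _ _
    have hR0 : 0 < R := by linarith
    have h1 := Metric.tendstoUniformlyOn_iff.1
      (h _ he _ (fun z hz => (levelCore_subset i hz).1) hK) (ε / R ^ 2) (by positivity)
    filter_upwards [h1] with j hj z hz
    by_cases hzc : z ∈ levelChart u c (𝒦.e i)
    swap
    · rw [levelField_of_notMem hc hu _ hzc]
      simpa using hε.le
    have hz' := mem_levelCore hz hzc
    have hs : ∀ (v : E) {M : ℝ}, (∀ x ∈ levelCore 𝒦 u c i,
        ‖levelProj (fderiv ℝ (u ∘ (𝒦.e i).symm) x) v‖ ≤ M) → M ≤ R →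
        ‖levelProj (fderiv ℝ (u ∘ (𝒦.e i).symm) z) (R⁻¹ • v)‖ ≤ 1 := by
      intro v M hM hMR
      rw [map_smul, norm_smul, norm_inv, Real.norm_of_nonneg hR0.le, inv_mul_le_iff₀ hR0, mul_one]
      exact (hM z hz').trans hMR
    have h2 := hj (levelPoint hc hu he ⟨z, hzc⟩ (R⁻¹ • v) (R⁻¹ • w))
      ⟨hz', hs v hM₁ ((le_max_left _ _).trans (le_max_left _ _)),
        hs w hM₂ ((le_max_right _ _).trans (le_max_left _ _))⟩
    rw [← levelField_apply hc hu _ hzc, Alt2.smul_left, Alt2.smul_right, Pi.zero_apply,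
      dist_zero_left, norm_smul, norm_smul, norm_inv, Real.norm_of_nonneg hR0.le,
      lt_div_iff₀ (by positivity)] at h2
    have h3 : R⁻¹ * (R⁻¹ * ‖levelField 𝒦 hc hu (β j).1 i z ![v, w]‖) * R ^ 2 =
        ‖levelField 𝒦 hc hu (β j).1 i z ![v, w]‖ := by field_simp
    rw [h3] at h2
    exact h2.le
  set N : ℝ := ∑ _j : Idx E, ∑ _k : Idx E, (1 + 1) with hN
  have hN0 : 0 ≤ N := by positivity
  have h1 : ∀ᶠ j in atTop, ∀ a b : Idx E, (∀ z ∈ 𝒦.B i,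
      ‖levelField 𝒦 hc hu (β j).1 i z ![bas E a, bas E b]‖ ≤ δ / (N + 1)) ∧ (∀ z ∈ 𝒦.B i,
      ‖levelField 𝒦 hc hu (β j).1 i z ![Complex.I • bas E a, Complex.I • bas E b]‖ ≤ δ / (N + 1)) :=
    eventually_all.2 fun a => eventually_all.2 fun b =>
      (key _ _ _ (by positivity)).and (key _ _ _ (by positivity))
  filter_upwards [h1] with j hj z hz
  calc nrm (levelField 𝒦 hc hu (β j).1 i z)
      ≤ ∑ _j : Idx E, ∑ _k : Idx E, (δ / (N + 1) + δ / (N + 1)) :=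
        Finset.sum_le_sum fun a _ => Finset.sum_le_sum fun b _ =>
          add_le_add ((hj a b).1 z hz) ((hj a b).2 z hz)
    _ = N * (δ / (N + 1)) := by
        simp only [hN, Finset.sum_mul]
        refine Finset.sum_congr rfl fun _ _ => Finset.sum_congr rfl fun _ _ => by ring
    _ ≤ (N + 1) * (δ / (N + 1)) := by gcongr; linarith
    _ = δ := by field_simp

namespace Density

variable [MeasurableSpace E] [BorelSpace E] (τ : Density 𝒦)

/-- In each ball the field is continuous on the trace of a compact piece of the level set and zero
elsewhere; the jump is harmless for measurability. -/
theorem measurable_evalField_level {β : LevelTwoForm E u c} (hβ : β ∈ levelForms E u c) :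
    Measurable (τ.evalField (levelField 𝒦 hc hu β)) := by
  refine τ.measurable_evalField fun i v w => ?_
  have hm : MeasurableSet (levelCore 𝒦 u c i) :=
    (isCompact_levelCore hu.continuous i).isClosed.measurableSet
  have h1 : Measurable ((levelCore 𝒦 u c i).indicator
      fun z => levelField 𝒦 hc hu β i z ![v, w]) := by
    classical
    rw [← piecewise_eq_indicator]
    exact ((continuousOn_levelField hc hu hβ i v w).mono
      (levelCore_subset i)).measurable_piecewise continuousOn_const hm
  have h2 := h1.indicator (isOpen_ball (x := 𝒦.c i) (ε := 𝒦.r i)).measurableSet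
  convert h2 using 1
  funext z
  by_cases hz : z ∈ 𝒦.B i
  · rw [indicator_of_mem hz, indicator_of_mem hz]
    by_cases h : z ∈ levelCore 𝒦 u c i
    · rw [indicator_of_mem h]
    · rw [indicator_of_notMem h, levelField_of_notMem hc hu β fun h' => h (mem_levelCore hz h')]
      rfl
  · rw [indicator_of_notMem hz, indicator_of_notMem hz]

theorem integrable_level {β : LevelTwoForm E u c} (hβ : β ∈ levelForms E u c)
    (σ : Measure (ℕ × E)) [IsFiniteMeasure σ] :
    Integrable (τ.evalField (levelField 𝒦 hc hu β)) σ := by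
  have hK : IsCompact (Subtype.val '' β.support : Set X) := hβ.2.image continuous_subtype_val
  have hI := 𝒦.finite_meeting hK
  choose C hC0 hC using τ.val_bound
  choose M hM using exists_bound_nrm_levelField (𝒦 := 𝒦) hc hu hβ
  refine Integrable.of_bound (τ.measurable_evalField_level hc hu hβ).aestronglyMeasurable
    ((∑ i ∈ hI.toFinset, C i) * ∑ i ∈ hI.toFinset, |M i|) (Eventually.of_forall fun o => ?_)
  refine τ.exists_bound_evalField hI (fun i hi z _ hz2 => levelField_eq_zero hc hu subset_rfl
    fun h => hi ⟨_, hz2, h⟩) hC hC0 (fun i hi z hz _ => ?_)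
    (Finset.sum_nonneg fun _ _ => abs_nonneg _) o
  exact ((hM i z hz).trans (le_abs_self _)).trans
    (Finset.single_le_sum (f := fun i => |M i|) (fun i _ => abs_nonneg _) (hI.mem_toFinset.2 hi))

/-- The current defined on a regular level set by a density and a measure. -/
def levelCurrent (σ : Measure (ℕ × E)) [IsFiniteMeasure σ] : LevelCurrent E u c where
  toFun :=
    { toFun := fun β => ∫ o, τ.evalField (levelField 𝒦 hc hu β.1) o ∂σ
      map_add' := fun β γ => by
        rw [← integral_add (τ.integrable_level hc hu β.2 σ) (τ.integrable_level hc hu γ.2 σ)]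
        refine integral_congr_ae (Eventually.of_forall fun o => ?_)
        change τ.val o _ = τ.val o _ + τ.val o _
        rw [← val_add, ← levelField_add]
        rfl
      map_smul' := fun a β => by
        rw [RingHom.id_apply, smul_eq_mul, ← integral_const_mul]
        refine integral_congr_ae (Eventually.of_forall fun o => ?_)
        change τ.val o _ = a * τ.val o _
        rw [← val_smul, ← levelField_smul]
        rfl }
  continuous' := by
    intro K β hK hβK h
    have hK' : IsCompact (Subtype.val '' K : Set X) := hK.image continuous_subtype_val
    have hI := 𝒦.finite_meeting hK'
    choose C hC0 hC using τ.val_bound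
    set S := ∑ i ∈ hI.toFinset, C i
    have hS : 0 ≤ S := Finset.sum_nonneg fun i _ => hC0 i
    have hR : 0 ≤ σ.real univ := measureReal_nonneg
    rw [Metric.tendsto_nhds]
    intro ε hε
    set δ := ε / (S * σ.real univ + 1) with hδdef
    have hδ : 0 < δ := by positivity
    have h1 : ∀ᶠ j in atTop, ∀ i ∈ hI.toFinset, ∀ z ∈ 𝒦.B i,
        nrm (levelField 𝒦 hc hu (β j).1 i z) ≤ δ :=
      (Finset.eventually_all _).2 fun i _ => tendsto_nrm_levelField hc hu h i hδ
    filter_upwards [h1] with j hj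
    rw [dist_zero_right]
    have hb : ∀ o, ‖τ.evalField (levelField 𝒦 hc hu (β j).1) o‖ ≤ S * δ := fun o =>
      τ.exists_bound_evalField hI (fun i hi z _ hz2 => levelField_eq_zero hc hu (hβK j)
        fun h => hi ⟨_, hz2, h⟩) hC hC0 (fun i hi z hz _ => hj i (hI.mem_toFinset.2 hi) z hz)
        hδ.le o
    refine (norm_integral_le_of_norm_le_const (μ := σ) (Eventually.of_forall hb)).trans_lt ?_
    have h2 : S * δ * σ.real univ = ε * ((S * σ.real univ) / (S * σ.real univ + 1)) := by
      rw [hδdef]; ring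
    rw [h2]
    refine mul_lt_of_lt_one_right hε ((div_lt_one (by positivity)).2 (by linarith))

/-- Both sides are integrals over points of the level set, and the integrands agree there because
the functional at such a point does not distinguish a form from its pull-back by the projection to
the tangent space. -/
theorem isPushforward_current (σ : Measure (ℕ × E)) [IsFiniteMeasure σ]
    (h1 : ∀ᵐ o ∂σ, 𝒦.pull u o = c)
    (h2 : ∀ᵐ o ∂σ, τ.val o (gam (fderiv ℝ (u ∘ (𝒦.e o.1).symm) o.2)
      (fderiv ℝ (u ∘ (𝒦.e o.1).symm) o.2)) = 0) :
    IsPushforward (τ.current σ) hu.continuous (τ.levelCurrent hc hu σ) := by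
  intro α
  refine integral_congr_ae ?_
  filter_upwards [h1, h2] with o ho1 ho2
  by_cases hB : o.2 ∈ 𝒦.B o.1
  · have h3 : o.2 ∈ levelChart u c (𝒦.e o.1) := ⟨𝒦.B_subset_target _ hB, by
      rw [← ho1]; exact (indicator_of_mem hB fun z => u ((𝒦.e o.1).symm z)).symm⟩
    rw [evalField, evalField, levelField_restrict hc hu _ h3]
    exact τ.val_eq_val_comp ho2 _ _
  · rw [τ.evalField_eq_zero hB, τ.evalField_eq_zero hB]

end Density

end Level

/-! ### Assembling the disintegration -/

section Main

variable {E : Type*} [NormedAddCommGroup E] [NormedSpace ℂ E]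
variable {X : Type*} [TopologicalSpace X] [ChartedSpace E X]

theorem Current.ext_ev {S T : Current E X} (h : ∀ α ∈ testForms E X, S.ev α = T.ev α) : S = T := by
  have h1 : S.toFun = T.toFun := LinearMap.ext fun α => by
    have := h α.1 α.2
    rwa [S.ev_eq α.2, T.ev_eq α.2] at this
  cases S
  cases T
  congr

variable [IsManifold 𝓘(ℂ, E) ω X]

/-- On an empty manifold the only current is zero. A point is needed to index the cover by all of
`ℕ`. -/
theorem Current.IsLevi.nonempty {T : Current E X} (hT : T.IsLevi) : Nonempty X := by
  by_contra h
  rw [not_nonempty_iff] at h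
  refine hT.ne_zero (Current.ext_ev fun α hα => ?_)
  have h0 : α = 0 := funext fun x => h.elim x
  have h1 : (⟨α, hα⟩ : testForms E X) = 0 := Subtype.ext h0
  rw [T.ev_eq hα, Current.ev_eq _ hα, h1, map_zero, map_zero]

theorem isPushforward_zero (E : Type*) [NormedAddCommGroup E] [NormedSpace ℂ E]
    {X : Type*} [TopologicalSpace X] [ChartedSpace E X] {u : X → ℝ} (hu : Continuous u) (c : ℝ) :
    ∃ S : LevelCurrent E u c, IsPushforward (0 : Current E X) hu S :=
  ⟨⟨0, fun _ _ _ _ _ => tendsto_const_nhds⟩, fun _ => rfl⟩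

/-- Levi currents disintegrate along the level sets of continuous plurisubharmonic functions. -/
theorem Current.IsLevi.exists_disintegration {E : Type*} [NormedAddCommGroup E] [NormedSpace ℂ E] [FiniteDimensional ℂ E]
    {X : Type*} [TopologicalSpace X] [T2Space X] [SecondCountableTopology X]
    [ChartedSpace E X] [IsManifold 𝓘(ℂ, E) ω X]
    {T : Current E X} (hT : T.IsLevi)
    {u : X → ℝ} (hu : IsPshZero E u) :
    ∃ (μ : Measure ℝ) (Tc : ℝ → Current E X),
      IsLocallyFiniteMeasure μ ∧
      (∀ c, (Tc c).support ⊆ {x | u x = c}) ∧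
      (∀ᵐ c ∂μ, Tc c ≠ 0) ∧
      (∀ c, Tc c ≠ 0 → (Tc c).IsLevi) ∧
      (∀ α : testForms E X,
        Integrable (fun c => Tc c α) μ ∧ T α = ∫ c, Tc c α ∂μ) ∧
      (ContMDiff 𝓘(ℝ, E) 𝓘(ℝ, ℝ) 1 u → ∀ c, IsRegularValue E u c →
        ∃ S : LevelCurrent E u c,
          IsPushforward (Tc c) hu.continuous S) := by
  classical
  borelize E
  have := hT.nonempty
  obtain ⟨𝒦⟩ := exists_cover (E := E) (X := X)
  obtain ⟨σ, hσ, τ, hτ⟩ := exists_current_eq hT.pos hT.bidim 𝒦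
  obtain ⟨D, hDS, hD, hDd⟩ := exists_countable_dense_forms 𝒦 (testForms E X : Set (TwoForm E X))
    subset_rfl
  set μ := σ.map (𝒦.pull u) with hμ
  set κ := fun c => τ.fiberCurrent σ u c with hκ
  have hpull := 𝒦.measurable_pull hu.continuous
  -- These properties hold for almost every `c`. At the other values the current is set to zero, so
  -- that the conclusions stated for every `c` hold without exception.
  let Good : ℝ → Prop := fun c => (∀ᵐ o ∂fiberKernel σ (𝒦.pull u) c, 𝒦.pull u o = c) ∧
    (κ c ≠ 0 → (κ c).IsLevi) ∧ (ContMDiff 𝓘(ℝ, E) 𝓘(ℝ, ℝ) 1 u →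
      ∀ᵐ o ∂fiberKernel σ (𝒦.pull u) c, τ.val o (gam (fderiv ℝ (u ∘ (𝒦.e o.1).symm) o.2)
        (fderiv ℝ (u ∘ (𝒦.e o.1).symm) o.2)) = 0)
  have hGood : ∀ᵐ c ∂μ, Good c := by
    refine (ae_fiberKernel_eq hpull).and ((τ.ae_fiberCurrent_isLevi hT hτ hu).and ?_)
    by_cases hu1 : ContMDiff 𝓘(ℝ, E) 𝓘(ℝ, ℝ) 1 u
    · exact (ae_fiberKernel hpull (τ.ae_val_gam_eq_zero hT hτ hu hu1)).mono fun c hc _ => hc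
    · exact Eventually.of_forall fun c h => absurd h hu1
  -- A countable family `D` detects whether `κ c` vanishes, so the set of values where it does not
  -- is measurable. Restricting `μ` to it makes the fiber currents nonzero almost everywhere, and
  -- changes no integral since off `A` they vanish on all test forms.
  let A : Set ℝ := ⋃ α ∈ D, {c | (κ c).ev α ≠ 0}
  have hA : MeasurableSet A := MeasurableSet.biUnion hD fun α hα =>
    (measurableSet_eq_fun (τ.measurable_fiberCurrent u (hDS hα)) measurable_const).compl
  have hA0 : ∀ c ∉ A, ∀ α ∈ testForms E X, (κ c).ev α = 0 := by
    intro c hc α hα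
    rw [hκ, τ.fiberCurrent_ev u c hα]
    refine hDd τ _ (fun β hβ => ?_) α hα
    rw [← τ.fiberCurrent_ev u c (hDS hβ)]
    by_contra h
    exact hc (mem_biUnion hβ h)
  let Tc : ℝ → Current E X := fun c => if Good c then κ c else 0
  have hTc : ∀ c, Good c → Tc c = κ c := fun c h => if_pos h
  have hTc0 : ∀ c, ¬ Good c → Tc c = 0 := fun c h => if_neg h
  have hev : ∀ α : testForms E X, (fun c => Tc c α) =ᵐ[μ] fun c => (κ c).ev α.1 := by
    intro α
    filter_upwards [hGood] with c hc
    rw [hTc c hc, Current.ev_eq _ α.2]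
  refine ⟨μ.restrict A, Tc, inferInstance, fun c => ?_, ?_, fun c hc => ?_, fun α => ⟨?_, ?_⟩,
    fun hu1 c hc => ?_⟩
  · by_cases h : Good c
    · rw [hTc c h]
      exact τ.fiberCurrent_support hu.continuous h.1
    · rw [hTc0 c h]
      intro x hx
      obtain ⟨α, -, h2⟩ := hx univ isOpen_univ trivial
      exact absurd rfl h2
  · filter_upwards [ae_restrict_of_ae hGood, ae_restrict_mem hA] with c hc hcA h0
    obtain ⟨α, hα, h1⟩ := mem_iUnion₂.1 hcA
    refine h1 ?_
    rw [← hTc c hc, h0, Current.ev_eq _ (hDS hα)]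
    rfl
  · by_cases h : Good c
    · rw [hTc c h] at hc ⊢
      exact h.2.1 hc
    · exact absurd (hTc0 c h) hc
  · exact ((τ.integrable_fiberCurrent u α.2).congr (hev α).symm).restrict
  · rw [integral_congr_ae (ae_restrict_of_ae (hev α)),
      setIntegral_eq_integral_of_forall_compl_eq_zero fun c hc => hA0 c hc _ α.2,
      τ.integral_fiberCurrent hτ hu.continuous α.2, T.ev_eq α.2]
  · by_cases h : Good c
    · rw [hTc c h]
      exact ⟨_, τ.isPushforward_current hc hu1 _ h.1 (h.2.2 hu1)⟩
    · rw [hTc0 c h]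
      exact isPushforward_zero E hu.continuous c

end Main

end

end LeviCurrents

theorem mainTheorem4 {E : Type*} [NormedAddCommGroup E] [NormedSpace ℂ E] [FiniteDimensional ℂ E]
    {X : Type*} [TopologicalSpace X] [T2Space X] [SecondCountableTopology X]
    [ChartedSpace E X] [IsManifold 𝓘(ℂ, E) ω X]
    (T : LeviCurrents.Current E X) (hT : T.IsLevi)
    (u : X → ℝ) (hu : LeviCurrents.IsPshZero E u) :
    ∃ (μ : MeasureTheory.Measure ℝ) (Tc : ℝ → LeviCurrents.Current E X),
      MeasureTheory.IsLocallyFiniteMeasure μ ∧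
      (∀ c, (Tc c).support ⊆ {x | u x = c}) ∧
      (∀ᵐ c ∂μ, Tc c ≠ 0) ∧
      (∀ c, Tc c ≠ 0 → (Tc c).IsLevi) ∧
      (∀ α : LeviCurrents.testForms E X,
        MeasureTheory.Integrable (fun c => Tc c α) μ ∧ T α = ∫ c, Tc c α ∂μ) ∧
      (ContMDiff 𝓘(ℝ, E) 𝓘(ℝ, ℝ) 1 u → ∀ c, LeviCurrents.IsRegularValue E u c →
        ∃ S : LeviCurrents.LevelCurrent E u c,
          LeviCurrents.IsPushforward (Tc c) hu.continuous S) :=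
  hT.exists_disintegration hu
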